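/- Let $N\in\mathbb N$, $s\in(0,1)$, $\alpha\in(0,N)$, $\theta\in(0,\alpha)$ with $2s<N<2s+\alpha$, put $2^*_s:=\frac{2N}{N-2s}$ and $\gamma_\alpha:=\frac{\pi^{N/2}2^\alpha\Gamma(\alpha/2)}{\Gamma(N/2-\alpha/2)}$. Let $V:\mathbb R^N\to\mathbb R$ be continuous, attaining its minimum $V_0$, with $$0<V_0=\min_{\mathbb R^N}V<V_\infty:=\liminf_{|x|\to\infty}V(x)\in(V_0,+\infty],$$ and let $f:\mathbb R\to\mathbb R$ satisfy (f1) $f\in C^1(\mathbb R)$ and $f(t)=0$ for $t\le 0$; (f2) $\lim_{t\to0}f(t)/t=0$; (f3) there is $q_0\in(2,2^*_s-1)$ with $\lim_{t\to\infty}f(t)/t^{q_0}=0$; (f4) there is $K>4$ with $0<KF(t)\le tf(t)$ for all $t>0$, where $F(t):=\int_0^tf(\tau)\,d\tau$; (f5) $t\mapsto f(t)/t^3$ is strictly increasing on $(0,\infty)$. Functions are real-valued. The fractional powers of $-\Delta$ are defined by Fourier transform, $(-\Delta)^\beta$ having symbol $|\xi|^{2\beta}$; $H^s(\mathbb R^N)=\{u\in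 L^2:(-\Delta)^{s/2}u\in L^2\}$; and $\dot H^{\alpha/2}(\mathbb R^N)\subset L^{2N/(N-\alpha)}(\mathbb R^N)$ is the completion of $C_c^\infty(\mathbb R^N)$ in the norm $|(-\Delta)^{\alpha/4}\cdot|_2$. For $\varepsilon>0$ consider the system $$(P^*_\varepsilon)\qquad (-\Delta)^su+V(\varepsilon x)u+\phi u=f(u),\qquad (-\Delta)^{\alpha/2}\phi=\varepsilon^{\alpha-\theta}\gamma_\alpha u^2\qquad\text{in }\mathbb R^N.$$ Let $W_\varepsilon:=\{u\in H^s(\mathbb R^N):\int V(\varepsilon x)u^2<\infty\}$, with scalar product $(u,v)_\varepsilon=\int(-\Delta)^{s/2}u(-\Delta)^{s/2}v+\int V(\varepsilon x)uv$ and norm $\|u\|_\varepsilon$. For $u\in H^s(\mathbb R^N)$ let $\phi_{\varepsilon,u}\in\dot H^{\alpha/2}(\mathbb R^N)$ be the unique weak solution of the second equation, i.e. $\int(-\Delta)^{\alpha/4}\phi_{\varepsilon,u}(-\Delta)^{\alpha/4}v=\varepsilon^{\alpha-\theta}\gamma_\alpha\int u^2v$ for all $v\in\dot H^{\alpha/2}(\mathbb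 R^N)$. Put $$I_\varepsilon(u):=\tfrac12\|u\|_\varepsilon^2+\tfrac14\int\phi_{\varepsilon,u}u^2-\int F(u),\qquad \mathcal N_\varepsilon:=\Big\{u\in W_\varepsilon\setminus\{0\}:\|u\|_\varepsilon^2+\int\phi_{\varepsilon,u}u^2=\int f(u)u\Big\}.$$ A ground state solution of $(P^*_\varepsilon)$ is a $u\in W_\varepsilon\setminus\{0\}$ such that $(u,\phi_{\varepsilon,u})$ is a weak solution of $(P^*_\varepsilon)$, that is, $$(u,v)_\varepsilon+\int\phi_{\varepsilon,u}uv=\int f(u)v\qquad\text{for all }v\in W_\varepsilon,$$ and $u$ has least energy: $u\in\mathcal N_\varepsilon$ and $I_\varepsilon(u)=\min_{\mathcal N_\varepsilon}I_\varepsilon$. Then: 1. if $V_\infty<\infty$, there is $\bar\varepsilon>0$ such that for every $\varepsilon\in(0,\bar\varepsilon]$ problem $(P^*_\varepsilon)$ has a ground state solution in $W_\varepsilon$; 2. if $V_\infty=\infty$, problem $(P^*_\varepsilon)$ has a ground state solution in $W_\varepsilon$ for every $\varepsilon>0$. -/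

import Mathlib

open MeasureTheory Filter Topology Set

namespace FracSP

open scoped FourierTransform ENNReal ContDiff

noncomputable section

/-- The Euclidean space `ℝ^N`. -/
abbrev E (N : ℕ) : Type := EuclideanSpace ℝ (Fin N)

/-- Real-valued `L²(ℝ^N)`. -/
abbrev L2 (N : ℕ) : Type := Lp ℝ 2 (volume : Measure (E N))

/-- A real-valued `L²` function regarded as a complex-valued one. -/
def toC {N : ℕ} (u : L2 N) : Lp ℂ 2 (volume : Measure (E N)) :=
  Complex.ofRealCLM.compLp u

/-- `g = (-Δ)^β u` with `u, g ∈ L²(ℝ^N)`, through the Fourier transform.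
Mathlib's Fourier transform has the kernel `exp (-2πi ⟪x, ξ⟫)`, so the symbol of `-Δ`
is `(2π|ξ|)^2` and that of `(-Δ)^β` is `(2π|ξ|)^(2β)`. -/
def HasFracLap {N : ℕ} (β : ℝ) (u g : L2 N) : Prop :=
  ((𝓕 (toC g) : Lp ℂ 2 (volume : Measure (E N))) : E N → ℂ) =ᵐ[volume]
    fun ξ => (((2 * Real.pi * ‖ξ‖) ^ (2 * β) : ℝ) : ℂ) *
      ((𝓕 (toC u) : Lp ℂ 2 (volume : Measure (E N))) : E N → ℂ) ξ

theorem toC_injective {N : ℕ} : Function.Injective (toC (N := N)) := by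
  intro u v h
  apply Lp.ext
  have hu := ContinuousLinearMap.coeFn_compLp Complex.ofRealCLM u
  have hv := ContinuousLinearMap.coeFn_compLp Complex.ofRealCLM v
  have h' : Complex.ofRealCLM.compLp u = Complex.ofRealCLM.compLp v := h
  rw [h'] at hu
  filter_upwards [hu, hv] with x h1 h2
  rw [h1] at h2
  simpa using h2

/-- `(-Δ)^β u` is unique. -/
theorem HasFracLap.unique {N : ℕ} {β : ℝ} {u g h : L2 N}
    (hg : HasFracLap β u g) (hh : HasFracLap β u h) : g = h := by
  apply toC_injective
  apply (Lp.fourierTransformₗᵢ (E N) ℂ).injective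
  exact Lp.ext (hg.trans hh.symm)

/-- `u ∈ H^s(ℝ^N)`: `u ∈ L²` and `(-Δ)^(s/2) u ∈ L²`. -/
def MemHs {N : ℕ} (s : ℝ) (u : L2 N) : Prop :=
  ∃ g : L2 N, HasFracLap (s / 2) u g

open Classical in
/-- `(-Δ)^β u` when this belongs to `L²`, and `0` otherwise. -/
def fracLap {N : ℕ} (β : ℝ) (u : L2 N) : L2 N :=
  if h : ∃ g : L2 N, HasFracLap β u g then h.choose else 0

theorem HasFracLap.fracLap_eq {N : ℕ} {β : ℝ} {u g : L2 N} (h : HasFracLap β u g) :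
    fracLap β u = g := by
  have h' : ∃ g : L2 N, HasFracLap β u g := ⟨g, h⟩
  rw [fracLap, dif_pos h']
  exact h'.choose_spec.unique h

/-- `w` is (the class of) a function in `C_c^∞(ℝ^N)`. -/
def IsTest {N : ℕ} (w : L2 N) : Prop :=
  ∃ η : E N → ℝ, ContDiff ℝ ∞ η ∧ HasCompactSupport η ∧ (w : E N → ℝ) =ᵐ[volume] η

/-- The Sobolev exponent `2N/(N-α)` of `Ḣ^(α/2)(ℝ^N)`. -/
def pStar (N : ℕ) (α : ℝ) : ℝ≥0∞ := ENNReal.ofReal (2 * N / (N - α))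

/-- `L^(2N/(N-α))(ℝ^N)`, the space in which `Ḣ^(α/2)(ℝ^N)` is embedded. -/
abbrev LStar (N : ℕ) (α : ℝ) : Type := Lp ℝ (pStar N α) (volume : Measure (E N))

/-- `φ ∈ Ḣ^(α/2)(ℝ^N)` and `g = (-Δ)^(α/4) φ ∈ L²(ℝ^N)`, where `Ḣ^(α/2)(ℝ^N)` is the completion
of `C_c^∞(ℝ^N)` in the norm `|(-Δ)^(α/4) w|_2`. The completion is realised in `L^(2N/(N-α))` by
the Sobolev embedding: `φ` is the limit there of test functions `w n` for which
`(-Δ)^(α/4) (w n)` converges to `g` in `L²`. -/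
def HasHomFracLap {N : ℕ} (α : ℝ) (φ : LStar N α) (g : L2 N) : Prop :=
  ∃ w h : ℕ → L2 N,
    (∀ n, IsTest (w n) ∧ HasFracLap (α / 4) (w n) (h n)) ∧
    Tendsto h atTop (𝓝 g) ∧
    Tendsto (fun n => eLpNorm (fun x => (w n : E N → ℝ) x - (φ : E N → ℝ) x) (pStar N α) volume)
      atTop (𝓝 0)

/-- The constant `γ_α`. -/
def gammaConst (N : ℕ) (α : ℝ) : ℝ :=
  Real.pi ^ ((N : ℝ) / 2) * 2 ^ α * Real.Gamma (α / 2) / Real.Gamma ((N : ℝ) / 2 - α / 2)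

/-- `φ ∈ Ḣ^(α/2)(ℝ^N)` is a weak solution of `(-Δ)^(α/2) φ = ε^(α-θ) γ_α u²`, tested against
every `v ∈ Ḣ^(α/2)(ℝ^N)`. -/
def IsPoissonSol {N : ℕ} (α θ ε : ℝ) (u : L2 N) (φ : LStar N α) : Prop :=
  ∃ g : L2 N, HasHomFracLap α φ g ∧
    ∀ (v : LStar N α) (h : L2 N), HasHomFracLap α v h →
      ∫ x, g x * h x = ε ^ (α - θ) * gammaConst N α * ∫ x, (u x) ^ 2 * v x

open Classical in
/-- `φ_{ε,u}`, the weak solution in `Ḣ^(α/2)(ℝ^N)` of `(-Δ)^(α/2) φ = ε^(α-θ) γ_α u²`. -/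
def phi {N : ℕ} (α θ ε : ℝ) (u : L2 N) : LStar N α :=
  if h : ∃ φ : LStar N α, IsPoissonSol α θ ε u φ then h.choose else 0

/-- `u ∈ W_ε`: `u ∈ H^s(ℝ^N)` and `∫ V(εx) u² < ∞`. -/
def MemW {N : ℕ} (s : ℝ) (V : E N → ℝ) (ε : ℝ) (u : L2 N) : Prop :=
  MemHs s u ∧ Integrable (fun x => V (ε • x) * (u x) ^ 2)

/-- The scalar product `(u, v)_ε` of `W_ε`. -/
def innerW {N : ℕ} (s : ℝ) (V : E N → ℝ) (ε : ℝ) (u v : L2 N) : ℝ :=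
  (∫ x, fracLap (s / 2) u x * fracLap (s / 2) v x) + ∫ x, V (ε • x) * u x * v x

/-- `F(t) = ∫_0^t f`. -/
def primitive (f : ℝ → ℝ) (t : ℝ) : ℝ := ∫ τ in (0 : ℝ)..t, f τ

/-- The functional `I_ε` on `W_ε`. -/
def energy {N : ℕ} (s α θ : ℝ) (V : E N → ℝ) (f : ℝ → ℝ) (ε : ℝ) (u : L2 N) : ℝ :=
  1 / 2 * innerW s V ε u u + 1 / 4 * (∫ x, phi α θ ε u x * (u x) ^ 2)
    - ∫ x, primitive f (u x)

/-- The Nehari manifold `N_ε = {u ∈ W_ε \ {0} : I_ε'(u)[u] = 0}`. -/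
def nehari {N : ℕ} (s α θ : ℝ) (V : E N → ℝ) (f : ℝ → ℝ) (ε : ℝ) : Set (L2 N) :=
  {u | MemW s V ε u ∧ u ≠ 0 ∧
    innerW s V ε u u + (∫ x, phi α θ ε u x * (u x) ^ 2) - (∫ x, f (u x) * u x) = 0}

/-- `(u, φ) ∈ W_ε × Ḣ^(α/2)` is a weak solution of the system
`(-Δ)^s u + V(εx) u + φ u = f(u)`, `(-Δ)^(α/2) φ = ε^(α-θ) γ_α u²`. -/
structure IsWeakSol {N : ℕ} (s α θ : ℝ) (V : E N → ℝ) (f : ℝ → ℝ) (ε : ℝ)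
    (u : L2 N) (φ : LStar N α) : Prop where
  memW : MemW s V ε u
  schrodinger : ∀ v : L2 N, MemW s V ε v →
    innerW s V ε u v + (∫ x, φ x * u x * v x) = ∫ x, f (u x) * v x
  poisson : IsPoissonSol α θ ε u φ

/-- `u` is a ground state solution: a nontrivial weak solution (with `φ = φ_{ε,u}`) whose energy is
the ground state level, the minimum of `I_ε` on the Nehari manifold. -/
structure IsGroundState {N : ℕ} (s α θ : ℝ) (V : E N → ℝ) (f : ℝ → ℝ) (ε : ℝ)
    (u : L2 N) : Prop where
  ne_zero : u ≠ 0
  weakSol : IsWeakSol s α θ V f ε u (phi α θ ε u)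
  isLeast : IsLeast (energy s α θ V f ε '' nehari s α θ V f ε) (energy s α θ V f ε u)

/-- `V_∞ = liminf_{|x| → ∞} V(x)`, with values in `[-∞, ∞]`. -/
def Vinf {N : ℕ} (V : E N → ℝ) : EReal :=
  liminf (fun x => (V x : EReal)) (Bornology.cobounded (E N))

end

end FracSP

open MeasureTheory Filter Topology Set

namespace FracSP

open scoped FourierTransform ENNReal ContDiff SchwartzMap

noncomputable section

/-! ### The Fourier transform on `L¹` and on `L²` -/

section Fourier

variable {N : ℕ}

/-! Along a ray the energy is `t²/2 ‖u‖² + t⁴/4 D - ∫ F(tu)`, with `D` the Poisson energy of `u`,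
and `F` grows faster than `t⁴`. Since `f(t)/t³` increases, a point of the Nehari manifold maximises
the energy on its ray, and `4F(t) ≤ t f(t)` gives `I_ε ≥ ‖u‖²/4` there. Minimising sequences are
therefore bounded in `W_ε`; the only obstruction to a minimum is mass escaping to infinity, where
the potential is at least some `μ`.

Escape is measured by the level `m_μ` of the autonomous problem with constant potential `μ` and no
Poisson term. Along a minimising sequence `u + v_n` with `v_n ⇀ 0`, local compactness gives `v_n →
0` in `L²` on balls. Then the energy of `t(u + v_n)` is, up to an error uniform for bounded `t`, at
least the energy of `t u` plus the autonomous energy of `t v_n`: weak convergence splits the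
quadratic part, a Brezis-Lieb estimate splits `∫ F`, and the Poisson energy is lower semicontinuous.
If the infimum `c` is below `m_μ`, evaluating at the autonomous Nehari point of `v_n` is
contradictory unless the Nehari point on the ray of `u` already has energy at most `c`. This yields
a minimiser without Palais-Smale sequences (`Setting.exists_minimiser`). A minimiser is a weak
solution because a descent direction could be corrected along the ray so as to stay on the manifold
(`Setting.nonneg_of_isLeast`).

It remains to get `c < m_μ`. If `V_∞` is finite, take `V₀ < μ < V_∞`: then `m_μ` exceeds `m_{V₀}`
(`Setting.exists_level_gap`), while test functions moved to a minimum point of `V(εx)` push the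
level of the problem almost below `m_{V₀}` for small `ε`, since the factor `ε^(α-θ)` kills the
Poisson term (`Setting.exists_nehari_energy_le`). If `V_∞` is infinite, `m_μ` tends to infinity with
`μ` (`Setting.exists_level_ge`), so it can be placed above the energy of any given Nehari point.

The functional analysis rests on the Fourier transform. Cutting into low and high frequencies gives
the Sobolev inequality (`exists_sobolev_lintegral`) and local compactness
(`tendsto_setIntegral_sq_of_weak`). Test functions are dense in the graph of `(-Δ)^β`
(`exists_test_near`), and the Poisson equation is solved by Riesz representation (`exists_isRiesz`).
-/

lemma integral_fourier_mul_flip {φ G : E N → ℂ} (hφ : Integrable φ) (hG : Integrable G) :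
    ∫ ξ, 𝓕 φ ξ * G ξ = ∫ x, φ x * 𝓕 G x := by
  have h := VectorFourier.integral_fourierIntegral_smul_eq_flip (e := Real.fourierChar)
    (μ := (volume : Measure (E N))) (ν := (volume : Measure (E N))) (L := innerₗ (E N))
    Real.continuous_fourierChar continuous_inner hφ hG
  rw [flip_innerₗ] at h
  exact h

lemma integral_fourierInv_mul_flip {φ G : E N → ℂ} (hφ : Integrable φ) (hG : Integrable G) :
    ∫ ξ, 𝓕⁻ φ ξ * G ξ = ∫ x, φ x * 𝓕⁻ G x := by
  have h := integral_fourier_mul_flip hφ hG.comp_neg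
  simp_rw [Real.fourierInv_eq_fourier_neg]
  have h1 : ∫ ξ, 𝓕 φ (-ξ) * G ξ = ∫ ξ, 𝓕 φ ξ * G (-ξ) := by
    rw [← integral_neg_eq_self (fun ξ => 𝓕 φ (-ξ) * G ξ)]
    simp
  rw [h1, h]
  congr 1; ext x
  rw [← Real.fourierInv_eq_fourier_neg, ← Real.fourierInv_eq_fourier_comp_neg]

lemma continuous_fourier_of_integrable {G : E N → ℂ} (hG : Integrable G) : Continuous (𝓕 G) :=
  VectorFourier.fourierIntegral_continuous Real.continuous_fourierChar continuous_inner hG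

lemma continuous_fourierInv_of_integrable {G : E N → ℂ} (hG : Integrable G) :
    Continuous (𝓕⁻ G) := by
  have : 𝓕⁻ G = fun x => 𝓕 G (-x) := by ext x; rw [Real.fourierInv_eq_fourier_neg]
  rw [this]
  exact (continuous_fourier_of_integrable hG).comp continuous_neg

/-- A real test function as a complex Schwartz function. -/
def testSchwartz {g : E N → ℝ} (hg : ContDiff ℝ ∞ g) (hg' : HasCompactSupport g) : 𝓢(E N, ℂ) :=
  HasCompactSupport.toSchwartzMap (f := fun x => (g x : ℂ))
    (hg'.comp_left (g := fun t : ℝ => (t : ℂ)) (by simp)) (Complex.ofRealCLM.contDiff.comp hg)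

lemma testSchwartz_apply {g : E N → ℝ} (hg : ContDiff ℝ ∞ g) (hg' : HasCompactSupport g)
    (x : E N) : testSchwartz hg hg' x = (g x : ℂ) := rfl

/-- Reconciles the abstract transform on `L²` with the integral formula on `L¹`: paired with a test
function, the first is computed as a tempered distribution and the second by Fubini, with the same
result. -/
theorem fourierInv_toLp_ae_eq {G : E N → ℂ} (h1 : Integrable G) (h2 : MemLp G 2 volume) :
    (𝓕⁻ (h2.toLp G) : Lp ℂ 2 (volume : Measure (E N))) =ᵐ[volume] 𝓕⁻ G := by
  apply ae_eq_of_integral_contDiff_smul_eq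
  · exact (Lp.memLp _).locallyIntegrable (by norm_num)
  · exact (continuous_fourierInv_of_integrable h1).locallyIntegrable
  intro g hg hg'
  have e := congrArg (fun T => T (testSchwartz hg hg'))
    (Lp.fourierInv_toTemperedDistribution_eq (h2.toLp G))
  simp only [TemperedDistribution.fourierInv_apply, Lp.toTemperedDistribution_apply] at e
  simp only [testSchwartz_apply] at e
  have e2 : ∫ x, g x • (𝓕⁻ (h2.toLp G) : Lp ℂ 2 (volume : Measure (E N))) x
      = ∫ x, (𝓕⁻ (testSchwartz hg hg')) x * G x := by
    calc _ = _ := e.symm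
      _ = _ := by
        apply integral_congr_ae
        filter_upwards [h2.coeFn_toLp] with x hx
        rw [hx, smul_eq_mul]
  rw [e2, SchwartzMap.fourierInv_coe,
    integral_fourierInv_mul_flip (testSchwartz hg hg').integrable h1]
  rfl

/-- Injectivity of the Fourier transform on `L¹`. -/
theorem ae_eq_zero_of_fourierInv_eq_zero {G : E N → ℂ} (h1 : Integrable G)
    (h0 : ∀ x, 𝓕⁻ G x = 0) : G =ᵐ[volume] 0 := by
  apply ae_eq_zero_of_integral_contDiff_smul_eq_zero h1.locallyIntegrable
  intro g hg hg'
  -- Pairing with the transform of the test function makes the inverse transform return the test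
  -- function itself.
  have e := integral_fourierInv_mul_flip (𝓕 (testSchwartz hg hg')).integrable h1
  simp only [h0, mul_zero, integral_zero] at e
  rw [← SchwartzMap.fourierInv_coe, FourierTransform.fourierInv_fourier_eq] at e
  simpa [testSchwartz_apply] using e

/-! ### Real functions -/

lemma coeFn_toC (u : L2 N) : (toC u : E N → ℂ) =ᵐ[volume] fun x => (u x : ℂ) :=
  ContinuousLinearMap.coeFn_compLp Complex.ofRealCLM u

/-- The Fourier transform of a real `L²` function. -/
def ft : L2 N →L[ℝ] Lp ℂ 2 (volume : Measure (E N)) :=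
  ((Lp.fourierTransformₗᵢ (E N) ℂ).toContinuousLinearEquiv.toContinuousLinearMap.restrictScalars
    ℝ).comp (Complex.ofRealCLM.compLpL 2 volume)

lemma ft_apply (u : L2 N) : ft u = 𝓕 (toC u) := rfl

lemma norm_toC (u : L2 N) : ‖toC u‖ = ‖u‖ := by
  rw [Lp.norm_def, Lp.norm_def]
  congr 1
  apply eLpNorm_congr_norm_ae
  filter_upwards [coeFn_toC u] with x hx
  rw [hx]; simp

lemma norm_ft (u : L2 N) : ‖ft u‖ = ‖u‖ := by
  rw [ft_apply, Lp.norm_fourier_eq, norm_toC]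

lemma inner_ft (u v : L2 N) : inner ℂ (ft u) (ft v) = ((inner ℝ u v : ℝ) : ℂ) := by
  rw [ft_apply, ft_apply, Lp.inner_fourier_eq, L2.inner_def, L2.inner_def, ← integral_complex_ofReal]
  apply integral_congr_ae
  filter_upwards [coeFn_toC u, coeFn_toC v] with x h1 h2
  rw [h1, h2]; simp

/-- The symbol `|2πξ|^(2β)` of `(-Δ)^β`. -/
def symb (β : ℝ) (ξ : E N) : ℝ := (2 * Real.pi * ‖ξ‖) ^ (2 * β)

lemma symb_nonneg (β : ℝ) (ξ : E N) : 0 ≤ symb β ξ := by unfold symb; positivity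

lemma symb_neg (β : ℝ) (ξ : E N) : symb β (-ξ) = symb β ξ := by simp [symb]

lemma continuous_symb {β : ℝ} (hβ : 0 ≤ β) : Continuous (symb (N := N) β) := by
  unfold symb
  apply Continuous.rpow_const (by fun_prop)
  intro x; right; linarith

lemma hasFracLap_iff {β : ℝ} {u g : L2 N} :
    HasFracLap β u g ↔ ft g =ᵐ[volume] fun ξ => (symb β ξ : ℂ) * ft u ξ := Iff.rfl

lemma HasFracLap.add {β : ℝ} {u g v h : L2 N} (hu : HasFracLap β u g) (hv : HasFracLap β v h) :
    HasFracLap β (u + v) (g + h) := by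
  rw [hasFracLap_iff] at *
  rw [map_add, map_add]
  filter_upwards [hu, hv, Lp.coeFn_add (ft u) (ft v), Lp.coeFn_add (ft g) (ft h)] with x a b c d
  rw [d, c, Pi.add_apply, Pi.add_apply, a, b]; ring

lemma HasFracLap.smul {β : ℝ} {u g : L2 N} (c : ℝ) (hu : HasFracLap β u g) :
    HasFracLap β (c • u) (c • g) := by
  rw [hasFracLap_iff] at *
  rw [map_smul, map_smul]
  filter_upwards [hu, Lp.coeFn_smul c (ft u), Lp.coeFn_smul c (ft g)] with x a b d
  rw [d, b, Pi.smul_apply, Pi.smul_apply, a]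
  simp only [Complex.real_smul]; ring

lemma HasFracLap.sub {β : ℝ} {u g v h : L2 N} (hu : HasFracLap β u g) (hv : HasFracLap β v h) :
    HasFracLap β (u - v) (g - h) := by
  have := hu.add (hv.smul (-1))
  simpa [sub_eq_add_neg] using this

lemma HasFracLap.zero {β : ℝ} : HasFracLap β (0 : L2 N) 0 := by
  rw [hasFracLap_iff, map_zero]
  filter_upwards [Lp.coeFn_zero ℂ 2 (volume : Measure (E N))] with x hx
  rw [hx]; simp

/-- Convergence in `L²` implies a.e. convergence of a subsequence. -/
lemma exists_subseq_ae_tendsto {F : Type*} [NormedAddCommGroup F]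
    {u : ℕ → Lp F 2 (volume : Measure (E N))} {v : Lp F 2 (volume : Measure (E N))}
    (h : Tendsto u atTop (𝓝 v)) : ∃ φ : ℕ → ℕ, StrictMono φ ∧
      ∀ᵐ x, Tendsto (fun n => u (φ n) x) atTop (𝓝 (v x)) :=
  (tendstoInMeasure_of_tendsto_Lp h).exists_seq_tendsto_ae

/-- The graph of `(-Δ)^β` is closed: on the Fourier side the relation is pointwise, and it survives
a.e. convergence along a subsequence common to both sequences. -/
lemma HasFracLap.of_tendsto {β : ℝ} {u g : ℕ → L2 N} {v h : L2 N}
    (hn : ∀ n, HasFracLap β (u n) (g n)) (hu : Tendsto u atTop (𝓝 v))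
    (hg : Tendsto g atTop (𝓝 h)) : HasFracLap β v h := by
  rw [hasFracLap_iff]
  obtain ⟨φ, hφ, h1⟩ := exists_subseq_ae_tendsto ((ft.continuous.tendsto v).comp hu)
  obtain ⟨ψ, hψ, h2⟩ := exists_subseq_ae_tendsto
    (((ft.continuous.tendsto h).comp hg).comp hφ.tendsto_atTop)
  have h3 : ∀ᵐ x, ∀ n, ft (g n) x = (symb β x : ℂ) * ft (u n) x :=
    ae_all_iff.2 fun n => hn n
  filter_upwards [h1, h2, h3] with x a b c
  simp only [Function.comp] at a b
  refine tendsto_nhds_unique b ?_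
  simp only [c]
  exact (a.comp hψ.tendsto_atTop).const_mul _

end Fourier

/-! ### Fractional Laplacians of test functions and frequency splitting -/

section Test

variable {N : ℕ}

lemma norm_sq_eq_integral {F : Type*} [NormedAddCommGroup F] (f : Lp F 2 (volume : Measure (E N))) :
    ‖f‖ ^ 2 = ∫ x, ‖f x‖ ^ 2 := by
  rw [Lp.norm_def, (Lp.memLp f).eLpNorm_eq_integral_rpow_norm (by norm_num) (by norm_num)]
  have h0 : 0 ≤ ∫ x, ‖f x‖ ^ 2 := integral_nonneg fun x => by positivity
  simp only [ENNReal.toReal_ofNat, Real.rpow_ofNat]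
  rw [ENNReal.toReal_ofReal (by positivity), ← Real.rpow_natCast, ← Real.rpow_mul h0]
  norm_num

lemma integrable_norm_sq {F : Type*} [NormedAddCommGroup F] (f : Lp F 2 (volume : Measure (E N))) :
    Integrable fun x => ‖f x‖ ^ 2 :=
  (Lp.memLp f).integrable_norm_pow (by norm_num)

lemma integrable_sq (f : L2 N) : Integrable fun x => (f x) ^ 2 := by
  simpa using integrable_norm_sq f

lemma norm_sq_eq_integral_real (f : L2 N) : ‖f‖ ^ 2 = ∫ x, (f x) ^ 2 := by
  simpa using norm_sq_eq_integral f

lemma inner_eq_integral (f g : L2 N) : inner ℝ f g = ∫ x, f x * g x := by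
  rw [L2.inner_def]
  congr 1; ext x; simp [mul_comm]

lemma ft_test {w : L2 N} {η : E N → ℝ} (h1 : ContDiff ℝ ∞ η) (h2 : HasCompactSupport η)
    (hw : (w : E N → ℝ) =ᵐ[volume] η) :
    ft w =ᵐ[volume] (𝓕 (testSchwartz h1 h2) : 𝓢(E N, ℂ)) := by
  have : toC w = (testSchwartz h1 h2).toLp 2 := by
    apply Lp.ext
    filter_upwards [coeFn_toC w, hw, (testSchwartz h1 h2).coeFn_toLp 2] with x a b c
    rw [a, b, c, testSchwartz_apply]
  rw [ft_apply, this, SchwartzMap.toLp_fourier_eq]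
  exact SchwartzMap.coeFn_toLp _ 2 volume

lemma conj_fourierChar (t : ℝ) :
    (starRingEnd ℂ) (Real.fourierChar t : ℂ) = (Real.fourierChar (-t) : ℂ) := by
  rw [← Circle.coe_inv_eq_conj, AddChar.map_neg_eq_inv]

lemma conj_fourier_real (η : E N → ℝ) (ξ : E N) :
    (starRingEnd ℂ) (𝓕 (fun x => (η x : ℂ)) ξ) = 𝓕 (fun x => (η x : ℂ)) (-ξ) := by
  rw [Real.fourier_eq, Real.fourier_eq, ← integral_conj]
  congr 1; ext v
  simp only [Circle.smul_def, smul_eq_mul, map_mul, conj_fourierChar, Complex.conj_ofReal,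
    inner_neg_right]

/-- Hermitian symmetry on the Fourier side means that the function is real; this lets `(-Δ)^β w` be
built over `ℂ` and then taken real-valued. -/
lemma conj_fourierInv_of_symm {k : E N → ℂ} (hk : ∀ ξ, (starRingEnd ℂ) (k ξ) = k (-ξ)) (x : E N) :
    (starRingEnd ℂ) (𝓕⁻ k x) = 𝓕⁻ k x := by
  rw [Real.fourierInv_eq, ← integral_conj, ← integral_neg_eq_self]
  congr 1; ext v
  simp only [Circle.smul_def, smul_eq_mul, map_mul, conj_fourierChar, hk, inner_neg_left, neg_neg]

/-- The symbol grows at most like `(1 + |ξ|)^m` with `m = ⌈2β⌉`; Schwartz decay of order `m + N + 1`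
leaves a power integrable over `ℝ^N`. -/
lemma symb_mul_schwartz_bound {β : ℝ} (hβ : 0 ≤ β) (ψ : 𝓢(E N, ℂ)) :
    ∃ C : ℝ, 0 ≤ C ∧ ∀ ξ, ‖(symb β ξ : ℂ) * ψ ξ‖ ≤ C * (1 + ‖ξ‖) ^ (-((N : ℝ) + 1)) := by
  set m : ℕ := ⌈2 * β⌉₊
  set C0 : ℝ := 2 ^ (m + N + 1) *
    ((Finset.Iic (m + N + 1, 0)).sup fun m => SchwartzMap.seminorm ℝ m.1 m.2) ψ
  have hψ : ∀ ξ, (1 + ‖ξ‖) ^ (m + N + 1) * ‖ψ ξ‖ ≤ C0 := fun ξ => by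
    have := SchwartzMap.one_add_le_sup_seminorm_apply (𝕜 := ℝ) (m := (m + N + 1, 0))
      (k := m + N + 1) (n := 0) le_rfl le_rfl ψ ξ
    simpa using this
  have hC0 : 0 ≤ C0 := (by positivity : (0 : ℝ) ≤ (1 + ‖(0 : E N)‖) ^ (m + N + 1) * ‖ψ 0‖).trans
    (hψ 0)
  refine ⟨(2 * Real.pi) ^ (2 * β) * C0, by positivity, fun ξ => ?_⟩
  have h1 : symb β ξ ≤ (2 * Real.pi) ^ (2 * β) * (1 + ‖ξ‖) ^ m := by
    unfold symb
    rw [Real.mul_rpow (by positivity) (by positivity)]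
    gcongr
    calc ‖ξ‖ ^ (2 * β) ≤ (1 + ‖ξ‖) ^ (2 * β) := by gcongr; linarith
      _ ≤ (1 + ‖ξ‖) ^ (m : ℝ) := by
        apply Real.rpow_le_rpow_of_exponent_le
        · linarith [norm_nonneg ξ]
        · exact Nat.le_ceil _
      _ = _ := Real.rpow_natCast _ _
  have hp : (0 : ℝ) < 1 + ‖ξ‖ := by positivity
  have h2 : (1 + ‖ξ‖) ^ (-((N : ℝ) + 1)) = ((1 + ‖ξ‖) ^ (N + 1))⁻¹ := by
    rw [Real.rpow_neg hp.le, ← Real.rpow_natCast]; push_cast; rfl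
  rw [norm_mul, Complex.norm_real, Real.norm_of_nonneg (symb_nonneg _ _), h2, ← div_eq_mul_inv,
    le_div_iff₀ (by positivity)]
  calc symb β ξ * ‖ψ ξ‖ * (1 + ‖ξ‖) ^ (N + 1)
      ≤ (2 * Real.pi) ^ (2 * β) * (1 + ‖ξ‖) ^ m * ‖ψ ξ‖ * (1 + ‖ξ‖) ^ (N + 1) := by gcongr
    _ = (2 * Real.pi) ^ (2 * β) * ((1 + ‖ξ‖) ^ (m + N + 1) * ‖ψ ξ‖) := by ring
    _ ≤ _ := by gcongr; exact hψ ξ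

lemma integrable_memLp_of_bound {k : E N → ℂ} (hk : Continuous k) {C : ℝ} (hC : 0 ≤ C)
    (h : ∀ ξ, ‖k ξ‖ ≤ C * (1 + ‖ξ‖) ^ (-((N : ℝ) + 1))) : Integrable k ∧ MemLp k 2 volume := by
  have h1 : Integrable k := by
    refine Integrable.mono' ((integrable_one_add_norm (E := E N) (r := (N : ℝ) + 1)
      (by simp)).const_mul C) hk.aestronglyMeasurable (ae_of_all _ h)
  refine ⟨h1, ?_⟩
  have hb : ∀ ξ, ‖k ξ‖ ≤ C := fun ξ => (h ξ).trans (by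
    refine mul_le_of_le_one_right hC ?_
    apply Real.rpow_le_one_of_one_le_of_nonpos
    · linarith [norm_nonneg ξ]
    · have : (0 : ℝ) ≤ N := Nat.cast_nonneg N
      linarith)
  rw [memLp_two_iff_integrable_sq_norm hk.aestronglyMeasurable]
  refine Integrable.mono' (h1.norm.const_mul C) (by fun_prop) (ae_of_all _ fun ξ => ?_)
  rw [Real.norm_of_nonneg (by positivity), sq]
  gcongr
  exact hb ξ

/-- `(-Δ)^β w` exists for test functions `w`. -/
theorem IsTest.exists_hasFracLap {w : L2 N} (hw : IsTest w) {β : ℝ} (hβ : 0 ≤ β) :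
    ∃ h, HasFracLap β w h := by
  obtain ⟨η, h1, h2, h3⟩ := hw
  set ψ := 𝓕 (testSchwartz h1 h2)
  set k : E N → ℂ := fun ξ => (symb β ξ : ℂ) * ψ ξ
  obtain ⟨C, hC, hb⟩ := symb_mul_schwartz_bound hβ ψ
  have hkc : Continuous k :=
    (Complex.continuous_ofReal.comp (continuous_symb hβ)).mul ψ.continuous
  obtain ⟨hk1, hk2⟩ := integrable_memLp_of_bound hkc hC hb
  have hsym : ∀ ξ, (starRingEnd ℂ) (k ξ) = k (-ξ) := fun ξ => by
    have : ∀ ξ, ψ ξ = 𝓕 (fun x => (η x : ℂ)) ξ := fun ξ => by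
      simp only [ψ, SchwartzMap.fourier_coe]; rfl
    simp only [k, map_mul, Complex.conj_ofReal, symb_neg, this, conj_fourier_real]
  set G : Lp ℂ 2 (volume : Measure (E N)) := 𝓕⁻ (hk2.toLp k)
  have hG : G =ᵐ[volume] 𝓕⁻ k := fourierInv_toLp_ae_eq hk1 hk2
  refine ⟨Complex.reCLM.compLp G, ?_⟩
  have e : toC (Complex.reCLM.compLp G) = G := by
    apply Lp.ext
    filter_upwards [coeFn_toC (Complex.reCLM.compLp G), Complex.reCLM.coeFn_compLp G, hG]
      with x a b c
    rw [a, b, c]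
    exact Complex.conj_eq_iff_re.1 (conj_fourierInv_of_symm hsym x)
  rw [hasFracLap_iff, ft_apply, e, FourierTransform.fourier_fourierInv_eq]
  filter_upwards [hk2.coeFn_toLp, ft_test h1 h2 h3] with x a b
  rw [a, b]

/-- Splitting of an `L²` function into low and high frequencies. -/
theorem exists_low_high (u : L2 N) (A : ℝ) : ∃ h : Lp ℂ 2 (volume : Measure (E N)),
    ‖h‖ ^ 2 = ∫ ξ in (Metric.ball 0 A)ᶜ, ‖ft u ξ‖ ^ 2 ∧
    ∀ᵐ x, (u x : ℂ) = 𝓕⁻ ((Metric.ball 0 A).indicator (ft u)) x + h x := by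
  have hm : MeasurableSet (Metric.ball (0 : E N) A) := measurableSet_ball
  have hl : MemLp ((Metric.ball 0 A).indicator (ft u)) 2 volume := (Lp.memLp (ft u)).indicator hm
  have hh : MemLp ((Metric.ball 0 A)ᶜ.indicator (ft u)) 2 volume :=
    (Lp.memLp (ft u)).indicator hm.compl
  have hl1 : Integrable ((Metric.ball 0 A).indicator (ft u)) := by
    rw [integrable_indicator_iff hm]
    have : IsFiniteMeasure ((volume : Measure (E N)).restrict (Metric.ball 0 A)) :=
      ⟨by simpa using measure_ball_lt_top⟩
    exact ((Lp.memLp (ft u)).restrict _).integrable (by norm_num)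
  refine ⟨𝓕⁻ (hh.toLp _), ?_, ?_⟩
  · have : ‖(𝓕⁻ (hh.toLp _) : Lp ℂ 2 (volume : Measure (E N)))‖ = ‖hh.toLp _‖ := by
      rw [← Lp.norm_fourier_eq, FourierTransform.fourier_fourierInv_eq]
    rw [this, norm_sq_eq_integral, ← integral_indicator hm.compl]
    apply integral_congr_ae
    filter_upwards [hh.coeFn_toLp] with x hx
    rw [hx]
    by_cases h : x ∈ (Metric.ball (0 : E N) A)ᶜ <;> simp [h, indicator]
  · have e : toC u = 𝓕⁻ (hl.toLp _) + 𝓕⁻ (hh.toLp _) := by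
      rw [← FourierTransform.fourierInv_add]
      refine (FourierTransform.fourierInv_fourier_eq (F := Lp ℂ 2 (volume : Measure (E N)))
        (toC u)).symm.trans ?_
      rw [← ft_apply]
      congr 1
      apply Lp.ext
      filter_upwards [Lp.coeFn_add (hl.toLp _) (hh.toLp _), hl.coeFn_toLp, hh.coeFn_toLp]
        with x a b c
      rw [a, Pi.add_apply, b, c]
      exact (congrFun (indicator_self_add_compl _ _) x).symm
    filter_upwards [coeFn_toC u, Lp.coeFn_add (𝓕⁻ (hl.toLp _)) (𝓕⁻ (hh.toLp _)),
      fourierInv_toLp_ae_eq hl1 hl] with x a b c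
    rw [← a, e, b, Pi.add_apply, c]

end Test

/-! ### The fractional Sobolev inequality -/

section Sobolev

variable {N : ℕ}

lemma integral_mul_le_sqrt {α : Type*} [MeasurableSpace α] {μ : Measure α} {f g : α → ℝ}
    (hf0 : 0 ≤ᵐ[μ] f) (hg0 : 0 ≤ᵐ[μ] g) (hf : MemLp f 2 μ) (hg : MemLp g 2 μ) :
    ∫ a, f a * g a ∂μ ≤ √(∫ a, f a ^ 2 ∂μ) * √(∫ a, g a ^ 2 ∂μ) := by
  have := integral_mul_le_Lp_mul_Lq_of_nonneg (p := 2) (q := 2) Real.HolderConjugate.two_two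
    hf0 hg0 (by simpa using hf) (by simpa using hg)
  simpa [Real.sqrt_eq_rpow] using this

/-- Polar coordinates give integrability, the radial exponent `N - 1 - 2σ` being above `-1`; the
substitution `ξ ↦ Aξ` gives the power of `A`. The summand `1` in the constant only ensures
positivity. -/
lemma integral_ball_norm_rpow {σ : ℝ} (hN : 2 * σ < N) :
    ∃ K : ℝ, 0 < K ∧ ∀ A : ℝ, 0 < A →
      IntegrableOn (fun ξ : E N => ‖ξ‖ ^ (-(2 * σ))) (Metric.ball 0 A) ∧
      ∫ ξ in Metric.ball (0 : E N) A, ‖ξ‖ ^ (-(2 * σ)) ≤ K * A ^ ((N : ℝ) - 2 * σ) := by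
  -- For `N = 0` the hypothesis forces `σ < 0`, and the integrand vanishes identically.
  rcases Nat.eq_zero_or_pos N with h0 | hpos
  · subst h0
    refine ⟨1 + ∫ ξ : E 0, ‖ξ‖ ^ (-(2 * σ)), ?_, fun A hA => ⟨?_, ?_⟩⟩
    · have : 0 ≤ ∫ ξ : E 0, ‖ξ‖ ^ (-(2 * σ)) := integral_nonneg fun ξ => by positivity
      linarith
    · have : IsFiniteMeasure ((volume : Measure (E 0)).restrict (Metric.ball 0 A)) :=
        ⟨by simp⟩
      exact Integrable.of_finite
    · have h : ∀ ξ : E 0, ‖ξ‖ ^ (-(2 * σ)) = 0 := fun ξ => by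
        rw [Subsingleton.elim ξ 0, norm_zero, Real.zero_rpow]
        push_cast at hN; linarith
      simp only [h, integral_zero]
      positivity
  have : Nontrivial (E N) := by
    have : Nonempty (Fin N) := ⟨⟨0, hpos⟩⟩
    infer_instance
  have hint : ∀ A : ℝ, 0 < A →
      IntegrableOn (fun ξ : E N => ‖ξ‖ ^ (-(2 * σ))) (Metric.ball 0 A) := fun A hA => by
    rw [integrableOn_fun_norm_addHaar volume (f := fun y : ℝ => y ^ (-(2 * σ)))]
    have h1 := (intervalIntegral.integrableOn_Ioo_rpow_iff (s := (N : ℝ) - 1 - 2 * σ) hA).2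
      (by linarith)
    refine h1.congr_fun (fun y hy => ?_) measurableSet_Ioo
    simp only [finrank_euclideanSpace, Fintype.card_fin, smul_eq_mul]
    rw [← Real.rpow_natCast, ← Real.rpow_add hy.1]
    congr 1
    rw [Nat.cast_sub hpos]; push_cast; ring
  refine ⟨1 + ∫ ξ in Metric.ball (0 : E N) 1, ‖ξ‖ ^ (-(2 * σ)), ?_, fun A hA => ⟨hint A hA, ?_⟩⟩
  · have : 0 ≤ ∫ ξ in Metric.ball (0 : E N) 1, ‖ξ‖ ^ (-(2 * σ)) :=
      integral_nonneg fun ξ => by positivity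
    linarith
  · have h := Measure.setIntegral_comp_smul_of_pos (volume : Measure (E N))
      (fun ξ => ‖ξ‖ ^ (-(2 * σ))) (Metric.ball 0 1) hA
    rw [smul_unitBall_of_pos hA] at h
    simp only [norm_smul, Real.norm_of_nonneg hA.le, finrank_euclideanSpace, Fintype.card_fin,
      smul_eq_mul] at h
    simp_rw [Real.mul_rpow hA.le (norm_nonneg _)] at h
    rw [integral_const_mul] at h
    have hAN : A ^ N = A ^ (N : ℝ) := (Real.rpow_natCast _ _).symm
    have e : ∫ ξ in Metric.ball (0 : E N) A, ‖ξ‖ ^ (-(2 * σ)) =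
        A ^ ((N : ℝ) - 2 * σ) * ∫ ξ in Metric.ball (0 : E N) 1, ‖ξ‖ ^ (-(2 * σ)) := by
      rw [sub_eq_add_neg, Real.rpow_add hA, ← hAN, mul_assoc, h, ← mul_assoc,
        mul_inv_cancel₀ (by positivity), one_mul]
    rw [e, add_mul, one_mul, mul_comm]
    have : 0 < A ^ ((N : ℝ) - 2 * σ) := by positivity
    nlinarith

lemma HasFracLap.norm_ft_sq {σ : ℝ} {u g : L2 N} (h : HasFracLap (σ / 2) u g) :
    ∀ᵐ ξ, ‖ft g ξ‖ = (2 * Real.pi * ‖ξ‖) ^ σ * ‖ft u ξ‖ := by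
  filter_upwards [hasFracLap_iff.1 h] with ξ hξ
  rw [hξ, norm_mul, Complex.norm_real, Real.norm_of_nonneg (symb_nonneg _ _), symb]
  congr 2; ring

lemma norm_fourierInv_le (G : E N → ℂ) (x : E N) : ‖𝓕⁻ G x‖ ≤ ∫ ξ, ‖G ξ‖ := by
  rw [Real.fourierInv_eq]
  refine (norm_integral_le_integral_norm _).trans (le_of_eq ?_)
  congr 1; ext ξ
  rw [Circle.norm_smul]

/-- The low-frequency part of a function is bounded by its homogeneous Sobolev norm. -/
lemma exists_low_bound {σ : ℝ} (hσ : 0 < σ) (hN : 2 * σ < N) :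
    ∃ K : ℝ, 0 < K ∧ ∀ (u g : L2 N), HasFracLap (σ / 2) u g → ∀ A : ℝ, 0 < A → ∀ x : E N,
      ‖𝓕⁻ ((Metric.ball 0 A).indicator (ft u)) x‖ ≤ K * A ^ (((N : ℝ) - 2 * σ) / 2) * ‖g‖ := by
  obtain ⟨K, hK, hKA⟩ := integral_ball_norm_rpow hN
  refine ⟨√K, Real.sqrt_pos.2 hK, fun u g hug A hA x => ?_⟩
  have hm : MeasurableSet (Metric.ball (0 : E N) A) := measurableSet_ball
  have hpos : 0 < N := by
    rcases Nat.eq_zero_or_pos N with h | h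
    · subst h; push_cast at hN; linarith
    · exact h
  have : Nontrivial (E N) := by
    have : Nonempty (Fin N) := ⟨⟨0, hpos⟩⟩
    infer_instance
  obtain ⟨hi, hle⟩ := hKA A hA
  set B := Metric.ball (0 : E N) A
  have hne : ∀ᵐ ξ : E N, ξ ≠ 0 := by
    rw [ae_iff]; simp
  -- The factor `(2π)^σ ≥ 1` is discarded. Cauchy-Schwarz then pairs `|ξ|^(-σ)`, square integrable
  -- on the ball, with the transform of `g`.
  have hpt : ∀ᵐ ξ ∂(volume.restrict B), ‖ft u ξ‖ ≤ ‖ξ‖ ^ (-σ) * ‖ft g ξ‖ := by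
    apply ae_restrict_of_ae
    filter_upwards [hug.norm_ft_sq, hne] with ξ h1 h2
    have h3 : 0 < ‖ξ‖ := norm_pos_iff.2 h2
    rw [h1, Real.mul_rpow (by positivity) h3.le, Real.rpow_neg h3.le]
    have : 1 ≤ (2 * Real.pi) ^ σ := Real.one_le_rpow (by linarith [Real.pi_gt_three]) hσ.le
    have h5 : 0 < ‖ξ‖ ^ σ := by positivity
    calc ‖ft u ξ‖ ≤ (2 * Real.pi) ^ σ * ‖ft u ξ‖ := le_mul_of_one_le_left (norm_nonneg _) this
      _ = _ := by field_simp
  have hg2 : MemLp (fun ξ => ‖ft g ξ‖) 2 (volume.restrict B) :=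
    ((Lp.memLp (ft g)).restrict B).norm
  have hsq : ∀ ξ : E N, (‖ξ‖ ^ (-σ)) ^ 2 = ‖ξ‖ ^ (-(2 * σ)) := fun ξ => by
    rw [← Real.rpow_natCast, ← Real.rpow_mul (norm_nonneg _)]
    congr 1; push_cast; ring
  have hr2 : MemLp (fun ξ : E N => ‖ξ‖ ^ (-σ)) 2 (volume.restrict B) := by
    rw [memLp_two_iff_integrable_sq]
    · simp only [hsq]
      exact hi
    · exact (measurable_norm.pow_const _).aestronglyMeasurable
  calc ‖𝓕⁻ (B.indicator (ft u)) x‖ ≤ ∫ ξ, ‖B.indicator (ft u) ξ‖ := norm_fourierInv_le _ _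
    _ = ∫ ξ in B, ‖ft u ξ‖ := by
      rw [← integral_indicator hm]
      congr 1; ext ξ
      rw [norm_indicator_eq_indicator_norm]
    _ ≤ ∫ ξ in B, ‖ξ‖ ^ (-σ) * ‖ft g ξ‖ :=
      integral_mono_of_nonneg (ae_of_all _ fun _ => norm_nonneg _) (hr2.integrable_mul hg2) hpt
    _ ≤ √(∫ ξ in B, (‖ξ‖ ^ (-σ)) ^ 2) * √(∫ ξ in B, ‖ft g ξ‖ ^ 2) :=
      integral_mul_le_sqrt (ae_of_all _ fun _ => by positivity) (ae_of_all _ fun _ => norm_nonneg _)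
        hr2 hg2
    _ ≤ √(K * A ^ ((N : ℝ) - 2 * σ)) * √(‖g‖ ^ 2) := by
      gcongr
      · simpa only [hsq] using hle
      · rw [← norm_ft, norm_sq_eq_integral]
        exact setIntegral_le_integral (integrable_norm_sq _) (ae_of_all _ fun _ => by positivity)
    _ = _ := by
      rw [Real.sqrt_sq (norm_nonneg _), Real.sqrt_mul hK.le, Real.sqrt_eq_rpow (A ^ _),
        ← Real.rpow_mul hA.le]
      congr 3; ring

lemma lintegral_Ioc_rpow {a L : ℝ} (ha : 0 < a) (hL : 0 ≤ L) :
    ∫⁻ t in Ioc 0 L, ENNReal.ofReal (t ^ (a - 1)) = ENNReal.ofReal (L ^ a / a) := by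
  have hi : IntervalIntegrable (fun t : ℝ => t ^ (a - 1)) volume 0 L :=
    intervalIntegral.intervalIntegrable_rpow' (by linarith)
  rw [← ofReal_integral_eq_lintegral_ofReal]
  · rw [← intervalIntegral.integral_of_le hL, integral_rpow (Or.inl (by linarith))]
    simp [Real.zero_rpow ha.ne']
  · exact (intervalIntegrable_iff_integrableOn_Ioc_of_le hL).1 hi
  · filter_upwards [self_mem_ae_restrict measurableSet_Ioc] with t ht
    exact Real.rpow_nonneg ht.1.le _

lemma lintegral_norm_sq (f : Lp ℂ 2 (volume : Measure (E N))) :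
    ∫⁻ x, ENNReal.ofReal (‖f x‖ ^ 2) = ENNReal.ofReal (‖f‖ ^ 2) := by
  rw [norm_sq_eq_integral, ofReal_integral_eq_lintegral_ofReal (integrable_norm_sq f)
    (ae_of_all _ fun _ => by positivity)]

/-- The fractional Sobolev inequality, in integral form. -/
theorem exists_sobolev_lintegral {σ : ℝ} (hσ : 0 < σ) (hN : 2 * σ < N) :
    ∃ C : ℝ, 0 < C ∧ ∀ (u g : L2 N), HasFracLap (σ / 2) u g →
      ∫⁻ x, ENNReal.ofReal (|u x| ^ (2 * N / (N - 2 * σ) : ℝ)) ≤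
        ENNReal.ofReal (C * ‖g‖ ^ (2 * N / (N - 2 * σ) : ℝ)) := by
  obtain ⟨K, hK, hlow⟩ := exists_low_bound hσ hN
  set q : ℝ := 2 * N / (N - 2 * σ) with hq
  have hd : (0 : ℝ) < N - 2 * σ := by linarith
  have hq2 : q - 2 = 4 * σ / (N - 2 * σ) := by rw [hq]; field_simp; ring
  have hq2' : 0 < q - 2 := by rw [hq2]; positivity
  have hq0 : 0 < q := by linarith
  set b : ℝ := ((N : ℝ) - 2 * σ) / 2 with hb
  have hb0 : 0 < b := by positivity
  -- This relation singles out the critical exponent: it turns the weight `Λ^(q-2)` below into a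
  -- multiple of `|ξ|^(2σ)`.
  have hbq : b * (q - 2) = 2 * σ := by rw [hq2, hb]; field_simp; ring
  refine ⟨4 * q * ((2 * K) ^ (q - 2) / (q - 2)), by positivity, fun u g hug => ?_⟩
  -- If `g = 0` the cut-off below would divide by zero; then the transform of `u` vanishes off the
  -- origin, so `u = 0`.
  rcases eq_or_lt_of_le (norm_nonneg g) with hg0 | hgpos
  · have hg : g = 0 := norm_eq_zero.1 hg0.symm
    have hpos : 0 < N := by
      rcases Nat.eq_zero_or_pos N with h | h
      · subst h; push_cast at hN; linarith
      · exact h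
    have : Nontrivial (E N) := by
      have : Nonempty (Fin N) := ⟨⟨0, hpos⟩⟩
      infer_instance
    have hne : ∀ᵐ ξ : E N, ξ ≠ 0 := by
      rw [ae_iff]; simp
    have hu : u = 0 := by
      rw [← norm_eq_zero, ← norm_ft, norm_eq_zero]
      apply Lp.ext
      subst hg
      filter_upwards [hug.norm_ft_sq, hne, Lp.coeFn_zero ℂ 2 (volume : Measure (E N))]
        with ξ h1 h2 h3
      rw [map_zero, h3] at h1
      have h4 : 0 < ‖ξ‖ := norm_pos_iff.2 h2
      have h5 : (2 * Real.pi * ‖ξ‖) ^ σ ≠ 0 := by positivity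
      rw [h3]
      simpa [h5] using h1.symm
    have : ∫⁻ x, ENNReal.ofReal (|u x| ^ q) = 0 := by
      rw [lintegral_eq_zero_iff' (by
        exact ((Lp.stronglyMeasurable u).measurable.abs.pow_const q).ennreal_ofReal.aemeasurable)]
      subst hu
      filter_upwards [Lp.coeFn_zero ℝ 2 (volume : Measure (E N))] with x hx
      rw [hx]
      simp [Real.zero_rpow (by linarith : q ≠ 0)]
    rw [this]; exact zero_le
  set M := ‖g‖
  set c : ℝ := 2 * K * M
  have hc : 0 < c := by positivity
  set Λ : E N → ℝ := fun ξ => c * ‖ξ‖ ^ b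
  have hΛ0 : ∀ ξ, 0 ≤ Λ ξ := fun ξ => by positivity
  -- the distribution function of `u`
  have hdist : ∀ t : ℝ, 0 < t → volume {x | t < |u x|} ≤
      ENNReal.ofReal (4 / t ^ 2) * ∫⁻ ξ, {ξ | t ≤ Λ ξ}.indicator
        (fun ξ => ENNReal.ofReal (‖ft u ξ‖ ^ 2)) ξ := fun t ht => by
    -- The cut-off frequency depends on the level `t`: with this `A` the low-frequency part is at
    -- most `t/2`, so `|u| > t` forces the high-frequency part to be at least `t/2`, and Chebyshev's
    -- inequality applies.
    set A : ℝ := (t / c) ^ b⁻¹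
    have hA : 0 < A := by positivity
    have hAb : A ^ b = t / c := by
      rw [← Real.rpow_mul (by positivity), inv_mul_cancel₀ hb0.ne', Real.rpow_one]
    obtain ⟨h, hh1, hh2⟩ := exists_low_high u A
    have hball : (Metric.ball (0 : E N) A)ᶜ = {ξ | t ≤ Λ ξ} := by
      ext ξ
      simp only [mem_compl_iff, Metric.mem_ball, dist_zero_right, not_lt, mem_ofPred_eq, Λ]
      rw [← Real.rpow_le_rpow_iff hA.le (norm_nonneg _) hb0, hAb, div_le_iff₀' hc]
    have hsub : volume {x | t < |u x|} ≤
        volume {x | ENNReal.ofReal (t ^ 2 / 4) ≤ ENNReal.ofReal (‖h x‖ ^ 2)} := by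
      apply measure_mono_ae
      filter_upwards [hh2] with x hx hxt
      have h1 := hlow u g hug A hA x
      rw [hAb] at h1
      have h2 : K * (t / c) * ‖g‖ = t / 2 := by
        change K * (t / (2 * K * M)) * M = t / 2
        field_simp
      rw [h2] at h1
      have h3 : |u x| ≤ t / 2 + ‖h x‖ := by
        have : ‖(u x : ℂ)‖ = |u x| := Complex.norm_real _
        rw [← this, hx]
        exact (norm_add_le _ _).trans (by gcongr)
      have hxt' : t < |u x| := hxt
      change ENNReal.ofReal (t ^ 2 / 4) ≤ ENNReal.ofReal (‖h x‖ ^ 2)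
      apply ENNReal.ofReal_le_ofReal
      have h4 : t / 2 ≤ ‖h x‖ := by linarith
      calc t ^ 2 / 4 = (t / 2) ^ 2 := by ring
        _ ≤ _ := by gcongr
    have hch := mul_meas_ge_le_lintegral (μ := volume)
      (((Lp.stronglyMeasurable h).measurable.norm.pow_const 2).ennreal_ofReal)
      (ENNReal.ofReal (t ^ 2 / 4))
    have hhi : ∫⁻ x, ENNReal.ofReal (‖h x‖ ^ 2) = ∫⁻ ξ, {ξ | t ≤ Λ ξ}.indicator
        (fun ξ => ENNReal.ofReal (‖ft u ξ‖ ^ 2)) ξ := by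
      rw [lintegral_norm_sq, hh1, ← hball, lintegral_indicator measurableSet_ball.compl,
        ofReal_integral_eq_lintegral_ofReal (integrable_norm_sq _).integrableOn
          (ae_of_all _ fun _ => by positivity)]
    rw [hhi] at hch
    refine hsub.trans ?_
    calc _ = ENNReal.ofReal (4 / t ^ 2) * (ENNReal.ofReal (t ^ 2 / 4) *
          volume {x | ENNReal.ofReal (t ^ 2 / 4) ≤ ENNReal.ofReal (‖h x‖ ^ 2)}) := by
          rw [← mul_assoc, ← ENNReal.ofReal_mul (by positivity)]
          have : 4 / t ^ 2 * (t ^ 2 / 4) = 1 := by field_simp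
          rw [this]; simp
      _ ≤ _ := by gcongr
  have hum : AEMeasurable (fun x => |u x|) volume :=
    (Lp.stronglyMeasurable u).measurable.abs.aemeasurable
  rw [lintegral_rpow_eq_lintegral_meas_lt_mul volume (ae_of_all _ fun _ => abs_nonneg _) hum
    (by linarith : 0 < q)]
  have hfm : Measurable fun ξ => ENNReal.ofReal (‖ft u ξ‖ ^ 2) :=
    ((Lp.stronglyMeasurable (ft u)).measurable.norm.pow_const 2).ennreal_ofReal
  have hΛm : Measurable Λ := (measurable_norm.pow_const b).const_mul c
  set H : ℝ → E N → ℝ≥0∞ := fun t ξ => {p : ℝ × E N | p.1 ≤ Λ p.2}.indicator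
    (fun p => ENNReal.ofReal (4 * p.1 ^ (q - 2 - 1)) * ENNReal.ofReal (‖ft u p.2‖ ^ 2)) (t, ξ)
  have hHm : Measurable (Function.uncurry H) := by
    apply Measurable.indicator
    · exact ((measurable_fst.pow_const _).const_mul 4).ennreal_ofReal.mul
        (hfm.comp measurable_snd)
    · exact measurableSet_le measurable_fst (hΛm.comp measurable_snd)
  -- After the layer-cake formula comes Tonelli: a frequency `ξ` contributes only for `t ≤ Λ ξ`, and
  -- `∫ t^(q-3) dt` converges at `0` because `q > 2`.
  have hstep : ∫⁻ t in Ioi (0 : ℝ), volume {x | t < |u x|} * ENNReal.ofReal (t ^ (q - 1)) ≤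
      ∫⁻ t in Ioi (0 : ℝ), ∫⁻ ξ, H t ξ := by
    apply setLIntegral_mono' measurableSet_Ioi
    intro t ht
    have ht' : 0 < t := ht
    calc _ ≤ (ENNReal.ofReal (4 / t ^ 2) * ∫⁻ ξ, {ξ | t ≤ Λ ξ}.indicator
        (fun ξ => ENNReal.ofReal (‖ft u ξ‖ ^ 2)) ξ) * ENNReal.ofReal (t ^ (q - 1)) := by
          gcongr; exact hdist t ht
      _ = ENNReal.ofReal (4 * t ^ (q - 2 - 1)) * ∫⁻ ξ, {ξ | t ≤ Λ ξ}.indicator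
        (fun ξ => ENNReal.ofReal (‖ft u ξ‖ ^ 2)) ξ := by
          rw [mul_right_comm, ← ENNReal.ofReal_mul (by positivity)]
          congr 2
          have : t ^ (q - 1) = t ^ (q - 2 - 1) * t ^ 2 := by
            rw [← Real.rpow_natCast, ← Real.rpow_add ht']; congr 1; push_cast; ring
          rw [this]; field_simp
      _ = _ := by
          rw [← lintegral_const_mul]
          · congr 1; ext ξ
            by_cases hξ : t ≤ Λ ξ <;> simp [H, hξ, indicator]
          · exact hfm.indicator (measurableSet_le measurable_const hΛm)
  have hinner : ∀ ξ, ∫⁻ t in Ioi (0 : ℝ), H t ξ =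
      ENNReal.ofReal (4 * (c ^ (q - 2) / (q - 2))) *
        ENNReal.ofReal ((‖ξ‖ ^ σ * ‖ft u ξ‖) ^ 2) := fun ξ => by
    have e1 : ∫⁻ t in Ioi (0 : ℝ), H t ξ = ∫⁻ t in Ioc 0 (Λ ξ),
        ENNReal.ofReal (‖ft u ξ‖ ^ 2) * 4 * ENNReal.ofReal (t ^ (q - 2 - 1)) := by
      rw [← lintegral_indicator measurableSet_Ioi, ← lintegral_indicator measurableSet_Ioc]
      congr 1; ext t
      by_cases h1 : 0 < t <;> by_cases h2 : t ≤ Λ ξ <;> simp [H, h1, h2, indicator]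
      ring
    rw [e1, lintegral_const_mul' _ _ (by finiteness), lintegral_Ioc_rpow hq2' (hΛ0 ξ),
      ← ENNReal.ofReal_mul (by positivity)]
    have : Λ ξ ^ (q - 2) = c ^ (q - 2) * (‖ξ‖ ^ σ) ^ 2 := by
      simp only [Λ]
      rw [Real.mul_rpow hc.le (by positivity), ← Real.rpow_mul (norm_nonneg _), hbq,
        ← Real.rpow_natCast, ← Real.rpow_mul (norm_nonneg _)]
      congr 2; push_cast; ring
    rw [this]
    have h4 : (4 : ℝ≥0∞) = ENNReal.ofReal 4 := by simp
    rw [h4, ← ENNReal.ofReal_mul (by positivity), ← ENNReal.ofReal_mul (by positivity)]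
    congr 1
    ring
  have hswap : ∫⁻ t in Ioi (0 : ℝ), ∫⁻ ξ, H t ξ ≤
      ENNReal.ofReal (4 * (c ^ (q - 2) / (q - 2))) * ENNReal.ofReal (M ^ 2) := by
    rw [lintegral_lintegral_swap hHm.aemeasurable]
    simp_rw [hinner]
    rw [lintegral_const_mul' _ _ (by finiteness)]
    gcongr
    simp only [M]
    rw [← norm_ft, ← lintegral_norm_sq]
    apply lintegral_mono_ae
    filter_upwards [hug.norm_ft_sq] with ξ hξ
    apply ENNReal.ofReal_le_ofReal
    rw [hξ]
    gcongr
    have := Real.pi_gt_three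
    nlinarith [norm_nonneg ξ]
  calc _ ≤ ENNReal.ofReal q *
        (ENNReal.ofReal (4 * (c ^ (q - 2) / (q - 2))) * ENNReal.ofReal (M ^ 2)) := by
        gcongr; exact hstep.trans hswap
    _ = _ := by
      rw [← ENNReal.ofReal_mul (by positivity), ← ENNReal.ofReal_mul (by linarith)]
      congr 1
      have h1 : M ^ q = M ^ (q - 2) * M ^ 2 := by
        rw [← Real.rpow_natCast, ← Real.rpow_add hgpos]; congr 1; push_cast; ring
      have h2 : c ^ (q - 2) = (2 * K) ^ (q - 2) * M ^ (q - 2) :=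
        Real.mul_rpow (by positivity) (by positivity)
      rw [h1, h2]; ring

end Sobolev

/-! ### Local compactness of weakly convergent sequences -/

section Compactness

variable {N : ℕ}

lemma tendsto_apply_of_weak {X : Type*} [NormedAddCommGroup X] [InnerProductSpace ℝ X]
    [CompleteSpace X] {v : ℕ → X}
    (hw : ∀ ψ : X, Tendsto (fun n => inner ℝ ψ (v n)) atTop (𝓝 0)) (T : X →L[ℝ] ℂ) :
    Tendsto (fun n => T (v n)) atTop (𝓝 0) := by
  have key : ∀ ℓ : X →L[ℝ] ℝ, Tendsto (fun n => ℓ (v n)) atTop (𝓝 0) := fun ℓ => by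
    have := hw ((InnerProductSpace.toDual ℝ X).symm ℓ)
    simpa using this
  have h1 := key (Complex.reCLM.comp T)
  have h2 := key (Complex.imCLM.comp T)
  have h3 := ((Complex.continuous_ofReal.tendsto 0).comp h1).add
    (((Complex.continuous_ofReal.tendsto 0).comp h2).mul_const Complex.I)
  simpa [Function.comp_def, Complex.re_add_im] using h3

/-- Local compactness of `H^s` in `L²`. -/
theorem tendsto_setIntegral_sq_of_weak {s : ℝ} (hs : 0 < s) {v g : ℕ → L2 N}
    (hv : ∀ n, HasFracLap (s / 2) (v n) (g n))
    (hw : ∀ ψ : L2 N, Tendsto (fun n => inner ℝ ψ (v n)) atTop (𝓝 0)) {M : ℝ}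
    (hM : ∀ n, ‖v n‖ ≤ M) (hG : ∀ n, ‖g n‖ ≤ M) (R : ℝ) :
    Tendsto (fun n => ∫ x in Metric.ball 0 R, (v n x) ^ 2) atTop (𝓝 0) := by
  have hM0 : 0 ≤ M := (norm_nonneg _).trans (hM 0)
  -- low frequencies
  have hlow : ∀ A : ℝ, Tendsto (fun n => ∫ x in Metric.ball (0 : E N) R,
      ‖𝓕⁻ ((Metric.ball 0 A).indicator (ft (v n))) x‖ ^ 2) atTop (𝓝 0) := fun A => by
    have hm : MeasurableSet (Metric.ball (0 : E N) A) := measurableSet_ball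
    have : IsFiniteMeasure ((volume : Measure (E N)).restrict (Metric.ball 0 A)) :=
      ⟨by simpa using measure_ball_lt_top⟩
    have : IsFiniteMeasure ((volume : Measure (E N)).restrict (Metric.ball 0 R)) :=
      ⟨by simpa using measure_ball_lt_top⟩
    have hint : ∀ n, Integrable ((Metric.ball 0 A).indicator (ft (v n))) := fun n => by
      rw [integrable_indicator_iff hm]
      exact ((Lp.memLp (ft (v n))).restrict _).integrable (by norm_num)
    set C : ℝ := √(∫ ξ in Metric.ball (0 : E N) A, (1 : ℝ) ^ 2) * M
    have hbd : ∀ n x, ‖𝓕⁻ ((Metric.ball 0 A).indicator (ft (v n))) x‖ ≤ C := fun n x => by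
      refine (norm_fourierInv_le _ _).trans ?_
      simp_rw [norm_indicator_eq_indicator_norm]
      rw [integral_indicator hm]
      calc ∫ ξ in Metric.ball (0 : E N) A, ‖ft (v n) ξ‖
          = ∫ ξ in Metric.ball (0 : E N) A, 1 * ‖ft (v n) ξ‖ := by simp
        _ ≤ √(∫ ξ in Metric.ball (0 : E N) A, (1 : ℝ) ^ 2) *
            √(∫ ξ in Metric.ball (0 : E N) A, ‖ft (v n) ξ‖ ^ 2) :=
          integral_mul_le_sqrt (ae_of_all _ fun _ => zero_le_one)
            (ae_of_all _ fun _ => norm_nonneg _) (memLp_const _)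
            ((Lp.memLp (ft (v n))).restrict _).norm
        _ ≤ C := by
          refine mul_le_mul_of_nonneg_left ?_ (Real.sqrt_nonneg _)
          rw [← Real.sqrt_sq hM0]
          apply Real.sqrt_le_sqrt
          calc _ ≤ ∫ ξ, ‖ft (v n) ξ‖ ^ 2 :=
                setIntegral_le_integral (integrable_norm_sq _) (ae_of_all _ fun _ => by positivity)
            _ = ‖v n‖ ^ 2 := by rw [← norm_sq_eq_integral, norm_ft]
            _ ≤ M ^ 2 := by gcongr; exact hM n
    -- At a fixed `x` the truncated inverse transform is a bounded functional of `v n`, namely the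
    -- pairing with a character cut off to the ball, so it tends to `0` by weak convergence.
    have hpt : ∀ x, Tendsto (fun n => 𝓕⁻ ((Metric.ball 0 A).indicator (ft (v n))) x) atTop
        (𝓝 0) := fun x => by
      set e : E N → ℂ := (Metric.ball 0 A).indicator fun ξ => (Real.fourierChar (-inner ℝ ξ x) : ℂ)
      have hem : MemLp e 2 volume := by
        rw [memLp_indicator_iff_restrict hm]
        refine MemLp.of_bound (by fun_prop) 1 (ae_of_all _ fun ξ =>
          (Circle.norm_coe _).le)
      have h1 := tendsto_apply_of_weak hw
        (((innerSL ℂ (hem.toLp e)).restrictScalars ℝ).comp (ft (N := N)))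
      refine h1.congr fun n => ?_
      simp only [ContinuousLinearMap.comp_apply, ContinuousLinearMap.coe_restrictScalars',
        innerSL_apply_apply]
      rw [L2.inner_def, Real.fourierInv_eq]
      apply integral_congr_ae
      filter_upwards [hem.coeFn_toLp] with ξ hξ
      rw [hξ]
      by_cases h : ξ ∈ Metric.ball (0 : E N) A
      · simp only [e, indicator_of_mem h, RCLike.inner_apply, conj_fourierChar, neg_neg,
          Circle.smul_def, smul_eq_mul]
        ring
      · simp only [e, indicator_of_notMem h, inner_zero_left, smul_zero]
    have := tendsto_integral_of_dominated_convergence (μ := volume.restrict (Metric.ball (0 : E N) R))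
      (F := fun n x => ‖𝓕⁻ ((Metric.ball 0 A).indicator (ft (v n))) x‖ ^ 2) (f := fun _ => 0)
      (fun _ => C ^ 2)
      (fun n => ((continuous_fourierInv_of_integrable (hint n)).norm.pow 2).aestronglyMeasurable)
      (integrable_const _)
      (fun n => ae_of_all _ fun x => by
        rw [Real.norm_of_nonneg (by positivity)]
        gcongr
        exact hbd n x)
      (ae_of_all _ fun x => by simpa using ((hpt x).norm.pow 2))
    simpa using this
  -- high frequencies
  have hmain : ∀ A : ℝ, 0 < A → ∀ n, ∫ x in Metric.ball 0 R, (v n x) ^ 2 ≤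
      2 * (∫ x in Metric.ball (0 : E N) R,
        ‖𝓕⁻ ((Metric.ball 0 A).indicator (ft (v n))) x‖ ^ 2) + 2 * ((A ^ s)⁻¹ * M) ^ 2 := by
    intro A hA n
    have : IsFiniteMeasure ((volume : Measure (E N)).restrict (Metric.ball 0 A)) :=
      ⟨by simpa using measure_ball_lt_top⟩
    have : IsFiniteMeasure ((volume : Measure (E N)).restrict (Metric.ball 0 R)) :=
      ⟨by simpa using measure_ball_lt_top⟩
    obtain ⟨h, h1, h2⟩ := exists_low_high (v n) A
    have hh : ‖h‖ ^ 2 ≤ ((A ^ s)⁻¹ * M) ^ 2 := by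
      rw [h1]
      calc ∫ ξ in (Metric.ball 0 A)ᶜ, ‖ft (v n) ξ‖ ^ 2
          ≤ ∫ ξ in (Metric.ball 0 A)ᶜ, ((A ^ s)⁻¹) ^ 2 * ‖ft (g n) ξ‖ ^ 2 := by
            apply integral_mono_ae (integrable_norm_sq _).integrableOn
              ((integrable_norm_sq _).const_mul _).integrableOn
            filter_upwards [ae_restrict_of_ae (hv n).norm_ft_sq,
              self_mem_ae_restrict measurableSet_ball.compl] with ξ h3 h4
            have h5 : A ≤ ‖ξ‖ := by simpa using h4
            rw [h3, ← mul_pow]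
            gcongr
            have h6 : A ^ s ≤ (2 * Real.pi * ‖ξ‖) ^ s := by
              gcongr
              have := Real.pi_gt_three
              nlinarith [norm_nonneg ξ]
            have h7 : 0 < A ^ s := by positivity
            rw [← mul_assoc]
            apply le_mul_of_one_le_left (norm_nonneg _)
            rw [← div_eq_inv_mul, one_le_div h7]
            exact h6
        _ = ((A ^ s)⁻¹) ^ 2 * ∫ ξ in (Metric.ball 0 A)ᶜ, ‖ft (g n) ξ‖ ^ 2 := integral_const_mul _ _
        _ ≤ ((A ^ s)⁻¹) ^ 2 * ∫ ξ, ‖ft (g n) ξ‖ ^ 2 := by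
          gcongr
          · exact ae_of_all _ fun _ => by positivity
          · exact integrable_norm_sq _
          · exact Measure.restrict_le_self
        _ ≤ ((A ^ s)⁻¹) ^ 2 * M ^ 2 := by
          rw [← norm_sq_eq_integral, norm_ft]
          gcongr
          exact hG n
        _ = _ := by ring
    have hint : Integrable ((Metric.ball 0 A).indicator (ft (v n))) := by
      rw [integrable_indicator_iff measurableSet_ball]
      exact ((Lp.memLp (ft (v n))).restrict _).integrable (by norm_num)
    have hlc := continuous_fourierInv_of_integrable hint
    have hil : Integrable (fun x => ‖𝓕⁻ ((Metric.ball 0 A).indicator (ft (v n))) x‖ ^ 2)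
        (volume.restrict (Metric.ball (0 : E N) R)) := by
      refine Integrable.mono' (integrable_const ((∫ ξ, ‖(Metric.ball 0 A).indicator
        (ft (v n)) ξ‖) ^ 2)) (hlc.norm.pow 2).aestronglyMeasurable (ae_of_all _ fun x => ?_)
      rw [Real.norm_of_nonneg (by positivity)]
      gcongr
      exact norm_fourierInv_le _ _
    calc ∫ x in Metric.ball 0 R, (v n x) ^ 2
        ≤ ∫ x in Metric.ball (0 : E N) R,
          (2 * ‖𝓕⁻ ((Metric.ball 0 A).indicator (ft (v n))) x‖ ^ 2 + 2 * ‖h x‖ ^ 2) := by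
          apply integral_mono_ae (integrable_sq _).integrableOn
            ((hil.const_mul 2).add ((integrable_norm_sq h).const_mul 2).integrableOn)
          filter_upwards [ae_restrict_of_ae h2] with x hx
          have h3 : |v n x| ≤ ‖𝓕⁻ ((Metric.ball 0 A).indicator (ft (v n))) x‖ + ‖h x‖ := by
            have : ‖(v n x : ℂ)‖ = |v n x| := Complex.norm_real _
            rw [← this, hx]
            exact norm_add_le _ _
          rw [← sq_abs]
          calc |v n x| ^ 2 ≤ (‖𝓕⁻ ((Metric.ball 0 A).indicator (ft (v n))) x‖ + ‖h x‖) ^ 2 := by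
                gcongr
            _ ≤ 2 * ‖𝓕⁻ ((Metric.ball 0 A).indicator (ft (v n))) x‖ ^ 2 + 2 * ‖h x‖ ^ 2 := by
              nlinarith [sq_nonneg (‖𝓕⁻ ((Metric.ball 0 A).indicator (ft (v n))) x‖ - ‖h x‖)]
      _ = 2 * (∫ x in Metric.ball (0 : E N) R,
          ‖𝓕⁻ ((Metric.ball 0 A).indicator (ft (v n))) x‖ ^ 2) +
          2 * ∫ x in Metric.ball (0 : E N) R, ‖h x‖ ^ 2 := by
          rw [integral_add (hil.const_mul 2) ((integrable_norm_sq h).const_mul 2).integrableOn,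
            integral_const_mul, integral_const_mul]
      _ ≤ _ := by
          gcongr
          refine le_trans ?_ hh
          rw [norm_sq_eq_integral]
          exact setIntegral_le_integral (integrable_norm_sq _) (ae_of_all _ fun _ => by positivity)
  -- `A` is fixed first, which makes the high frequencies small uniformly in `n`; only then is `n`
  -- taken large.
  have hlim : Tendsto (fun A : ℝ => 2 * ((A ^ s)⁻¹ * M) ^ 2) atTop (𝓝 0) := by
    have h1 : Tendsto (fun A : ℝ => (A ^ s)⁻¹) atTop (𝓝 0) :=
      (tendsto_rpow_atTop hs).inv_tendsto_atTop
    simpa using ((h1.mul_const M).pow 2).const_mul 2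
  rw [Metric.tendsto_atTop]
  intro δ hδ
  obtain ⟨A, hA1, hA2⟩ := ((hlim.eventually (gt_mem_nhds (half_pos hδ))).and
    (eventually_gt_atTop 0)).exists
  obtain ⟨n0, hn0⟩ := eventually_atTop.1
    ((hlow A).eventually (gt_mem_nhds (by positivity : (0 : ℝ) < δ / 4)))
  refine ⟨n0, fun n hn => ?_⟩
  have h0 : 0 ≤ ∫ x in Metric.ball 0 R, (v n x) ^ 2 := integral_nonneg fun x => by positivity
  rw [Real.dist_eq, sub_zero, abs_of_nonneg h0]
  have := hmain A hA2 n
  have := hn0 n hn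
  linarith

end Compactness

/-! ### Density of test functions in the graph norm -/

section Density

variable {N : ℕ}

/-- A test function as an element of `L²`. -/
def testLp {η : E N → ℝ} (h1 : ContDiff ℝ ∞ η) (h2 : HasCompactSupport η) : L2 N :=
  (h1.continuous.memLp_of_hasCompactSupport h2 (p := 2) (μ := volume)).toLp η

lemma coeFn_testLp {η : E N → ℝ} (h1 : ContDiff ℝ ∞ η) (h2 : HasCompactSupport η) :
    (testLp h1 h2 : E N → ℝ) =ᵐ[volume] η := MemLp.coeFn_toLp _

lemma isTest_testLp {η : E N → ℝ} (h1 : ContDiff ℝ ∞ η) (h2 : HasCompactSupport η) :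
    IsTest (testLp h1 h2) := ⟨η, h1, h2, coeFn_testLp h1 h2⟩

lemma IsTest.add {v w : L2 N} (hv : IsTest v) (hw : IsTest w) : IsTest (v + w) := by
  obtain ⟨η, h1, h2, h3⟩ := hv
  obtain ⟨ζ, k1, k2, k3⟩ := hw
  exact ⟨fun x => η x + ζ x, h1.add k1, h2.add k2, (Lp.coeFn_add _ _).trans (h3.add k3)⟩

lemma IsTest.smul {w : L2 N} (c : ℝ) (hw : IsTest w) : IsTest (c • w) := by
  obtain ⟨η, h1, h2, h3⟩ := hw
  exact ⟨fun x => c * η x, contDiff_const.mul h1, h2.mul_left,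
    (Lp.coeFn_smul _ _).trans (h3.const_smul c)⟩

lemma IsTest.zero : IsTest (0 : L2 N) :=
  ⟨fun _ => 0, contDiff_const, HasCompactSupport.zero, Lp.coeFn_zero _ _ _⟩

lemma contDiff_translate {η : E N → ℝ} (h1 : ContDiff ℝ ∞ η) (y : E N) :
    ContDiff ℝ ∞ fun x => η (x - y) := h1.comp (contDiff_id.sub contDiff_const)

lemma hasCompactSupport_translate {η : E N → ℝ} (h2 : HasCompactSupport η) (y : E N) :
    HasCompactSupport fun x => η (x - y) := by
  have := h2.comp_homeomorph (Homeomorph.subRight y)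
  exact this

lemma fourier_translate (η : E N → ℝ) (y ξ : E N) :
    𝓕 (fun x => (η (x - y) : ℂ)) ξ =
      (Real.fourierChar (-inner ℝ y ξ) : ℂ) * 𝓕 (fun x => (η x : ℂ)) ξ := by
  rw [Real.fourier_eq, Real.fourier_eq, ← integral_const_mul,
    ← integral_add_right_eq_self _ y]
  congr 1; ext x
  simp only [add_sub_cancel_right, Circle.smul_def, smul_eq_mul, inner_add_left, neg_add,
    AddChar.map_add_eq_mul, Circle.coe_mul]
  ring

lemma ft_testLp {η : E N → ℝ} (h1 : ContDiff ℝ ∞ η) (h2 : HasCompactSupport η) :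
    ft (testLp h1 h2) =ᵐ[volume] 𝓕 (fun x => (η x : ℂ)) := by
  have := ft_test h1 h2 (coeFn_testLp h1 h2)
  rw [SchwartzMap.fourier_coe] at this
  exact this

/-- The `L²` norm of `(-Δ)^β` of a test function is translation invariant. -/
lemma norm_fracLap_translate {β : ℝ} {η : E N → ℝ} (h1 : ContDiff ℝ ∞ η)
    (h2 : HasCompactSupport η) (y : E N) {h k : L2 N} (hh : HasFracLap β (testLp h1 h2) h)
    (hk : HasFracLap β (testLp (contDiff_translate h1 y) (hasCompactSupport_translate h2 y)) k) :
    ‖k‖ = ‖h‖ := by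
  rw [← norm_ft, ← norm_ft, Lp.norm_def, Lp.norm_def]
  congr 1
  apply eLpNorm_congr_norm_ae
  filter_upwards [hasFracLap_iff.1 hh, hasFracLap_iff.1 hk, ft_testLp h1 h2,
    ft_testLp (contDiff_translate h1 y) (hasCompactSupport_translate h2 y)] with ξ a b c d
  rw [a, b, c, d, fourier_translate, norm_mul, norm_mul, norm_mul, Circle.norm_coe, one_mul]

/-- A bump function whose Fourier transform does not vanish on a prescribed ball. -/
lemma exists_bump_fourier_ne_zero (n : ℕ) : ∃ η : E N → ℝ, ContDiff ℝ ∞ η ∧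
    HasCompactSupport η ∧ ∀ ξ : E N, ‖ξ‖ ≤ n → 𝓕 (fun x => (η x : ℂ)) ξ ≠ 0 := by
  -- For `|ξ| ≤ n` and `|v| < r` the phase is at most `2π/8 = π/4`, so the cosine stays nonnegative
  -- on the support of the bump and the real part of its transform is positive.
  set r : ℝ := 1 / (8 * (n + 1))
  have hr : 0 < r := by positivity
  let φ : ContDiffBump (0 : E N) := ⟨r / 2, r, by positivity, by linarith⟩
  refine ⟨φ, φ.contDiff, φ.hasCompactSupport, fun ξ hξ h0 => ?_⟩
  have hre := congrArg Complex.re h0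
  rw [Real.fourier_eq', Complex.zero_re] at hre
  have hint : Integrable fun v : E N =>
      Complex.exp (↑(-2 * Real.pi * inner ℝ v ξ) * Complex.I) • (φ v : ℂ) := by
    have hc : Continuous fun v : E N =>
      Complex.exp (↑(-2 * Real.pi * inner ℝ v ξ) * Complex.I) • (φ v : ℂ) := by
      have := φ.continuous
      fun_prop
    apply hc.integrable_of_hasCompactSupport
    exact HasCompactSupport.intro φ.hasCompactSupport fun x hx => by
      rw [image_eq_zero_of_notMem_tsupport hx, Complex.ofReal_zero, smul_zero]
  have hre2 : ∫ v : E N, Real.cos (-2 * Real.pi * inner ℝ v ξ) * φ v = 0 := by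
    rw [← hre]
    have := integral_re hint
    simp only [RCLike.re_eq_complex_re] at this
    rw [← this]
    congr 1; ext v
    rw [smul_eq_mul, Complex.re_mul_ofReal, Complex.exp_ofReal_mul_I_re]
  have hpos : 0 < ∫ v : E N, Real.cos (-2 * Real.pi * inner ℝ v ξ) * φ v := by
    apply Continuous.integral_pos_of_hasCompactSupport_nonneg_nonzero (x := 0)
    · have := φ.continuous
      fun_prop
    · exact φ.hasCompactSupport.mul_left
    · intro v
      by_cases hv : v ∈ Metric.ball (0 : E N) r
      · apply mul_nonneg _ φ.nonneg
        apply Real.cos_nonneg_of_mem_Icc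
        have h1 : |inner ℝ v ξ| ≤ 1 / 8 := by
          refine (abs_real_inner_le_norm v ξ).trans ?_
          have : ‖v‖ ≤ r := by simpa using (Metric.mem_ball.1 hv).le
          calc ‖v‖ * ‖ξ‖ ≤ r * (n + 1) := by gcongr; linarith
            _ = 1 / 8 := by simp only [r]; field_simp
        have h2 := abs_le.1 h1
        have := Real.pi_pos
        constructor <;> nlinarith
      · have : φ v = 0 := by
          by_contra hne
          have : v ∈ Function.support φ := hne
          rw [φ.support_eq] at this
          exact hv this
        simp [this]
    · have : φ 0 = 1 := φ.one_of_mem_closedBall (by simp; positivity)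
      simp [this]
  linarith

/-- Orthogonality to all translates of one bump says that an `L¹` function has vanishing inverse
transform, hence is zero. That function is `1 + symb²` times the conjugate transform of the bump
times the transform of `a`, so the latter vanishes wherever the bump's transform does not; bumps of
shrinking support exhaust all frequencies. -/
lemma eq_zero_of_orthogonal_tests {β : ℝ} (hβ : 0 ≤ β) {a b : L2 N} (hab : HasFracLap β a b)
    (h : ∀ w k : L2 N, IsTest w → HasFracLap β w k → inner ℝ w a + inner ℝ k b = 0) : a = 0 := by
  have key : ∀ (η : E N → ℝ), ContDiff ℝ ∞ η → HasCompactSupport η →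
      ∀ᵐ ξ, 𝓕 (fun x => (η x : ℂ)) ξ ≠ 0 → ft a ξ = 0 := by
    intro η h1 h2
    obtain ⟨k, hk⟩ := (isTest_testLp h1 h2).exists_hasFracLap hβ
    set w := testLp h1 h2
    set Ψ : E N → ℂ := fun ξ => inner ℂ (ft w ξ) (ft a ξ) + inner ℂ (ft k ξ) (ft b ξ)
    have hΨ : Integrable Ψ :=
      (L2.integrable_inner (ft w) (ft a)).add (L2.integrable_inner (ft k) (ft b))
    have h0 : Ψ =ᵐ[volume] 0 := by
      apply ae_eq_zero_of_fourierInv_eq_zero hΨ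
      intro y
      obtain ⟨k', hk'⟩ := (isTest_testLp (contDiff_translate h1 y)
        (hasCompactSupport_translate h2 y)).exists_hasFracLap hβ
      have e := h _ k' (isTest_testLp (contDiff_translate h1 y)
        (hasCompactSupport_translate h2 y)) hk'
      have e2 : inner ℂ (ft (testLp (contDiff_translate h1 y) (hasCompactSupport_translate h2 y)))
          (ft a) + inner ℂ (ft k') (ft b) = 0 := by
        rw [inner_ft, inner_ft, ← Complex.ofReal_add, e, Complex.ofReal_zero]
      rw [L2.inner_def, L2.inner_def, ← integral_add (L2.integrable_inner _ _)
        (L2.integrable_inner _ _)] at e2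
      rw [Real.fourierInv_eq, ← e2]
      apply integral_congr_ae
      filter_upwards [hasFracLap_iff.1 hk, hasFracLap_iff.1 hk', ft_testLp h1 h2,
        ft_testLp (contDiff_translate h1 y) (hasCompactSupport_translate h2 y)] with ξ q1 q2 q3 q4
      simp only [Ψ]
      rw [q1, q2, q3, q4, fourier_translate]
      simp only [RCLike.inner_apply, map_mul, conj_fourierChar, neg_neg, Circle.smul_def,
        smul_eq_mul, Complex.conj_ofReal, real_inner_comm]
      ring
    filter_upwards [h0, hasFracLap_iff.1 hk, hasFracLap_iff.1 hab, ft_testLp h1 h2]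
      with ξ q0 q1 q2 q3 hne
    have q3 : ft w ξ = 𝓕 (fun x => (η x : ℂ)) ξ := q3
    simp only [Ψ, Pi.zero_apply, q1, q2, q3, RCLike.inner_apply, map_mul, Complex.conj_ofReal]
      at q0
    have h4 : ((1 + symb β ξ ^ 2 : ℝ) : ℂ) * (ft a ξ * (starRingEnd ℂ)
        (𝓕 (fun x => (η x : ℂ)) ξ)) = 0 := by
      rw [← q0]; push_cast; ring
    have h5 : ((1 + symb β ξ ^ 2 : ℝ) : ℂ) ≠ 0 := by
      rw [Complex.ofReal_ne_zero]; positivity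
    rcases mul_eq_zero.1 ((mul_eq_zero.1 h4).resolve_left h5) with h6 | h6
    · exact h6
    · exact absurd ((map_eq_zero _).1 h6) hne
  rw [← norm_eq_zero, ← norm_ft, norm_eq_zero]
  apply Lp.ext
  choose η h1 h2 h3 using fun n : ℕ => exists_bump_fourier_ne_zero (N := N) n
  filter_upwards [ae_all_iff.2 fun n => key (η n) (h1 n) (h2 n),
    Lp.coeFn_zero ℂ 2 (volume : Measure (E N))] with ξ q q0
  obtain ⟨n, hn⟩ := exists_nat_ge ‖ξ‖
  rw [q n (h3 n ξ hn), q0]; rfl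

/-- Test functions are dense in the graph of `(-Δ)^β`. -/
theorem exists_test_near {β : ℝ} (hβ : 0 ≤ β) {u g : L2 N} (hug : HasFracLap β u g) {δ : ℝ}
    (hδ : 0 < δ) : ∃ w k : L2 N, IsTest w ∧ HasFracLap β w k ∧ ‖w - u‖ < δ ∧ ‖k - g‖ < δ := by
  let T : Submodule ℝ (WithLp 2 (L2 N × L2 N)) :=
    { carrier := {z | IsTest z.fst ∧ HasFracLap β z.fst z.snd}
      add_mem' := fun ha hb => ⟨ha.1.add hb.1, ha.2.add hb.2⟩
      zero_mem' := ⟨IsTest.zero, HasFracLap.zero⟩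
      smul_mem' := fun c _ ha => ⟨ha.1.smul c, ha.2.smul c⟩ }
  have hcl : ∀ z ∈ T.topologicalClosure, HasFracLap β z.fst z.snd := by
    intro z hz
    rw [← SetLike.mem_coe, Submodule.topologicalClosure_coe, mem_closure_iff_seq_limit] at hz
    obtain ⟨x, hx, hlim⟩ := hz
    exact HasFracLap.of_tendsto (fun n => (hx n).2)
      (((WithLp.prod_continuous_ofLp 2 _ _).fst.tendsto z).comp hlim)
      (((WithLp.prod_continuous_ofLp 2 _ _).snd.tendsto z).comp hlim)
  set z0 : WithLp 2 (L2 N × L2 N) := WithLp.toLp 2 (u, g)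
  have hmem : z0 ∈ T.topologicalClosure := by
    have hc : CompleteSpace T.topologicalClosure :=
      T.isClosed_topologicalClosure.completeSpace_coe
    set p := T.topologicalClosure.starProjection z0
    have hp : p ∈ T.topologicalClosure := Submodule.starProjection_apply_mem _ _
    have hz : z0 - p ∈ T.topologicalClosureᗮ := Submodule.sub_starProjection_mem_orthogonal z0
    -- The graph is closed, so the projection onto the closure of the test graph stays in the graph;
    -- the residual is thus a graph element orthogonal to every test pair.
    have hfl : HasFracLap β (z0 - p).fst (z0 - p).snd := hug.sub (hcl p hp)
    have h1 : (z0 - p).fst = 0 := by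
      apply eq_zero_of_orthogonal_tests hβ hfl
      intro w k hw hk
      have := (Submodule.mem_orthogonal _ _).1 hz (WithLp.toLp 2 (w, k))
        (T.le_topologicalClosure ⟨hw, hk⟩)
      rwa [WithLp.prod_inner_apply] at this
    have h2 : (z0 - p).snd = 0 := by
      rw [h1] at hfl
      exact hfl.unique HasFracLap.zero
    have h3 : z0 - p = 0 := by
      apply (WithLp.equiv 2 _).injective
      exact Prod.ext h1 h2
    rw [sub_eq_zero.1 h3]
    exact hp
  rw [← SetLike.mem_coe, Submodule.topologicalClosure_coe, mem_closure_iff_seq_limit] at hmem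
  obtain ⟨x, hx, hlim⟩ := hmem
  have l1 : Tendsto (fun n => (x n).fst) atTop (𝓝 u) :=
    ((WithLp.prod_continuous_ofLp 2 _ _).fst.tendsto z0).comp hlim
  have l2 : Tendsto (fun n => (x n).snd) atTop (𝓝 g) :=
    ((WithLp.prod_continuous_ofLp 2 _ _).snd.tendsto z0).comp hlim
  obtain ⟨n, hn1, hn2⟩ := ((l1.eventually (Metric.ball_mem_nhds _ hδ)).and
    (l2.eventually (Metric.ball_mem_nhds _ hδ))).exists
  exact ⟨_, _, (hx n).1, (hx n).2, by simpa [dist_eq_norm] using hn1,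
    by simpa [dist_eq_norm] using hn2⟩

end Density

/-! ### The homogeneous space and the Poisson equation -/

section Poisson

variable {N : ℕ}

/-- The fractional Sobolev inequality. -/
theorem exists_sobolev_integral {σ : ℝ} (hσ : 0 < σ) (hN : 2 * σ < N) :
    ∃ C : ℝ, 0 < C ∧ ∀ (u g : L2 N), HasFracLap (σ / 2) u g →
      Integrable (fun x => |u x| ^ (2 * N / (N - 2 * σ) : ℝ)) ∧
      ∫ x, |u x| ^ (2 * N / (N - 2 * σ) : ℝ) ≤ C * ‖g‖ ^ (2 * N / (N - 2 * σ) : ℝ) := by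
  obtain ⟨C, hC, h⟩ := exists_sobolev_lintegral hσ hN
  refine ⟨C, hC, fun u g hug => ?_⟩
  have h1 := h u g hug
  have hm : AEStronglyMeasurable (fun x => |u x| ^ (2 * N / (N - 2 * σ) : ℝ)) volume :=
    ((Lp.stronglyMeasurable u).measurable.abs.pow_const _).aestronglyMeasurable
  have h0 : 0 ≤ᵐ[volume] fun x => |u x| ^ (2 * N / (N - 2 * σ) : ℝ) :=
    ae_of_all _ fun x => by positivity
  refine ⟨⟨hm, ?_⟩, ?_⟩
  · rw [hasFiniteIntegral_iff_ofReal h0]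
    exact h1.trans_lt ENNReal.ofReal_lt_top
  · rw [integral_eq_lintegral_of_nonneg_ae h0 hm]
    exact ENNReal.toReal_le_of_le_ofReal (by positivity) h1

theorem exists_sobolev_eLpNorm {σ : ℝ} (hσ : 0 < σ) (hN : 2 * σ < N) :
    ∃ C : ℝ, 0 < C ∧ ∀ (u g : L2 N), HasFracLap (σ / 2) u g →
      eLpNorm u (ENNReal.ofReal (2 * N / (N - 2 * σ))) volume ≤ ENNReal.ofReal (C * ‖g‖) := by
  obtain ⟨C, hC, h⟩ := exists_sobolev_lintegral hσ hN
  set q : ℝ := 2 * N / (N - 2 * σ) with hq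
  have hd : (0 : ℝ) < N - 2 * σ := by linarith
  have hNpos : (0 : ℝ) < N := by linarith
  have hq0 : 0 < q := by positivity
  refine ⟨C ^ (1 / q), by positivity, fun u g hug => ?_⟩
  rw [eLpNorm_eq_lintegral_rpow_enorm_toReal (by simpa using hq0) ENNReal.ofReal_ne_top,
    ENNReal.toReal_ofReal hq0.le]
  have e : ∀ x, ‖u x‖ₑ ^ q = ENNReal.ofReal (|u x| ^ q) := fun x => by
    rw [← ENNReal.ofReal_rpow_of_nonneg (abs_nonneg _) hq0.le, Real.enorm_eq_ofReal_abs]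
  simp_rw [e]
  calc _ ≤ (ENNReal.ofReal (C * ‖g‖ ^ q)) ^ (1 / q) := by
        gcongr; exact h u g hug
    _ = _ := by
      rw [ENNReal.ofReal_rpow_of_nonneg (by positivity) (by positivity),
        Real.mul_rpow hC.le (by positivity), ← Real.rpow_mul (norm_nonneg _),
        mul_one_div_cancel hq0.ne', Real.rpow_one]

variable {α : ℝ}

lemma one_le_pStar (hα : 0 < α) (hαN : α < N) : 1 ≤ pStar N α := by
  unfold pStar
  rw [ENNReal.one_le_ofReal, le_div_iff₀ (by linarith)]
  linarith

/-- The exponent dual to `2N/(N-α)`. -/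
def cStar (N : ℕ) (α : ℝ) : ℝ≥0∞ := ENNReal.ofReal (2 * N / (N + α))

lemma holderConjugate_star (hα : 0 < α) (hαN : α < N) :
    ENNReal.HolderConjugate (cStar N α) (pStar N α) := by
  apply Real.HolderConjugate.ennrealOfReal
  have h1 : (0 : ℝ) < N := hα.trans hαN
  have h2 : (0 : ℝ) < N - α := by linarith
  rw [Real.holderConjugate_iff]
  constructor
  · rw [lt_div_iff₀ (by linarith)]; linarith
  · field_simp; ring

lemma exists_sobolev_star (hα : 0 < α) (hαN : α < N) :
    ∃ C : ℝ, 0 < C ∧ ∀ (w h : L2 N), HasFracLap (α / 4) w h →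
      eLpNorm w (pStar N α) volume ≤ ENNReal.ofReal (C * ‖h‖) := by
  obtain ⟨C, hC, h⟩ := exists_sobolev_eLpNorm (N := N) (σ := α / 2) (by linarith) (by linarith)
  refine ⟨C, hC, fun w k hwk => ?_⟩
  have e : α / 4 = α / 2 / 2 := by ring
  rw [e] at hwk
  have := h w k hwk
  rwa [show (2 * (α / 2) : ℝ) = α by ring] at this

lemma IsTest.memLp {w : L2 N} (hw : IsTest w) (p : ℝ≥0∞) : MemLp w p volume := by
  obtain ⟨η, h1, h2, h3⟩ := hw
  exact (memLp_congr_ae h3).2 (h1.continuous.memLp_of_hasCompactSupport h2)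

lemma norm_toLp_le_sobolev {C : ℝ} (hC : 0 < C) {w h : L2 N}
    (hb : eLpNorm w (pStar N α) volume ≤ ENNReal.ofReal (C * ‖h‖))
    (hw : MemLp w (pStar N α) volume) : ‖hw.toLp w‖ ≤ C * ‖h‖ := by
  rw [Lp.norm_toLp]
  exact ENNReal.toReal_le_of_le_ofReal (by positivity) hb

section WithFact

variable [Fact (1 ≤ pStar N α)]

/-- Restates the convergence inside the Banach space `LStar N α`, where linearity, norms and
completeness are available. -/
lemma hasHomFracLap_iff {φ : LStar N α} {g : L2 N} :
    HasHomFracLap α φ g ↔ ∃ (w h : ℕ → L2 N) (W : ℕ → LStar N α),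
      (∀ n, IsTest (w n) ∧ HasFracLap (α / 4) (w n) (h n) ∧ W n =ᵐ[volume] w n) ∧
      Tendsto h atTop (𝓝 g) ∧ Tendsto W atTop (𝓝 φ) := by
  constructor
  · rintro ⟨w, h, h1, h2, h3⟩
    refine ⟨w, h, fun n => ((h1 n).1.memLp _).toLp _, fun n =>
      ⟨(h1 n).1, (h1 n).2, MemLp.coeFn_toLp _⟩, h2, ?_⟩
    rw [Lp.tendsto_Lp_iff_tendsto_eLpNorm']
    refine h3.congr fun n => eLpNorm_congr_ae ?_
    filter_upwards [MemLp.coeFn_toLp ((h1 n).1.memLp (pStar N α))] with x hx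
    rw [Pi.sub_apply, hx]
  · rintro ⟨w, h, W, h1, h2, h3⟩
    refine ⟨w, h, fun n => ⟨(h1 n).1, (h1 n).2.1⟩, h2, ?_⟩
    rw [Lp.tendsto_Lp_iff_tendsto_eLpNorm'] at h3
    refine h3.congr fun n => eLpNorm_congr_ae ?_
    filter_upwards [(h1 n).2.2] with x hx
    rw [Pi.sub_apply, hx]

lemma HasHomFracLap.add_smul {φ ψ : LStar N α} {g h : L2 N} (hφ : HasHomFracLap α φ g)
    (hψ : HasHomFracLap α ψ h) (a b : ℝ) : HasHomFracLap α (a • φ + b • ψ) (a • g + b • h) := by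
  rw [hasHomFracLap_iff] at *
  obtain ⟨w, k, W, h1, h2, h3⟩ := hφ
  obtain ⟨w', k', W', h1', h2', h3'⟩ := hψ
  refine ⟨fun n => a • w n + b • w' n, fun n => a • k n + b • k' n,
    fun n => a • W n + b • W' n, fun n => ⟨((h1 n).1.smul a).add ((h1' n).1.smul b),
      ((h1 n).2.1.smul a).add ((h1' n).2.1.smul b), ?_⟩,
    (h2.const_smul a).add (h2'.const_smul b), (h3.const_smul a).add (h3'.const_smul b)⟩
  filter_upwards [(h1 n).2.2, (h1' n).2.2, Lp.coeFn_add (a • W n) (b • W' n),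
    Lp.coeFn_add (a • w n) (b • w' n), Lp.coeFn_smul a (W n), Lp.coeFn_smul b (W' n),
    Lp.coeFn_smul a (w n), Lp.coeFn_smul b (w' n)] with x a1 a2 a3 a4 a5 a6 a7 a8
  rw [a3, a4, Pi.add_apply, Pi.add_apply, a5, a6, a7, a8, Pi.smul_apply, Pi.smul_apply,
    Pi.smul_apply, Pi.smul_apply, a1, a2]

/-- The Sobolev inequality passes to the limit. It makes `φ` depend on `g` uniquely and
continuously. -/
lemma exists_norm_le_of_hasHomFracLap (hα : 0 < α) (hαN : α < N) :
    ∃ C : ℝ, 0 < C ∧ ∀ (φ : LStar N α) (g : L2 N), HasHomFracLap α φ g → ‖φ‖ ≤ C * ‖g‖ := by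
  obtain ⟨C, hC, hb⟩ := exists_sobolev_star (N := N) hα hαN
  refine ⟨C, hC, fun φ g hφ => ?_⟩
  obtain ⟨w, k, W, h1, h2, h3⟩ := hasHomFracLap_iff.1 hφ
  refine le_of_tendsto_of_tendsto' h3.norm (h2.norm.const_mul C) fun n => ?_
  have hm := (h1 n).1.memLp (pStar N α)
  have e : W n = hm.toLp (w n) := by
    apply Lp.ext
    exact (h1 n).2.2.trans hm.coeFn_toLp.symm
  rw [e]
  exact norm_toLp_le_sobolev hC (hb _ _ (h1 n).2.1) hm

lemma HasHomFracLap.unique (hα : 0 < α) (hαN : α < N) {φ ψ : LStar N α} {g : L2 N}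
    (hφ : HasHomFracLap α φ g) (hψ : HasHomFracLap α ψ g) : φ = ψ := by
  obtain ⟨C, hC, hb⟩ := exists_norm_le_of_hasHomFracLap (N := N) hα hαN
  have h := hb _ _ (hφ.add_smul hψ 1 (-1))
  simp only [one_smul, neg_smul, add_neg_cancel, norm_zero, mul_zero, norm_le_zero_iff] at h
  rwa [← sub_eq_add_neg, sub_eq_zero] at h

lemma hasHomFracLap_test {w h : L2 N} (hw : IsTest w) (hh : HasFracLap (α / 4) w h) :
    HasHomFracLap α ((hw.memLp (pStar N α)).toLp w) h :=
  hasHomFracLap_iff.2 ⟨fun _ => w, fun _ => h, fun _ => _, fun _ => ⟨hw, hh, MemLp.coeFn_toLp _⟩,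
    tendsto_const_nhds, tendsto_const_nhds⟩

variable (N α) in
/-- The range of `(-Δ)^(α/4)` on test functions. -/
def testRange : Submodule ℝ (L2 N) where
  carrier := {h | ∃ w, IsTest w ∧ HasFracLap (α / 4) w h}
  add_mem' := fun ⟨w, h1, h2⟩ ⟨v, k1, k2⟩ => ⟨w + v, h1.add k1, h2.add k2⟩
  zero_mem' := ⟨0, IsTest.zero, HasFracLap.zero⟩
  smul_mem' := fun c _ ⟨w, h1, h2⟩ => ⟨c • w, h1.smul c, h2.smul c⟩

omit [Fact (1 ≤ pStar N α)] in
lemma HasHomFracLap.mem_closure {φ : LStar N α} {g : L2 N} (h : HasHomFracLap α φ g) :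
    g ∈ (testRange N α).topologicalClosure := by
  obtain ⟨w, k, h1, h2, _⟩ := h
  rw [← SetLike.mem_coe, Submodule.topologicalClosure_coe, mem_closure_iff_seq_limit]
  exact ⟨k, fun n => ⟨w n, h1 n⟩, h2⟩

/-- By the Sobolev bound, preimages of a Cauchy sequence in the range are Cauchy in `L^(2N/(N-α))`.
Hence the closed range in `L²` is a faithful model of `Ḣ^(α/2)`. -/
lemma exists_hasHomFracLap (hα : 0 < α) (hαN : α < N) {g : L2 N}
    (hg : g ∈ (testRange N α).topologicalClosure) : ∃ φ : LStar N α, HasHomFracLap α φ g := by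
  obtain ⟨C, hC, hb⟩ := exists_norm_le_of_hasHomFracLap (N := N) hα hαN
  rw [← SetLike.mem_coe, Submodule.topologicalClosure_coe, mem_closure_iff_seq_limit] at hg
  obtain ⟨k, hk, hlim⟩ := hg
  choose w hw hwk using hk
  set W : ℕ → LStar N α := fun n => ((hw n).memLp (pStar N α)).toLp (w n)
  have hc : CauchySeq W := by
    rw [cauchySeq_iff_tendsto_dist_atTop_0]
    have h1 := (cauchySeq_iff_tendsto_dist_atTop_0.1 hlim.cauchySeq).const_mul C
    rw [mul_zero] at h1
    refine squeeze_zero (fun _ => dist_nonneg) (fun n => ?_) h1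
    rw [dist_eq_norm, dist_eq_norm]
    have := hb _ _ ((hasHomFracLap_test (hw n.1) (hwk n.1)).add_smul
      (hasHomFracLap_test (hw n.2) (hwk n.2)) 1 (-1))
    simpa [← sub_eq_add_neg] using this
  obtain ⟨φ, hφ⟩ := cauchySeq_tendsto_of_complete hc
  exact ⟨φ, hasHomFracLap_iff.2 ⟨w, k, W, fun n => ⟨hw n, hwk n, MemLp.coeFn_toLp _⟩, hlim, hφ⟩⟩

/-- `φ ∈ Ḣ^(α/2)` represents `ρ` in the duality with `Ḣ^(α/2)`, with `g = (-Δ)^(α/4) φ`. -/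
def IsRiesz (α : ℝ) (ρ : E N → ℝ) (φ : LStar N α) (g : L2 N) : Prop :=
  HasHomFracLap α φ g ∧ ∀ (v : LStar N α) (h : L2 N), HasHomFracLap α v h →
    inner ℝ g h = ∫ x, ρ x * v x

omit [Fact (1 ≤ pStar N α)] in
lemma integrable_mul_star (hα : 0 < α) (hαN : α < N) {ρ : E N → ℝ} (hρ : MemLp ρ (cStar N α) volume)
    (v : LStar N α) : Integrable fun x => ρ x * v x := by
  have := holderConjugate_star hα hαN
  exact hρ.integrable_mul (Lp.memLp v)

omit [Fact (1 ≤ pStar N α)] in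
lemma abs_integral_mul_star_le (hα : 0 < α) (hαN : α < N) {ρ : E N → ℝ}
    (hρ : MemLp ρ (cStar N α) volume) (v : LStar N α) :
    |∫ x, ρ x * v x| ≤ (eLpNorm ρ (cStar N α) volume).toReal * ‖v‖ := by
  have := holderConjugate_star hα hαN
  have h1 := eLpNorm_smul_le_mul_eLpNorm (r := 1) (Lp.aestronglyMeasurable v)
    hρ.aestronglyMeasurable (p := cStar N α) (q := pStar N α)
  rw [eLpNorm_one_eq_lintegral_enorm] at h1
  rw [Lp.norm_def, ← ENNReal.toReal_mul, ← Real.norm_eq_abs]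
  calc ‖∫ x, ρ x * v x‖ ≤ (∫⁻ x, ‖ρ x * v x‖ₑ).toReal := by
        have := enorm_integral_le_lintegral_enorm (μ := volume) fun x => ρ x * v x
        rw [← toReal_enorm]
        refine ENNReal.toReal_mono ?_ this
        exact (integrable_mul_star hα hαN hρ v).2.ne
    _ ≤ _ := ENNReal.toReal_mono (ENNReal.mul_ne_top hρ.2.ne (Lp.memLp v).2.ne) h1

/-- The space `Ḣ^(α/2)` is identified with the closed subspace `G` of `L²`; there `v ↦ ∫ ρ v` is
bounded by Hölder and Sobolev, and the Riesz theorem applies. -/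
theorem exists_isRiesz (hα : 0 < α) (hαN : α < N) {ρ : E N → ℝ}
    (hρ : MemLp ρ (cStar N α) volume) : ∃ φ g, IsRiesz α ρ φ g := by
  obtain ⟨C, hC, hb⟩ := exists_norm_le_of_hasHomFracLap (N := N) hα hαN
  set G := (testRange N α).topologicalClosure
  have hcomp : CompleteSpace G := (testRange N α).isClosed_topologicalClosure.completeSpace_coe
  choose T hT using fun g : G => exists_hasHomFracLap hα hαN g.2
  have hi := fun v => integrable_mul_star hα hαN hρ v
  let ℓ : G →ₗ[ℝ] ℝ :=
    { toFun := fun g => ∫ x, ρ x * T g x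
      map_add' := fun g h => by
        have e : T (g + h) = T g + T h := by
          have := (hT g).add_smul (hT h) 1 1
          simp only [one_smul] at this
          exact (hT (g + h)).unique hα hαN this
        rw [e, ← integral_add (hi _) (hi _)]
        apply integral_congr_ae
        filter_upwards [Lp.coeFn_add (T g) (T h)] with x hx
        rw [hx, Pi.add_apply, mul_add]
      map_smul' := fun c g => by
        have e : T (c • g) = c • T g := by
          have := (hT g).add_smul (hT g) c 0
          simp only [zero_smul, add_zero] at this
          exact (hT (c • g)).unique hα hαN this
        rw [e, RingHom.id_apply, smul_eq_mul, ← integral_const_mul]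
        apply integral_congr_ae
        filter_upwards [Lp.coeFn_smul c (T g)] with x hx
        rw [hx, Pi.smul_apply, smul_eq_mul]; ring }
  let L : G →L[ℝ] ℝ := ℓ.mkContinuous ((eLpNorm ρ (cStar N α) volume).toReal * C) fun g => by
    rw [mul_assoc]
    exact (abs_integral_mul_star_le hα hαN hρ (T g)).trans (by gcongr; exact hb _ _ (hT g))
  set g0 := (InnerProductSpace.toDual ℝ G).symm L
  refine ⟨T g0, g0, hT g0, fun v h hv => ?_⟩
  have h1 : inner ℝ g0 (⟨h, hv.mem_closure⟩ : G) = L ⟨h, hv.mem_closure⟩ :=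
    InnerProductSpace.toDual_symm_apply
  have h2 : T ⟨h, hv.mem_closure⟩ = v := (hT ⟨h, hv.mem_closure⟩).unique hα hαN hv
  calc inner ℝ (g0 : L2 N) h = L ⟨h, hv.mem_closure⟩ := h1
    _ = ∫ x, ρ x * T ⟨h, hv.mem_closure⟩ x := rfl
    _ = _ := by rw [h2]

lemma IsRiesz.add_smul (hα : 0 < α) (hαN : α < N) {ρ ρ' : E N → ℝ}
    (hρ : MemLp ρ (cStar N α) volume) (hρ' : MemLp ρ' (cStar N α) volume) {φ φ' : LStar N α}
    {g g' : L2 N} (h : IsRiesz α ρ φ g) (h' : IsRiesz α ρ' φ' g') (a b : ℝ) :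
    IsRiesz α (fun x => a * ρ x + b * ρ' x) (a • φ + b • φ') (a • g + b • g') := by
  refine ⟨h.1.add_smul h'.1 a b, fun v k hv => ?_⟩
  rw [inner_add_left, real_inner_smul_left, real_inner_smul_left, h.2 v k hv, h'.2 v k hv,
    ← integral_const_mul, ← integral_const_mul,
    ← integral_add ((integrable_mul_star hα hαN hρ v).const_mul a)
      ((integrable_mul_star hα hαN hρ' v).const_mul b)]
  congr 1; ext x; ring

lemma IsRiesz.unique (hα : 0 < α) (hαN : α < N) {ρ : E N → ℝ} {φ φ' : LStar N α} {g g' : L2 N}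
    (h : IsRiesz α ρ φ g) (h' : IsRiesz α ρ φ' g') : φ = φ' ∧ g = g' := by
  have h1 := h.1.add_smul h'.1 1 (-1)
  have e : g = g' := by
    have h2 := (h.2 _ _ h1).trans (h'.2 _ _ h1).symm
    rw [← sub_eq_zero, ← inner_sub_left] at h2
    simp only [one_smul, neg_smul, ← sub_eq_add_neg] at h2
    rwa [inner_self_eq_zero, sub_eq_zero] at h2
  subst e
  exact ⟨h.1.unique hα hαN h'.1, rfl⟩

lemma IsRiesz.norm_le (hα : 0 < α) (hαN : α < N) :
    ∃ C : ℝ, 0 < C ∧ ∀ {ρ : E N → ℝ} {φ : LStar N α} {g : L2 N},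
      MemLp ρ (cStar N α) volume → IsRiesz α ρ φ g →
      ‖g‖ ≤ C * (eLpNorm ρ (cStar N α) volume).toReal := by
  obtain ⟨C, hC, hb⟩ := exists_norm_le_of_hasHomFracLap (N := N) hα hαN
  refine ⟨C, hC, fun {ρ φ g} hρ h => ?_⟩
  have h1 := h.2 _ _ h.1
  rw [real_inner_self_eq_norm_sq] at h1
  have h2 := (le_abs_self _).trans (abs_integral_mul_star_le hα hαN hρ φ)
  rw [← h1] at h2
  have h3 := hb _ _ h.1
  rcases eq_or_lt_of_le (norm_nonneg g) with h0 | h0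
  · rw [← h0]; positivity
  · have : ‖g‖ * ‖g‖ ≤ (C * (eLpNorm ρ (cStar N α) volume).toReal) * ‖g‖ := by
      calc ‖g‖ * ‖g‖ = ‖g‖ ^ 2 := by ring
        _ ≤ _ := h2
        _ ≤ (eLpNorm ρ (cStar N α) volume).toReal * (C * ‖g‖) := by gcongr
        _ = _ := by ring
    exact le_of_mul_le_mul_right this h0

variable {θ ε : ℝ}

/-- The coefficient `ε^(α-θ) γ_α` of the Poisson equation. -/
def coef (N : ℕ) (α θ ε : ℝ) : ℝ := ε ^ (α - θ) * gammaConst N α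

omit [Fact (1 ≤ pStar N α)] in
lemma gammaConst_pos (hα : 0 < α) (hαN : α < N) : 0 < gammaConst N α := by
  unfold gammaConst
  have h1 : 0 < Real.Gamma (α / 2) := Real.Gamma_pos_of_pos (by linarith)
  have h2 : 0 < Real.Gamma ((N : ℝ) / 2 - α / 2) := Real.Gamma_pos_of_pos (by linarith)
  have := Real.pi_pos
  positivity

omit [Fact (1 ≤ pStar N α)] in
lemma coef_pos (hα : 0 < α) (hαN : α < N) (hε : 0 < ε) : 0 < coef N α θ ε :=
  mul_pos (Real.rpow_pos_of_pos hε _) (gammaConst_pos hα hαN)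

omit [Fact (1 ≤ pStar N α)] in
lemma isPoissonSol_iff (u : L2 N) (φ : LStar N α) :
    IsPoissonSol α θ ε u φ ↔ ∃ g, IsRiesz α (fun x => coef N α θ ε * (u x) ^ 2) φ g := by
  unfold IsPoissonSol IsRiesz
  refine exists_congr fun g => and_congr_right fun _ => forall₃_congr fun v h _ => ?_
  rw [inner_eq_integral, coef, ← integral_const_mul]
  simp only [mul_assoc]

/-- Uniqueness identifies the chosen solution with a multiple of the Riesz representative of `u²`,
so `ε` and `θ` enter only through a scalar factor. -/
theorem phi_eq (hα : 0 < α) (hαN : α < N) {u : L2 N}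
    (hu : MemLp (fun x => (u x) ^ 2) (cStar N α) volume) {φ : LStar N α} {g : L2 N}
    (h : IsRiesz α (fun x => (u x) ^ 2) φ g) :
    phi α θ ε u = coef N α θ ε • φ ∧ IsPoissonSol α θ ε u (phi α θ ε u) := by
  have h1 := h.add_smul hα hαN hu hu h (coef N α θ ε) 0
  simp only [zero_smul, add_zero, zero_mul] at h1
  have hex : ∃ φ : LStar N α, IsPoissonSol α θ ε u φ := ⟨_, (isPoissonSol_iff _ _).2 ⟨_, h1⟩⟩
  have hspec : IsPoissonSol α θ ε u (phi α θ ε u) := by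
    rw [phi, dif_pos hex]; exact hex.choose_spec
  refine ⟨?_, hspec⟩
  obtain ⟨g', hg'⟩ := (isPoissonSol_iff _ _).1 hspec
  exact (hg'.unique hα hαN h1).1

/-- Poisson integrals become inner products of Riesz representatives, which makes them a symmetric
positive form in the densities. -/
lemma integral_phi_mul (hα : 0 < α) (hαN : α < N) {u : L2 N}
    (hu : MemLp (fun x => (u x) ^ 2) (cStar N α) volume) {φ : LStar N α} {g : L2 N}
    (h : IsRiesz α (fun x => (u x) ^ 2) φ g) {ρ : E N → ℝ} {ψ : LStar N α} {k : L2 N}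
    (hρ : IsRiesz α ρ ψ k) :
    ∫ x, phi α θ ε u x * ρ x = coef N α θ ε * inner ℝ g k := by
  rw [(phi_eq hα hαN hu h).1, real_inner_comm, hρ.2 _ _ h.1, ← integral_const_mul]
  apply integral_congr_ae
  filter_upwards [Lp.coeFn_smul (coef N α θ ε) φ] with x hx
  rw [hx, Pi.smul_apply, smul_eq_mul]; ring

/-- The Poisson energy is sequentially lower semicontinuous under local convergence. -/
theorem eventually_norm_sq_le {ρ : ℕ → E N → ℝ} {ρ₀ : E N → ℝ}
    {φ : ℕ → LStar N α} {φ₀ : LStar N α} {g : ℕ → L2 N} {g₀ : L2 N}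
    (h : ∀ n, IsRiesz α (ρ n) (φ n) (g n)) (h₀ : IsRiesz α ρ₀ φ₀ g₀)
    (hlim : ∀ w : L2 N, IsTest w → Tendsto (fun n => ∫ x, ρ n x * w x) atTop
      (𝓝 (∫ x, ρ₀ x * w x))) {δ : ℝ} (hδ : 0 < δ) :
    ∀ᶠ n in atTop, ‖g₀‖ ^ 2 ≤ ‖g n‖ ^ 2 + δ := by
  have hg₀ := h₀.1.mem_closure
  rw [← SetLike.mem_coe, Submodule.topologicalClosure_coe, Metric.mem_closure_iff] at hg₀
  -- Expanding `‖g n - k‖² ≥ 0` gives `‖g n‖² ≥ 2⟪g n, k⟫ - ‖k‖²`, whose limit is `‖g₀‖² - ‖g₀ -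
  -- k‖²`. The choice of `k` costs `δ/2`, and so does the convergence of the inner products.
  obtain ⟨k, ⟨w, hw, hwk⟩, hd⟩ := hg₀ (√(δ / 2)) (by positivity)
  have hd2 : ‖g₀ - k‖ ^ 2 ≤ δ / 2 := by
    rw [dist_eq_norm] at hd
    calc _ ≤ (√(δ / 2)) ^ 2 := by gcongr
      _ = _ := Real.sq_sqrt (by positivity)
  have hv := hasHomFracLap_test hw hwk
  have key : ∀ {ρ : E N → ℝ} {φ : LStar N α} {g : L2 N}, IsRiesz α ρ φ g →
      inner ℝ g k = ∫ x, ρ x * w x := fun {ρ φ g} h => by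
    rw [h.2 _ _ hv]
    apply integral_congr_ae
    filter_upwards [(hw.memLp (pStar N α)).coeFn_toLp] with x hx
    rw [hx]
  have hlim' : Tendsto (fun n => inner ℝ (g n) k) atTop (𝓝 (inner ℝ g₀ k)) := by
    rw [key h₀]
    exact (hlim w hw).congr fun n => (key (h n)).symm
  filter_upwards [hlim'.eventually (lt_mem_nhds (by linarith : inner ℝ g₀ k - δ / 4 < _))]
    with n hn
  have e1 : ‖g n - k‖ ^ 2 = ‖g n‖ ^ 2 - 2 * inner ℝ (g n) k + ‖k‖ ^ 2 := norm_sub_sq_real _ _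
  have e2 : ‖g₀ - k‖ ^ 2 = ‖g₀‖ ^ 2 - 2 * inner ℝ g₀ k + ‖k‖ ^ 2 := norm_sub_sq_real _ _
  nlinarith [sq_nonneg ‖g n - k‖]

end WithFact

end Poisson

/-! ### Scalar inequalities for powers and for the nonlinearity -/

section Scalar

lemma rpow_le_add_rpow {a b c x : ℝ} (ha : 0 < a) (hab : a ≤ b) (hbc : b ≤ c) (hx : 0 ≤ x) :
    x ^ b ≤ x ^ a + x ^ c := by
  rcases hx.eq_or_lt with rfl | hx
  · rw [Real.zero_rpow (by linarith)]; positivity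
  rcases le_total x 1 with h | h
  · have := Real.rpow_le_rpow_of_exponent_ge hx h hab
    have : 0 < x ^ c := by positivity
    linarith
  · have := Real.rpow_le_rpow_of_exponent_le h hbc
    have : 0 < x ^ a := by positivity
    linarith

/-- The threshold `R` solves `δ R^(c-b) = 1`: above it the higher power absorbs `x^b`, below it the
lower one does with constant `R^(b-a)`. -/
lemma exists_rpow_le_high {a b c : ℝ} (ha : 0 < a) (hab : a < b) (hbc : b < c) {δ : ℝ}
    (hδ : 0 < δ) : ∃ C : ℝ, 0 < C ∧ ∀ x : ℝ, 0 ≤ x → x ^ b ≤ δ * x ^ c + C * x ^ a := by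
  set R : ℝ := (1 / δ) ^ (1 / (c - b))
  have hR : 0 < R := by positivity
  refine ⟨R ^ (b - a), by positivity, fun x hx => ?_⟩
  rcases hx.eq_or_lt with rfl | hx
  · rw [Real.zero_rpow (by linarith)]; positivity
  rcases le_total x R with h | h
  · have h1 : x ^ b = x ^ (b - a) * x ^ a := by rw [← Real.rpow_add hx]; congr 1; ring
    have h2 : x ^ (b - a) ≤ R ^ (b - a) := Real.rpow_le_rpow hx.le h (by linarith)
    have h3 : 0 < x ^ c := by positivity
    rw [h1]
    have : x ^ (b - a) * x ^ a ≤ R ^ (b - a) * x ^ a := by gcongr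
    nlinarith
  · have h1 : x ^ c = x ^ (c - b) * x ^ b := by rw [← Real.rpow_add hx]; congr 1; ring
    have h2 : R ^ (c - b) ≤ x ^ (c - b) := Real.rpow_le_rpow hR.le h (by linarith)
    have h3 : R ^ (c - b) = 1 / δ := by
      rw [← Real.rpow_mul (by positivity), one_div_mul_cancel (by linarith), Real.rpow_one]
    have h4 : 1 ≤ δ * x ^ (c - b) := by
      rw [h3, div_le_iff₀ hδ] at h2; linarith
    have h5 : 0 < x ^ b := by positivity
    have h6 : 0 < R ^ (b - a) * x ^ a := by positivity
    rw [h1]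
    nlinarith

/-- The same with the small factor on the lower power, hence the threshold `R^(b-a) = δ`. -/
lemma exists_rpow_le_low {a b c : ℝ} (ha : 0 < a) (hab : a < b) (hbc : b < c) {δ : ℝ}
    (hδ : 0 < δ) : ∃ C : ℝ, 0 < C ∧ ∀ x : ℝ, 0 ≤ x → x ^ b ≤ δ * x ^ a + C * x ^ c := by
  set R : ℝ := δ ^ (1 / (b - a))
  have hR : 0 < R := by positivity
  refine ⟨R ^ (b - c), by positivity, fun x hx => ?_⟩
  rcases hx.eq_or_lt with rfl | hx
  · rw [Real.zero_rpow (by linarith)]; positivity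
  rcases le_total R x with h | h
  · have h1 : x ^ b = x ^ (b - c) * x ^ c := by rw [← Real.rpow_add hx]; congr 1; ring
    have h2 : x ^ (b - c) ≤ R ^ (b - c) := Real.rpow_le_rpow_of_nonpos hR h (by linarith)
    have h3 : 0 < x ^ a := by positivity
    rw [h1]
    have : x ^ (b - c) * x ^ c ≤ R ^ (b - c) * x ^ c := by gcongr
    nlinarith
  · have h1 : x ^ b = x ^ (b - a) * x ^ a := by rw [← Real.rpow_add hx]; congr 1; ring
    have h2 : x ^ (b - a) ≤ R ^ (b - a) := Real.rpow_le_rpow hx.le h (by linarith)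
    have h3 : R ^ (b - a) = δ := by
      rw [← Real.rpow_mul hδ.le, one_div_mul_cancel (by linarith), Real.rpow_one]
    have h5 : 0 < x ^ a := by positivity
    have h6 : 0 < R ^ (b - c) * x ^ c := by positivity
    rw [h1]
    rw [h3] at h2
    nlinarith

/-- The hypotheses on the nonlinearity, with growth of order less than `p - 1`. -/
structure Nonlinearity (f : ℝ → ℝ) (p : ℝ) : Prop where
  cont : Continuous f
  eq_zero : ∀ t ≤ 0, f t = 0
  small : Tendsto (fun t => f t / t) (𝓝[≠] 0) (𝓝 0)
  growth : Tendsto (fun t => f t / t ^ (p - 1)) atTop (𝓝 0)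
  ambrosetti : ∃ K : ℝ, 4 < K ∧ ∀ t > 0, 0 < K * primitive f t ∧ K * primitive f t ≤ t * f t
  mono : StrictMonoOn (fun t => f t / t ^ 3) (Ioi 0)

namespace Nonlinearity

variable {f : ℝ → ℝ} {p : ℝ}

lemma hasDerivAt (hf : Nonlinearity f p) (t : ℝ) : HasDerivAt (primitive f) (f t) t :=
  intervalIntegral.integral_hasDerivAt_right (hf.cont.intervalIntegrable _ _)
    (hf.cont.stronglyMeasurableAtFilter _ _) hf.cont.continuousAt

lemma continuous_primitive (hf : Nonlinearity f p) : Continuous (primitive f) :=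
  continuous_iff_continuousAt.2 fun t => (hf.hasDerivAt t).continuousAt

lemma primitive_eq_zero (hf : Nonlinearity f p) {t : ℝ} (ht : t ≤ 0) : primitive f t = 0 := by
  unfold primitive
  rw [intervalIntegral.integral_symm, neg_eq_zero]
  apply intervalIntegral.integral_zero_ae
  refine ae_of_all _ fun x hx => hf.eq_zero x ?_
  rw [uIoc_of_le ht] at hx
  exact hx.2

lemma primitive_pos (hf : Nonlinearity f p) {t : ℝ} (ht : 0 < t) : 0 < primitive f t := by
  obtain ⟨K, hK, h⟩ := hf.ambrosetti
  have := (h t ht).1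
  exact pos_of_mul_pos_right this (by linarith)

lemma primitive_nonneg (hf : Nonlinearity f p) (t : ℝ) : 0 ≤ primitive f t := by
  rcases le_or_gt t 0 with h | h
  · exact (hf.primitive_eq_zero h).ge
  · exact (hf.primitive_pos h).le

lemma pos (hf : Nonlinearity f p) {t : ℝ} (ht : 0 < t) : 0 < f t := by
  obtain ⟨K, hK, h⟩ := hf.ambrosetti
  have := (h t ht).1.trans_le (h t ht).2
  exact pos_of_mul_pos_right this ht.le

lemma nonneg (hf : Nonlinearity f p) (t : ℝ) : 0 ≤ f t := by
  rcases le_or_gt t 0 with h | h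
  · exact (hf.eq_zero t h).ge
  · exact (hf.pos h).le

lemma mul_self_nonneg (hf : Nonlinearity f p) (t : ℝ) : 0 ≤ f t * t := by
  rcases le_or_gt t 0 with h | h
  · rw [hf.eq_zero t h, zero_mul]
  · exact (mul_pos (hf.pos h) h).le

lemma four_primitive_le (hf : Nonlinearity f p) (t : ℝ) : 4 * primitive f t ≤ f t * t := by
  rcases le_or_gt t 0 with h | h
  · rw [hf.primitive_eq_zero h, hf.eq_zero t h]; simp
  · obtain ⟨K, hK, h2⟩ := hf.ambrosetti
    have := (h2 t h).2
    have := hf.primitive_pos h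
    nlinarith

/-- Monotonicity of `f(t)/t³` in multiplicative form. The fourth power matches the homogeneity of
the Poisson energy, so the two can be compared on rays. -/
lemma scale_ge (hf : Nonlinearity f p) {t : ℝ} (ht : 1 ≤ t) (x : ℝ) :
    t ^ 4 * (f x * x) ≤ f (t * x) * (t * x) := by
  rcases le_or_gt x 0 with h | h
  · rw [hf.eq_zero x h, hf.eq_zero _ (mul_nonpos_of_nonneg_of_nonpos (by linarith) h)]; simp
  · have h1 : 0 < t * x := by positivity
    have h2 := hf.mono.monotoneOn (mem_Ioi.2 h) (mem_Ioi.2 h1) (by nlinarith)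
    beta_reduce at h2
    rw [div_le_div_iff₀ (by positivity) (by positivity)] at h2
    have h3 : f x * t ^ 3 ≤ f (t * x) := by
      have : f x * t ^ 3 * x ^ 3 ≤ f (t * x) * x ^ 3 := by
        calc _ = f x * (t * x) ^ 3 := by ring
          _ ≤ _ := h2
      exact le_of_mul_le_mul_right this (by positivity)
    calc _ = (f x * t ^ 3) * (t * x) := by ring
      _ ≤ _ := by gcongr

lemma scale_le (hf : Nonlinearity f p) {t : ℝ} (ht0 : 0 ≤ t) (ht : t ≤ 1) (x : ℝ) :
    f (t * x) * (t * x) ≤ t ^ 4 * (f x * x) := by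
  rcases ht0.eq_or_lt with rfl | ht0
  · simp
  have h := hf.scale_ge ((one_le_inv₀ ht0).2 ht) (t * x)
  rw [inv_mul_cancel_left₀ ht0.ne'] at h
  calc _ = t ^ 4 * (t⁻¹ ^ 4 * (f (t * x) * (t * x))) := by field_simp
    _ ≤ _ := by gcongr

lemma mul_self_mono (hf : Nonlinearity f p) {x y : ℝ} (h : x ≤ y) : f x * x ≤ f y * y := by
  rcases le_or_gt x 0 with hx | hx
  · rw [hf.eq_zero x hx, zero_mul]; exact hf.mul_self_nonneg y
  · have h1 : 1 ≤ y / x := (one_le_div hx).2 h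
    have h2 := hf.scale_ge h1 x
    rw [div_mul_cancel₀ _ hx.ne'] at h2
    have h3 := hf.mul_self_nonneg x
    have : 1 ≤ (y / x) ^ 4 := one_le_pow₀ h1
    nlinarith

/-- By the quartic scaling, `F(tx) - t⁴/4 · f(x)x` decreases in `t` on `[0,1]` and increases
afterwards, so its minimum is at `t = 1`. Integrated, this makes Nehari points maxima on their rays.
-/
lemma fiber_ineq (hf : Nonlinearity f p) {t : ℝ} (ht : 0 ≤ t) (x : ℝ) :
    (t ^ 4 - 1) / 4 * (f x * x) ≤ primitive f (t * x) - primitive f x := by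
  set ψ : ℝ → ℝ := fun t => primitive f (t * x) - t ^ 4 / 4 * (f x * x)
  have hd : ∀ t, HasDerivAt ψ (f (t * x) * x - t ^ 3 * (f x * x)) t := fun t => by
    have h1 : HasDerivAt (fun t => primitive f (t * x)) (f (t * x) * x) t :=
      HasDerivAt.comp (h₂ := primitive f) (h := fun t => t * x) t (hf.hasDerivAt (t * x))
        (hasDerivAt_mul_const x)
    have h2 : HasDerivAt (fun t : ℝ => t ^ 4 / 4 * (f x * x)) (t ^ 3 * (f x * x)) t := by
      have := (((hasDerivAt_id t).fun_pow 4).div_const 4).mul_const (f x * x)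
      refine this.congr_deriv ?_
      simp only [id]; push_cast; ring
    exact h1.sub h2
  have hc : Continuous ψ := continuous_iff_continuousAt.2 fun t => (hd t).continuousAt
  have key : ψ 1 ≤ ψ t := by
    rcases le_total t 1 with h | h
    · have : AntitoneOn ψ (Icc 0 1) := by
        apply antitoneOn_of_deriv_nonpos (convex_Icc 0 1) hc.continuousOn
        · exact fun t _ => (hd t).differentiableAt.differentiableWithinAt
        · intro t ht
          rw [interior_Icc] at ht
          rw [(hd t).deriv]
          have := hf.scale_le ht.1.le ht.2.le x
          have h0 := ht.1
          have : t * (f (t * x) * x) ≤ t * (t ^ 3 * (f x * x)) := by linarith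
          linarith [le_of_mul_le_mul_left this h0]
      exact this ⟨ht, h⟩ ⟨zero_le_one, le_rfl⟩ h
    · have : MonotoneOn ψ (Ici 1) := by
        apply monotoneOn_of_deriv_nonneg (convex_Ici 1) hc.continuousOn
        · exact fun t _ => (hd t).differentiableAt.differentiableWithinAt
        · intro t ht
          rw [interior_Ici] at ht
          rw [(hd t).deriv]
          have ht' : 1 < t := ht
          have := hf.scale_ge ht'.le x
          have : t * (t ^ 3 * (f x * x)) ≤ t * (f (t * x) * x) := by linarith
          linarith [le_of_mul_le_mul_left this (by linarith)]
      exact this (self_mem_Ici) h h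
  simp only [ψ, one_mul] at key
  linarith

/-- The Ambrosetti-Rabinowitz inequality says precisely that `F(tx) t^(-K)` has nonnegative
derivative. -/
lemma primitive_scale (hf : Nonlinearity f p) : ∃ K : ℝ, 4 < K ∧ ∀ T : ℝ, 1 ≤ T → ∀ x,
    T ^ K * primitive f x ≤ primitive f (T * x) := by
  obtain ⟨K, hK, h⟩ := hf.ambrosetti
  refine ⟨K, hK, fun T hT x => ?_⟩
  rcases le_or_gt x 0 with hx | hx
  · rw [hf.primitive_eq_zero hx, hf.primitive_eq_zero
      (mul_nonpos_of_nonneg_of_nonpos (by linarith) hx), mul_zero]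
  set ψ : ℝ → ℝ := fun t => primitive f (t * x) * t ^ (-K)
  have hd : ∀ t, 0 < t → HasDerivAt ψ (f (t * x) * x * t ^ (-K) +
      primitive f (t * x) * (-K * t ^ (-K - 1))) t := fun t ht => by
    have h1 : HasDerivAt (fun t => primitive f (t * x)) (f (t * x) * x) t :=
      HasDerivAt.comp (h₂ := primitive f) (h := fun t => t * x) t (hf.hasDerivAt (t * x))
        (hasDerivAt_mul_const x)
    exact h1.mul (Real.hasDerivAt_rpow_const (Or.inl ht.ne'))
  have hm : MonotoneOn ψ (Ici 1) := by
    apply monotoneOn_of_deriv_nonneg (convex_Ici 1)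
    · intro t ht
      have ht' : (1 : ℝ) ≤ t := ht
      exact (hd t (by linarith)).continuousAt.continuousWithinAt
    · intro t ht
      rw [interior_Ici] at ht
      have ht' : (1 : ℝ) < t := ht
      exact (hd t (by linarith)).differentiableAt.differentiableWithinAt
    · intro t ht
      rw [interior_Ici] at ht
      have ht' : (1 : ℝ) < t := ht
      have ht0 : 0 < t := by linarith
      rw [(hd t (by linarith)).deriv]
      have h2 := (h (t * x) (by positivity)).2
      have e : t ^ (-K) = t * t ^ (-K - 1) := by
        rw [Real.rpow_sub_one ht0.ne']; field_simp
      rw [e]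
      have h3 : 0 < t ^ (-K - 1) := by positivity
      have : 0 ≤ t ^ (-K - 1) * (t * x * f (t * x) - K * primitive f (t * x)) :=
        mul_nonneg h3.le (by linarith)
      linarith
  have := hm self_mem_Ici hT hT
  simp only [ψ, one_mul, Real.one_rpow, mul_one] at this
  have hTK : T ^ (-K) * T ^ K = 1 := by
    rw [← Real.rpow_add (by linarith)]; simp
  calc _ ≤ T ^ K * (primitive f (T * x) * T ^ (-K)) := by gcongr
    _ = primitive f (T * x) * (T ^ (-K) * T ^ K) := by ring
    _ = _ := by rw [hTK, mul_one]

/-- For `t ≥ 1` monotonicity gives `f(t) ≥ f(1) t³` with `f(1) > 0`, which is incompatible with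
`f(t) = o(t^(p-1))` unless `p > 4`. -/
lemma four_lt (hf : Nonlinearity f p) : 4 < p := by
  by_contra hp
  push Not at hp
  have h1 := hf.pos one_pos
  have h2 := ((hf.growth.eventually (gt_mem_nhds h1)).and (eventually_ge_atTop 1)).exists
  obtain ⟨t, h3, h4⟩ := h2
  have h5 := hf.mono.monotoneOn (mem_Ioi.2 one_pos) (mem_Ioi.2 (by linarith : 0 < t)) h4
  simp only [one_pow, div_one] at h5
  have h6 : t ^ (p - 1) ≤ t ^ (3 : ℝ) := Real.rpow_le_rpow_of_exponent_le h4 (by linarith)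
  have h7 : t ^ (3 : ℝ) = t ^ 3 := by norm_cast
  have h8 : 0 < t ^ (p - 1) := by positivity
  have h9 : f t / t ^ 3 ≤ f t / t ^ (p - 1) := by
    apply div_le_div_of_nonneg_left (hf.nonneg t) h8
    rw [← h7]; exact h6
  linarith

lemma exists_bound (hf : Nonlinearity f p) {δ : ℝ} (hδ : 0 < δ) :
    ∃ C : ℝ, 0 < C ∧ ∀ t, f t ≤ δ * |t| + C * |t| ^ (p - 1) := by
  have hp := hf.four_lt
  obtain ⟨η, hη, h1⟩ : ∃ η > 0, ∀ t, 0 < t → t < η → f t ≤ δ * t := by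
    have := hf.small.eventually (gt_mem_nhds hδ)
    rw [eventually_nhdsWithin_iff, Metric.eventually_nhds_iff] at this
    obtain ⟨η, hη, h⟩ := this
    refine ⟨η, hη, fun t ht1 ht2 => ?_⟩
    have := h (y := t) (by simpa [abs_of_pos ht1] using ht2) ht1.ne'
    rw [div_lt_iff₀ ht1] at this
    exact this.le
  obtain ⟨R, h2⟩ := eventually_atTop.1 (hf.growth.eventually (gt_mem_nhds one_pos))
  set R' := max R η
  obtain ⟨M, hM⟩ := isCompact_Icc.exists_bound_of_continuousOn (s := Icc η R')
    hf.cont.continuousOn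
  have hηp : 0 < η ^ (p - 1) := by positivity
  have hM0 : 0 ≤ M := (norm_nonneg _).trans (hM η ⟨le_rfl, le_max_right _ _⟩)
  refine ⟨1 + M / η ^ (p - 1), by positivity, fun t => ?_⟩
  rcases le_or_gt t 0 with ht | ht
  · rw [hf.eq_zero t ht]; positivity
  rw [abs_of_pos ht]
  have htp : 0 < t ^ (p - 1) := by positivity
  have hMq : 0 ≤ M / η ^ (p - 1) := by positivity
  rcases lt_or_ge t η with h3 | h3
  · have := h1 t ht h3
    have : 0 ≤ (1 + M / η ^ (p - 1)) * t ^ (p - 1) := by positivity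
    linarith
  rcases le_or_gt t R' with h4 | h4
  · have h5 : f t ≤ M := (le_abs_self _).trans (hM t ⟨h3, h4⟩)
    have h6 : η ^ (p - 1) ≤ t ^ (p - 1) := Real.rpow_le_rpow hη.le h3 (by linarith)
    have h7 : M ≤ M / η ^ (p - 1) * t ^ (p - 1) := by
      rw [div_mul_eq_mul_div, le_div_iff₀ hηp]
      gcongr
    have : 0 < δ * t := by positivity
    nlinarith
  · have h5 := h2 t ((le_max_left _ _).trans h4.le)
    rw [div_lt_one htp] at h5
    have : 0 < δ * t := by positivity
    nlinarith [mul_nonneg hMq htp.le]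

lemma abs_rpow_mul (hp : 4 < p) (t : ℝ) : |t| ^ (p - 1) * |t| = |t| ^ p := by
  rcases eq_or_ne t 0 with rfl | h
  · rw [abs_zero, Real.zero_rpow (by linarith : p ≠ 0), mul_zero]
  · rw [← Real.rpow_add_one (abs_pos.2 h).ne']; congr 1; ring

lemma exists_bound_mul (hf : Nonlinearity f p) {δ : ℝ} (hδ : 0 < δ) :
    ∃ C : ℝ, 0 < C ∧ ∀ t, f t * t ≤ δ * t ^ 2 + C * |t| ^ p := by
  obtain ⟨C, hC, h⟩ := hf.exists_bound hδ
  refine ⟨C, hC, fun t => ?_⟩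
  calc f t * t ≤ f t * |t| := by gcongr; exacts [hf.nonneg t, le_abs_self t]
    _ ≤ (δ * |t| + C * |t| ^ (p - 1)) * |t| := by gcongr; exact h t
    _ = δ * |t| ^ 2 + C * (|t| ^ (p - 1) * |t|) := by ring
    _ = _ := by rw [abs_rpow_mul hf.four_lt, sq_abs]

end Nonlinearity

/-- The gauge `t² + |t|^p`. -/
def gauge2 (p t : ℝ) : ℝ := t ^ 2 + |t| ^ p

lemma gauge2_nonneg (p t : ℝ) : 0 ≤ gauge2 p t := by unfold gauge2; positivity

lemma gauge2_mul_le {p c : ℝ} (hp : 4 < p) (hc : 1 ≤ c) (t : ℝ) :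
    gauge2 p (c * t) ≤ c ^ p * gauge2 p t := by
  unfold gauge2
  have hc0 : 0 < c := by linarith
  rw [abs_mul, abs_of_pos hc0, Real.mul_rpow hc0.le (abs_nonneg _), mul_pow, mul_add]
  gcongr
  rw [← Real.rpow_natCast]
  apply Real.rpow_le_rpow_of_exponent_le hc
  push_cast; linarith

lemma gauge2_mono {p s t : ℝ} (hp : 4 < p) (h : |s| ≤ |t|) : gauge2 p s ≤ gauge2 p t := by
  unfold gauge2
  rw [← sq_abs s, ← sq_abs t]
  gcongr

namespace Nonlinearity

variable {f : ℝ → ℝ} {p : ℝ}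

/-- Both arguments are replaced by the larger modulus, at the cost of adding the two gauges; this
dominates every mixed integrand that occurs. -/
lemma exists_gauge_bound (hf : Nonlinearity f p) :
    ∃ C : ℝ, 0 < C ∧ ∀ a b, f a * |b| ≤ C * (gauge2 p a + gauge2 p b) := by
  obtain ⟨C, hC, h⟩ := hf.exists_bound one_pos
  refine ⟨1 + C, by positivity, fun a b => ?_⟩
  set m := max |a| |b|
  have hm0 : 0 ≤ m := (abs_nonneg a).trans (le_max_left _ _)
  have hp := hf.four_lt
  have h1 : gauge2 p m ≤ gauge2 p a + gauge2 p b := by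
    have ha := gauge2_nonneg p a
    have hb := gauge2_nonneg p b
    rcases max_choice |a| |b| with e | e
    · have : gauge2 p m ≤ gauge2 p a := gauge2_mono hp (by simp only [m, e]; simp)
      linarith
    · have : gauge2 p m ≤ gauge2 p b := gauge2_mono hp (by simp only [m, e]; simp)
      linarith
  have e1 : |a| ≤ m := le_max_left _ _
  have e2 : |b| ≤ m := le_max_right _ _
  calc f a * |b| ≤ (1 * |a| + C * |a| ^ (p - 1)) * |b| := by gcongr; exact h a
    _ ≤ (1 * m + C * m ^ (p - 1)) * m := by gcongr; linarith
    _ = m ^ 2 + C * (|m| ^ (p - 1) * |m|) := by rw [abs_of_nonneg hm0]; ring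
    _ = m ^ 2 + C * |m| ^ p := by rw [abs_rpow_mul hp]
    _ ≤ (1 + C) * gauge2 p m := by
      unfold gauge2
      have : 0 ≤ |m| ^ p := by positivity
      nlinarith [sq_nonneg m]
    _ ≤ _ := by gcongr

lemma primitive_add_sub (hf : Nonlinearity f p) (a b : ℝ) :
    ∃ c, |c| ≤ |a| + |b| ∧ primitive f (a + b) - primitive f b = f c * a := by
  rcases eq_or_ne a 0 with rfl | ha
  · exact ⟨0, by rw [abs_zero]; positivity, by simp⟩
  have hd : ∀ t, HasDerivAt (fun t => primitive f (t * a + b)) (f (t * a + b) * a) t := fun t =>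
    HasDerivAt.comp (h₂ := primitive f) (h := fun t => t * a + b) t (hf.hasDerivAt (t * a + b))
      ((hasDerivAt_mul_const a).add_const b)
  obtain ⟨t, ht, e⟩ := exists_hasDerivAt_eq_slope (fun t => primitive f (t * a + b)) _ zero_lt_one
    (continuous_iff_continuousAt.2 fun t => (hd t).continuousAt).continuousOn fun t _ => hd t
  refine ⟨t * a + b, ?_, ?_⟩
  · have h1 : |t * a| ≤ |a| := by
      rw [abs_mul, abs_of_pos ht.1]
      exact mul_le_of_le_one_left (abs_nonneg a) ht.2.le
    calc |t * a + b| ≤ |t * a| + |b| := abs_add_le _ _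
      _ ≤ |a| + |b| := by linarith
  · rw [e]; simp

/-- The splitting estimate of Brezis-Lieb type. -/
theorem exists_split_bound (hf : Nonlinearity f p) {δ : ℝ} (hδ : 0 < δ) :
    ∃ C : ℝ, 0 < C ∧ ∀ a b, |primitive f (a + b) - primitive f a - primitive f b| ≤
      δ * gauge2 p b + C * gauge2 p a := by
  obtain ⟨C, hC, h⟩ := hf.exists_bound one_pos
  obtain ⟨C', hC', h'⟩ := hf.exists_gauge_bound
  have hp := hf.four_lt
  set C2 := (1 + C) * 2 ^ p
  have hC2 : 0 < C2 := by positivity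
  -- The ratio `|a|/|b|` is compared with `η`. Above it `b` is bounded by a multiple of `a`, and the
  -- gauge of `a` absorbs everything; below it the factor `|a| < η|b|` of the mean value formula
  -- supplies the smallness.
  set η := min 1 (δ / C2)
  have hη : 0 < η := lt_min one_pos (by positivity)
  have hη1 : η ≤ 1 := min_le_left _ _
  have hηδ : C2 * η ≤ δ := by
    calc C2 * η ≤ C2 * (δ / C2) := by gcongr; exact min_le_right _ _
      _ = δ := by field_simp
  have hFa : ∀ a, primitive f a ≤ C' * gauge2 p a := fun a => by
    have h1 := hf.four_primitive_le a
    have h2 := h' a a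
    have h3 : f a * a ≤ f a * |a| := by gcongr; exacts [hf.nonneg a, le_abs_self a]
    have h4 := hf.primitive_nonneg a
    nlinarith [mul_nonneg hC'.le (gauge2_nonneg p a)]
  have hroot : ∀ a b, |primitive f (a + b) - primitive f a - primitive f b| ≤
      |a| * ((1 + C) * ((|a| + |b|) + (|a| + |b|) ^ (p - 1))) + C' * gauge2 p a := fun a b => by
    obtain ⟨c, hc, e⟩ := hf.primitive_add_sub a b
    have e2 : primitive f (a + b) - primitive f a - primitive f b = f c * a - primitive f a := by
      linarith
    rw [e2]
    refine (abs_sub _ _).trans ?_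
    rw [abs_of_nonneg (hf.primitive_nonneg a), abs_mul, abs_of_nonneg (hf.nonneg c), mul_comm]
    refine add_le_add (mul_le_mul_of_nonneg_left ?_ (abs_nonneg a)) (hFa a)
    have h5 : |c| ^ (p - 1) ≤ (|a| + |b|) ^ (p - 1) :=
      Real.rpow_le_rpow (abs_nonneg _) hc (by linarith)
    have h6 : 0 ≤ |c| ^ (p - 1) := by positivity
    have h7 := abs_nonneg c
    calc f c ≤ 1 * |c| + C * |c| ^ (p - 1) := h c
      _ ≤ (1 + C) * (|c| + |c| ^ (p - 1)) := by nlinarith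
      _ ≤ _ := by gcongr
  have hgm : ∀ m : ℝ, 0 ≤ m → m * (m + m ^ (p - 1)) = gauge2 p m := fun m hm => by
    have := abs_rpow_mul hp m
    rw [abs_of_nonneg hm] at this
    unfold gauge2
    rw [abs_of_nonneg hm, ← this]; ring
  refine ⟨(1 + C) * (1 + η⁻¹) ^ p + C', by positivity, fun a b => (hroot a b).trans ?_⟩
  have ha0 := abs_nonneg a
  have hb0 := abs_nonneg b
  have hga := gauge2_nonneg p a
  have hgb := gauge2_nonneg p b
  rcases le_or_gt (η * |b|) |a| with hcase | hcase
  · have hb : |b| ≤ η⁻¹ * |a| := by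
      rw [← div_eq_inv_mul, le_div_iff₀ hη]; linarith
    set m := |a| + |b|
    have hm0 : 0 ≤ m := by positivity
    have hm : m ≤ (1 + η⁻¹) * |a| := by simp only [m]; linarith
    have h1 : |a| * ((1 + C) * (m + m ^ (p - 1))) ≤ (1 + C) * gauge2 p m := by
      rw [← hgm m hm0]
      have : |a| * (m + m ^ (p - 1)) ≤ m * (m + m ^ (p - 1)) := by
        gcongr; simp only [m]; linarith
      nlinarith
    have h2 : gauge2 p m ≤ (1 + η⁻¹) ^ p * gauge2 p a := by
      refine le_trans (gauge2_mono hp ?_) (gauge2_mul_le hp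
        (by have := inv_pos.2 hη; linarith : 1 ≤ 1 + η⁻¹) a)
      rw [abs_of_nonneg hm0, abs_mul, abs_of_pos (by positivity : 0 < 1 + η⁻¹)]
      exact hm
    have h3 : (1 + C) * gauge2 p m ≤ (1 + C) * ((1 + η⁻¹) ^ p * gauge2 p a) := by gcongr
    nlinarith [mul_nonneg hδ.le hgb]
  · set m := |a| + |b|
    have hm0 : 0 ≤ m := by positivity
    have hm : m ≤ 2 * |b| := by
      have : η * |b| ≤ |b| := mul_le_of_le_one_left hb0 hη1
      simp only [m]; linarith
    have h1 : |b| * (m + m ^ (p - 1)) ≤ 2 ^ p * gauge2 p b := by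
      calc _ ≤ |b| * (2 * |b| + (2 * |b|) ^ (p - 1)) := by
            gcongr; linarith
        _ ≤ (2 * |b|) * (2 * |b| + (2 * |b|) ^ (p - 1)) := by gcongr; linarith
        _ = gauge2 p (2 * |b|) := hgm _ (by positivity)
        _ ≤ 2 ^ p * gauge2 p |b| := gauge2_mul_le hp one_le_two _
        _ = _ := by simp [gauge2]
    have h2 : |a| * ((1 + C) * (m + m ^ (p - 1))) ≤ δ * gauge2 p b := by
      calc _ ≤ (η * |b|) * ((1 + C) * (m + m ^ (p - 1))) := by gcongr
        _ = η * (1 + C) * (|b| * (m + m ^ (p - 1))) := by ring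
        _ ≤ η * (1 + C) * (2 ^ p * gauge2 p b) := by gcongr
        _ = (C2 * η) * gauge2 p b := by simp only [C2]; ring
        _ ≤ _ := by gcongr
    have h3 : 0 ≤ (1 + C) * (1 + η⁻¹) ^ p * gauge2 p a := by positivity
    nlinarith

end Nonlinearity

end Scalar

/-- The standing assumptions on the exponents and on the nonlinearity. -/
structure Setting (N : ℕ) (s α p : ℝ) (f : ℝ → ℝ) : Prop where
  s_pos : 0 < s
  alpha_pos : 0 < α
  alpha_lt : α < N
  two_s_lt : 2 * s < N
  p_lt : p < 2 * N / (N - 2 * s)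
  nl : Nonlinearity f p

/-! ### Integrability, rays and Nehari bounds in `H^s` -/

section HsSpace

variable {N : ℕ} {s : ℝ}

lemma MemHs.hasFracLap {u : L2 N} (h : MemHs s u) : HasFracLap (s / 2) u (fracLap (s / 2) u) := by
  obtain ⟨g, hg⟩ := h
  rwa [hg.fracLap_eq]

lemma HasFracLap.lin {β : ℝ} {u g v h : L2 N} (hu : HasFracLap β u g) (hv : HasFracLap β v h)
    (a b : ℝ) : HasFracLap β (a • u + b • v) (a • g + b • h) := (hu.smul a).add (hv.smul b)

lemma MemHs.lin {u v : L2 N} (hu : MemHs s u) (hv : MemHs s v) (a b : ℝ) :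
    MemHs s (a • u + b • v) := ⟨_, hu.hasFracLap.lin hv.hasFracLap a b⟩

lemma MemHs.smul {u : L2 N} (hu : MemHs s u) (a : ℝ) : MemHs s (a • u) :=
  ⟨_, hu.hasFracLap.smul a⟩

lemma fracLap_lin {u v : L2 N} (hu : MemHs s u) (hv : MemHs s v) (a b : ℝ) :
    fracLap (s / 2) (a • u + b • v) = a • fracLap (s / 2) u + b • fracLap (s / 2) v :=
  (hu.hasFracLap.lin hv.hasFracLap a b).fracLap_eq

lemma fracLap_smul {u : L2 N} (hu : MemHs s u) (a : ℝ) :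
    fracLap (s / 2) (a • u) = a • fracLap (s / 2) u := (hu.hasFracLap.smul a).fracLap_eq

lemma coeFn_lin (u v : L2 N) (a b : ℝ) :
    (a • u + b • v : L2 N) =ᵐ[volume] fun x => a * u x + b * v x := by
  filter_upwards [Lp.coeFn_add (a • u) (b • v), Lp.coeFn_smul a u, Lp.coeFn_smul b v]
    with x h1 h2 h3
  rw [h1, Pi.add_apply, h2, h3]; rfl

lemma coeFn_smul' (u : L2 N) (a : ℝ) : (a • u : L2 N) =ᵐ[volume] fun x => a * u x := by
  filter_upwards [Lp.coeFn_smul a u] with x h1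
  rw [h1]; rfl

lemma measurable_coe (u : L2 N) : Measurable u := (Lp.stronglyMeasurable u).measurable

variable {α p : ℝ} {f : ℝ → ℝ}

lemma Setting.exists_sobolev (S : Setting N s α p f) : ∃ C : ℝ, 0 < C ∧ ∀ u : L2 N, MemHs s u →
    Integrable (fun x => |u x| ^ (2 * N / (N - 2 * s) : ℝ)) ∧
    ∫ x, |u x| ^ (2 * N / (N - 2 * s) : ℝ) ≤
      C * ‖fracLap (s / 2) u‖ ^ (2 * N / (N - 2 * s) : ℝ) := by
  obtain ⟨C, hC, h⟩ := exists_sobolev_integral S.s_pos S.two_s_lt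
  exact ⟨C, hC, fun u hu => h u _ hu.hasFracLap⟩

lemma Setting.integrable_rpow (S : Setting N s α p f) {u : L2 N} (hu : MemHs s u) :
    Integrable (fun x => |u x| ^ (2 * N / (N - 2 * s) : ℝ)) := by
  obtain ⟨C, hC, h⟩ := S.exists_sobolev
  exact (h u hu).1

lemma Setting.integrable_gauge (S : Setting N s α p f) {u : L2 N} (hu : MemHs s u) :
    Integrable (fun x => gauge2 p (u x)) := by
  refine (integrable_sq u).add ?_
  have hp := S.nl.four_lt
  have := S.p_lt
  refine Integrable.mono' ((integrable_sq u).add (S.integrable_rpow hu))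
    ((measurable_coe u).abs.pow_const p).aestronglyMeasurable (ae_of_all _ fun x => ?_)
  rw [Real.norm_of_nonneg (by positivity)]
  have := rpow_le_add_rpow (a := 2) (b := p) (c := 2 * N / (N - 2 * s)) two_pos (by linarith)
    this.le (abs_nonneg (u x))
  rw [Real.rpow_two, sq_abs] at this
  exact this

lemma Setting.integrable_mul (S : Setting N s α p f) {u v : L2 N} (hu : MemHs s u)
    (hv : MemHs s v) : Integrable fun x => f (u x) * v x := by
  obtain ⟨C, hC, h⟩ := S.nl.exists_gauge_bound
  refine Integrable.mono' (((S.integrable_gauge hu).add (S.integrable_gauge hv)).const_mul C)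
    ((S.nl.cont.measurable.comp (measurable_coe u)).mul (measurable_coe v)).aestronglyMeasurable
    (ae_of_all _ fun x => ?_)
  rw [norm_mul, Real.norm_of_nonneg (S.nl.nonneg _), Real.norm_eq_abs]
  exact h _ _

lemma Setting.integrable_primitive (S : Setting N s α p f) {u : L2 N} (hu : MemHs s u) :
    Integrable fun x => primitive f (u x) := by
  refine Integrable.mono' (S.integrable_mul hu hu)
    (S.nl.continuous_primitive.measurable.comp (measurable_coe u)).aestronglyMeasurable
    (ae_of_all _ fun x => ?_)
  rw [Real.norm_of_nonneg (S.nl.primitive_nonneg _)]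
  have := S.nl.four_primitive_le (u x)
  have := S.nl.primitive_nonneg (u x)
  linarith

lemma integral_comp_smul_congr (h : ℝ → ℝ) (u : L2 N) (a : ℝ) :
    ∫ x, h ((a • u : L2 N) x) = ∫ x, h (a * u x) := by
  apply integral_congr_ae
  filter_upwards [coeFn_smul' u a] with x hx
  rw [hx]

lemma Setting.integrable_primitive_smul (S : Setting N s α p f) {u : L2 N} (hu : MemHs s u)
    (a : ℝ) : Integrable fun x => primitive f (a * u x) := by
  refine (S.integrable_primitive (hu.smul a)).congr ?_
  filter_upwards [coeFn_smul' u a] with x hx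
  rw [hx]

lemma Setting.integrable_mul_smul (S : Setting N s α p f) {u : L2 N} (hu : MemHs s u) (a : ℝ) :
    Integrable fun x => f (a * u x) * (a * u x) := by
  refine (S.integrable_mul (hu.smul a) (hu.smul a)).congr ?_
  filter_upwards [coeFn_smul' u a] with x hx
  rw [hx]

lemma Setting.integrable_mul_self (S : Setting N s α p f) {u : L2 N} (hu : MemHs s u) :
    Integrable fun x => f (u x) * u x := S.integrable_mul hu hu

/-! ### Fibering maps -/

/-- The energy along the ray through `u`. -/
def fiber (f : ℝ → ℝ) (Q D : ℝ) (u : L2 N) (t : ℝ) : ℝ :=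
  1 / 2 * (t ^ 2 * Q) + 1 / 4 * (t ^ 4 * D) - ∫ x, primitive f (t * u x)

/-- Inserting the Nehari identity into `fiber_ineq` cancels `D` and leaves `fiber(1) - fiber(t) ≥ (1
- t²)² Q/4`. -/
lemma Setting.fiber_le (S : Setting N s α p f) {u : L2 N} (hu : MemHs s u) {Q D : ℝ} (hQ : 0 ≤ Q)
    (h : Q + D = ∫ x, f (u x) * u x) {t : ℝ} (ht : 0 ≤ t) : fiber f Q D u t ≤ fiber f Q D u 1 := by
  have h1 : (t ^ 4 - 1) / 4 * ∫ x, f (u x) * u x ≤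
      (∫ x, primitive f (t * u x)) - ∫ x, primitive f (1 * u x) := by
    rw [← integral_sub (S.integrable_primitive_smul hu t) (S.integrable_primitive_smul hu 1),
      ← integral_const_mul]
    refine integral_mono ((S.integrable_mul_self hu).const_mul _)
      ((S.integrable_primitive_smul hu t).sub (S.integrable_primitive_smul hu 1)) fun x => ?_
    have := S.nl.fiber_ineq ht (u x)
    simpa using this
  rw [← h] at h1
  unfold fiber
  nlinarith [sq_nonneg (1 - t ^ 2), mul_nonneg hQ (sq_nonneg (1 - t ^ 2))]

/-- Subtracting a quarter of the radial derivative removes the Poisson term, and `4F(y) ≤ f(y)y`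
disposes of the nonlinearity. It yields coercivity on the Nehari set, and also that negative energy
implies a negative radial derivative. -/
lemma Setting.quarter_le_fiber (S : Setting N s α p f) {u : L2 N} (hu : MemHs s u) (Q D t : ℝ) :
    1 / 4 * (t ^ 2 * Q + t ^ 4 * D - ∫ x, f (t * u x) * (t * u x)) + 1 / 4 * (t ^ 2 * Q) ≤
      fiber f Q D u t := by
  have h1 : 4 * ∫ x, primitive f (t * u x) ≤ ∫ x, f (t * u x) * (t * u x) := by
    rw [← integral_const_mul]
    exact integral_mono ((S.integrable_primitive_smul hu t).const_mul 4)
      (S.integrable_mul_smul hu t) fun x => S.nl.four_primitive_le _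
  unfold fiber
  linarith

lemma Setting.scale_integral_le (S : Setting N s α p f) {u : L2 N} (hu : MemHs s u) {t : ℝ}
    (ht0 : 0 ≤ t) (ht : t ≤ 1) :
    ∫ x, f (t * u x) * (t * u x) ≤ t ^ 4 * ∫ x, f (u x) * u x := by
  rw [← integral_const_mul]
  exact integral_mono (S.integrable_mul_smul hu t) ((S.integrable_mul_self hu).const_mul _)
    fun x => S.nl.scale_le ht0 ht _

lemma Setting.scale_integral_ge (S : Setting N s α p f) {u : L2 N} (hu : MemHs s u) {t : ℝ}
    (ht : 1 ≤ t) :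
    t ^ 4 * ∫ x, f (u x) * u x ≤ ∫ x, f (t * u x) * (t * u x) := by
  rw [← integral_const_mul]
  exact integral_mono ((S.integrable_mul_self hu).const_mul _) (S.integrable_mul_smul hu t)
    fun x => S.nl.scale_ge ht _

/-- The energy is nonnegative on the ray up to the Nehari point. -/
lemma Setting.fiber_nonneg (S : Setting N s α p f) {u : L2 N} (hu : MemHs s u) {Q D : ℝ}
    (hQ : 0 ≤ Q) {t₀ : ℝ} (ht₀ : 0 < t₀)
    (h : t₀ ^ 2 * Q + t₀ ^ 4 * D = ∫ x, f (t₀ * u x) * (t₀ * u x)) {t : ℝ} (ht : 0 ≤ t)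
    (htt : t ≤ t₀) : 0 ≤ fiber f Q D u t := by
  refine le_trans ?_ (S.quarter_le_fiber hu Q D t)
  -- Everything is measured relative to `t₀` with ratio `l = t/t₀ ≤ 1`: the nonlinear term scales at
  -- most like `l⁴` and the quadratic one like `l²`, so the radial derivative is nonnegative before
  -- `t₀`.
  have h1 := S.scale_integral_le (hu.smul t₀) (t := t / t₀) (by positivity)
    ((div_le_one ht₀).2 htt)
  have e1 : ∫ x, f (t / t₀ * (t₀ • u : L2 N) x) * (t / t₀ * (t₀ • u : L2 N) x) =
      ∫ x, f (t * u x) * (t * u x) := by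
    apply integral_congr_ae
    filter_upwards [coeFn_smul' u t₀] with x hx
    rw [hx, ← mul_assoc (t / t₀) t₀ (u x), div_mul_cancel₀ _ ht₀.ne']
  have e2 : ∫ x, f ((t₀ • u : L2 N) x) * (t₀ • u : L2 N) x =
      ∫ x, f (t₀ * u x) * (t₀ * u x) := integral_comp_smul_congr (fun y => f y * y) u t₀
  rw [e1, e2, ← h] at h1
  set l := t / t₀
  have hl0 : 0 ≤ l := by positivity
  have hl1 : l ≤ 1 := (div_le_one ht₀).2 htt
  have hl : t = l * t₀ := (div_mul_cancel₀ _ ht₀.ne').symm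
  have h3 : 0 ≤ t ^ 2 * Q - l ^ 4 * (t₀ ^ 2 * Q) := by
    have : t ^ 2 * Q - l ^ 4 * (t₀ ^ 2 * Q) = (1 - l ^ 2) * (t ^ 2 * Q) := by rw [hl]; ring
    rw [this]
    have : l ^ 2 ≤ 1 := pow_le_one₀ hl0 hl1
    exact mul_nonneg (by linarith) (by positivity)
  have h4 : l ^ 4 * (t₀ ^ 4 * D) = t ^ 4 * D := by rw [hl]; ring
  have h5 : 0 ≤ t ^ 2 * Q := by positivity
  nlinarith

/-- On `[0,T]` the value at `t = T` dominates, because `y ↦ f(y)y` is nondecreasing. -/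
lemma Setting.continuousOn_integral_smul (S : Setting N s α p f) {u : L2 N} (hu : MemHs s u)
    {T : ℝ} : ContinuousOn (fun t => ∫ x, f (t * u x) * (t * u x)) (Icc 0 T) := by
  apply continuousOn_of_dominated (bound := fun x => f (T * u x) * (T * u x))
  · intro t _
    exact (S.integrable_mul_smul hu t).aestronglyMeasurable
  · intro t ht
    refine ae_of_all _ fun x => ?_
    rw [Real.norm_of_nonneg (S.nl.mul_self_nonneg _)]
    rcases le_total 0 (u x) with h | h
    · exact S.nl.mul_self_mono (mul_le_mul_of_nonneg_right ht.2 h)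
    · rw [S.nl.eq_zero _ (mul_nonpos_of_nonneg_of_nonpos ht.1 h), zero_mul]
      exact S.nl.mul_self_nonneg _
  · exact S.integrable_mul_smul hu T
  · refine ae_of_all _ fun x => Continuous.continuousOn ?_
    have := S.nl.cont
    fun_prop

/-- Intermediate value theorem for the radial derivative. At `l T` with `l` small the nonlinear term
is at most `l⁴A`, which loses against `l²T²Q`; at `T` the sign is negative. -/
lemma Setting.exists_nehari_point (S : Setting N s α p f) {u : L2 N} (hu : MemHs s u) {Q D T : ℝ}
    (hQ : 0 < Q) (hD : 0 ≤ D) (hT : 0 < T)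
    (h : T ^ 2 * Q + T ^ 4 * D - ∫ x, f (T * u x) * (T * u x) < 0) :
    ∃ t, 0 < t ∧ t < T ∧ t ^ 2 * Q + t ^ 4 * D = ∫ x, f (t * u x) * (t * u x) := by
  set A := ∫ x, f (T * u x) * (T * u x)
  have hA : 0 < A := by nlinarith [mul_pos (pow_pos hT 2) hQ, mul_nonneg (pow_pos hT 4).le hD]
  obtain ⟨l, hl0, hl1, hl⟩ : ∃ l : ℝ, 0 < l ∧ l < 1 ∧ l ^ 2 * A < T ^ 2 * Q := by
    have : Tendsto (fun l : ℝ => l ^ 2 * A) (𝓝[>] 0) (𝓝 0) := by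
      have h1 : Continuous fun l : ℝ => l ^ 2 * A := by fun_prop
      have := (h1.tendsto 0).mono_left (nhdsWithin_le_nhds (s := Ioi 0))
      simpa using this
    have h2 := this.eventually (gt_mem_nhds (by positivity : 0 < T ^ 2 * Q))
    obtain ⟨l, h3, h4⟩ := (h2.and (Ioo_mem_nhdsGT (zero_lt_one (α := ℝ)))).exists
    exact ⟨l, h4.1, h4.2, h3⟩
  have h1 : 0 < (l * T) ^ 2 * Q + (l * T) ^ 4 * D -
      ∫ x, f (l * T * u x) * (l * T * u x) := by
    have h1 := S.scale_integral_le (hu.smul T) (t := l) hl0.le hl1.le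
    have e1 : ∫ x, f (l * (T • u : L2 N) x) * (l * (T • u : L2 N) x) =
        ∫ x, f (l * T * u x) * (l * T * u x) := by
      apply integral_congr_ae
      filter_upwards [coeFn_smul' u T] with x hx
      rw [hx, ← mul_assoc l T (u x)]
    have e2 : ∫ x, f ((T • u : L2 N) x) * (T • u : L2 N) x = A :=
      integral_comp_smul_congr (fun y => f y * y) u T
    rw [e1, e2] at h1
    have : 0 ≤ (l * T) ^ 4 * D := by positivity
    have h5 : l ^ 2 * (l ^ 2 * A) < l ^ 2 * (T ^ 2 * Q) := by gcongr
    nlinarith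
  have hc : ContinuousOn (fun t => t ^ 2 * Q + t ^ 4 * D - ∫ x, f (t * u x) * (t * u x))
      (Icc (l * T) T) := by
    refine ContinuousOn.sub (by fun_prop) ((S.continuousOn_integral_smul hu).mono
      (Icc_subset_Icc_left (by positivity)))
  have hlT : l * T < T := by nlinarith
  obtain ⟨t, ht, e⟩ := intermediate_value_Ioo' hlT.le hc ⟨h, h1⟩
  exact ⟨t, lt_trans (by positivity) ht.1, ht.2, by linarith⟩

/-- The nonlinear part grows at least like `T^K` with `K > 4` and overtakes both the quadratic and
the quartic term. -/
lemma Setting.exists_fiber_neg (S : Setting N s α p f) {u : L2 N} (hu : MemHs s u) (Q D : ℝ)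
    (h : 0 < ∫ x, primitive f (u x)) : ∃ T, 0 < T ∧ fiber f Q D u T < 0 := by
  obtain ⟨K, hK, hKs⟩ := S.nl.primitive_scale
  set A := ∫ x, primitive f (u x)
  have hlim : Tendsto (fun T : ℝ => T ^ (K - 4) * A) atTop atTop :=
    (tendsto_rpow_atTop (by linarith)).atTop_mul_const h
  obtain ⟨T, h1, h2⟩ := ((hlim.eventually_gt_atTop (|Q| + |D|)).and
    (eventually_ge_atTop 1)).exists
  refine ⟨T, by linarith, ?_⟩
  have h3 : T ^ K * A ≤ ∫ x, primitive f (T * u x) := by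
    rw [← integral_const_mul]
    exact integral_mono ((S.integrable_primitive hu).const_mul _)
      (S.integrable_primitive_smul hu T) fun x => hKs T h2 _
  have h4 : T ^ K = T ^ (K - 4) * T ^ 4 := by
    rw [← Real.rpow_natCast, ← Real.rpow_add (by linarith)]; congr 1; push_cast; ring
  have hT4 : 0 < T ^ 4 := by positivity
  have h5 : T ^ 2 ≤ T ^ 4 := pow_le_pow_right₀ h2 (by norm_num)
  have h6 : T ^ 2 * Q ≤ T ^ 4 * |Q| := by
    calc T ^ 2 * Q ≤ T ^ 2 * |Q| := by gcongr; exact le_abs_self Q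
      _ ≤ _ := by gcongr
  have h7 : T ^ 4 * D ≤ T ^ 4 * |D| := by gcongr; exact le_abs_self D
  have h8 : T ^ 4 * (|Q| + |D|) < T ^ 4 * (T ^ (K - 4) * A) := by gcongr
  have h9 : 0 ≤ T ^ 4 * |Q| := by positivity
  have h10 : 0 ≤ T ^ 4 * |D| := by positivity
  rw [h4] at h3
  unfold fiber
  nlinarith

lemma Setting.integral_primitive_pos (S : Setting N s α p f) {u : L2 N} (hu : MemHs s u)
    (h : ¬ ∀ᵐ x, u x ≤ 0) : 0 < ∫ x, primitive f (u x) := by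
  refine lt_of_le_of_ne (integral_nonneg fun x => S.nl.primitive_nonneg _) fun h0 => h ?_
  have := (integral_eq_zero_iff_of_nonneg (fun x => S.nl.primitive_nonneg _)
    (S.integrable_primitive hu)).1 h0.symm
  filter_upwards [this] with x hx
  by_contra hc
  push Not at hc
  exact (S.nl.primitive_pos hc).ne' hx

lemma Setting.not_nonpos_of_integral_pos (S : Setting N s α p f) {u : L2 N}
    (h : 0 < ∫ x, f (u x) * u x) : ¬ ∀ᵐ x, u x ≤ 0 := fun hn => by
  have : ∫ x, f (u x) * u x = 0 := by
    apply integral_eq_zero_of_ae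
    filter_upwards [hn] with x hx
    simp [S.nl.eq_zero _ hx]
  linarith

/-! ### Lower bounds on the Nehari manifold -/

/-- The quadratic form of the problem with constant potential `μ`. -/
def quad (s μ : ℝ) (u : L2 N) : ℝ := ‖fracLap (s / 2) u‖ ^ 2 + μ * ‖u‖ ^ 2

lemma quad_nonneg {μ : ℝ} (hμ : 0 ≤ μ) (u : L2 N) : 0 ≤ quad s μ u := by
  unfold quad; positivity

lemma quad_pos {μ : ℝ} (hμ : 0 < μ) {u : L2 N} (hu : u ≠ 0) : 0 < quad s μ u := by
  have : 0 < ‖u‖ := norm_pos_iff.2 hu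
  unfold quad; positivity

lemma quad_smul {μ : ℝ} {u : L2 N} (hu : MemHs s u) (t : ℝ) :
    quad s μ (t • u) = t ^ 2 * quad s μ u := by
  unfold quad
  rw [fracLap_smul hu, norm_smul, norm_smul, mul_pow, mul_pow, Real.norm_eq_abs, sq_abs]
  ring

lemma Setting.two_lt (S : Setting N s α p f) : (4 : ℝ) < 2 * N / (N - 2 * s) :=
  S.nl.four_lt.trans S.p_lt

/-- Here the small coefficient is on the `L²` norm, to be absorbed by the potential; the critical
Sobolev power carries the large constant. -/
lemma Setting.exists_mul_le_low (S : Setting N s α p f) {δ : ℝ} (hδ : 0 < δ) :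
    ∃ C : ℝ, 0 < C ∧ ∀ u : L2 N, MemHs s u →
      ∫ x, f (u x) * u x ≤ δ * ‖u‖ ^ 2 +
        C * ‖fracLap (s / 2) u‖ ^ (2 * N / (N - 2 * s) : ℝ) := by
  obtain ⟨C₁, hC₁, h₁⟩ := S.nl.exists_bound_mul (half_pos hδ)
  obtain ⟨C₂, hC₂, h₂⟩ := exists_rpow_le_low (a := 2) (b := p) (c := 2 * N / (N - 2 * s)) two_pos
    (by linarith [S.nl.four_lt]) S.p_lt (δ := δ / 2 / C₁) (by positivity)
  obtain ⟨C₃, hC₃, h₃⟩ := S.exists_sobolev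
  refine ⟨C₁ * C₂ * C₃, by positivity, fun u hu => ?_⟩
  obtain ⟨hi, hle⟩ := h₃ u hu
  calc ∫ x, f (u x) * u x
      ≤ ∫ x, (δ * (u x) ^ 2 + C₁ * C₂ * |u x| ^ (2 * N / (N - 2 * s) : ℝ)) := by
        refine integral_mono (S.integrable_mul_self hu)
          (((integrable_sq u).const_mul _).add (hi.const_mul _)) fun x => ?_
        have h4 := h₂ |u x| (abs_nonneg _)
        rw [Real.rpow_two, sq_abs] at h4
        calc _ ≤ _ := h₁ (u x)
          _ ≤ δ / 2 * u x ^ 2 + C₁ * (δ / 2 / C₁ * u x ^ 2 +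
              C₂ * |u x| ^ (2 * N / (N - 2 * s) : ℝ)) := by gcongr
          _ = _ := by field_simp; ring
    _ = δ * ‖u‖ ^ 2 + C₁ * C₂ * ∫ x, |u x| ^ (2 * N / (N - 2 * s) : ℝ) := by
        rw [integral_add ((integrable_sq u).const_mul _) (hi.const_mul _), integral_const_mul,
          integral_const_mul, norm_sq_eq_integral_real]
    _ ≤ _ := by
        have : C₁ * C₂ * ∫ x, |u x| ^ (2 * N / (N - 2 * s) : ℝ) ≤
          C₁ * C₂ * (C₃ * ‖fracLap (s / 2) u‖ ^ (2 * N / (N - 2 * s) : ℝ)) := by gcongr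
        linarith

/-- Here the small coefficient is on the critical Sobolev power, so that on bounded sets the
gradient term absorbs it and an estimate of the `L²` norm remains. -/
lemma Setting.exists_mul_le_high (S : Setting N s α p f) {κ δ : ℝ} (hκ : 0 < κ) (hδ : 0 < δ) :
    ∃ C : ℝ, 0 < C ∧ ∀ u : L2 N, MemHs s u →
      ∫ x, f (u x) * u x ≤ κ * ‖u‖ ^ 2 + (C * ‖u‖ ^ 2 +
        δ * ‖fracLap (s / 2) u‖ ^ (2 * N / (N - 2 * s) : ℝ)) := by
  obtain ⟨C₁, hC₁, h₁⟩ := S.nl.exists_bound_mul hκ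
  obtain ⟨C₃, hC₃, h₃⟩ := S.exists_sobolev
  obtain ⟨C₂, hC₂, h₂⟩ := exists_rpow_le_high (a := 2) (b := p) (c := 2 * N / (N - 2 * s)) two_pos
    (by linarith [S.nl.four_lt]) S.p_lt (δ := δ / C₃ / C₁) (by positivity)
  refine ⟨C₁ * C₂, by positivity, fun u hu => ?_⟩
  obtain ⟨hi, hle⟩ := h₃ u hu
  calc ∫ x, f (u x) * u x
      ≤ ∫ x, ((κ + C₁ * C₂) * (u x) ^ 2 + δ / C₃ * |u x| ^ (2 * N / (N - 2 * s) : ℝ)) := by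
        refine integral_mono (S.integrable_mul_self hu)
          (((integrable_sq u).const_mul _).add (hi.const_mul _)) fun x => ?_
        have h4 := h₂ |u x| (abs_nonneg _)
        rw [Real.rpow_two, sq_abs] at h4
        calc _ ≤ _ := h₁ (u x)
          _ ≤ κ * u x ^ 2 + C₁ * (δ / C₃ / C₁ * |u x| ^ (2 * N / (N - 2 * s) : ℝ) +
              C₂ * u x ^ 2) := by gcongr
          _ = _ := by field_simp; ring
    _ = (κ + C₁ * C₂) * ‖u‖ ^ 2 + δ / C₃ * ∫ x, |u x| ^ (2 * N / (N - 2 * s) : ℝ) := by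
        rw [integral_add ((integrable_sq u).const_mul _) (hi.const_mul _), integral_const_mul,
          integral_const_mul, norm_sq_eq_integral_real]
    _ ≤ (κ + C₁ * C₂) * ‖u‖ ^ 2 + δ / C₃ *
        (C₃ * ‖fracLap (s / 2) u‖ ^ (2 * N / (N - 2 * s) : ℝ)) := by gcongr
    _ = _ := by field_simp; ring

lemma rpow_le_sq_mul {r x M : ℝ} (hr : 4 < r) (hx : 0 ≤ x) (hxM : x ^ 2 ≤ M) :
    x ^ r ≤ M ^ (r / 2 - 1) * x ^ 2 := by
  have h1 : x ^ r = (x ^ 2) ^ (r / 2 - 1) * x ^ 2 := by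
    rcases hx.eq_or_lt with rfl | h
    · rw [Real.zero_rpow (by linarith)]; simp
    · rw [← Real.rpow_natCast x 2, ← Real.rpow_mul hx, ← Real.rpow_add h]
      congr 1; push_cast; ring
  rw [h1]
  gcongr
  linarith

/-- The Nehari manifold is bounded away from zero. -/
lemma Setting.exists_quad_lower (S : Setting N s α p f) {μ : ℝ} (hμ : 0 < μ) :
    ∃ ρ : ℝ, 0 < ρ ∧ ∀ u : L2 N, MemHs s u → u ≠ 0 → quad s μ u ≤ ∫ x, f (u x) * u x →
      ρ ≤ quad s μ u := by
  obtain ⟨C, hC, h⟩ := S.exists_mul_le_low (half_pos hμ)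
  set r : ℝ := 2 * N / (N - 2 * s)
  have hr : 4 < r := S.two_lt
  have hr1 : 0 < r / 2 - 1 := by linarith
  -- Absorbing the `L²` term leaves `q/2 ≤ C q^(r/2)` for `q = quad s μ u > 0`; this is the
  -- resulting lower bound on `q`.
  refine ⟨(1 / (2 * C)) ^ (1 / (r / 2 - 1)), by positivity, fun u hu hu0 hle => ?_⟩
  have hq := quad_pos (s := s) hμ hu0
  set q := quad s μ u with hqdef
  have h1 : ‖fracLap (s / 2) u‖ ^ 2 ≤ q := by
    rw [hqdef, quad]; nlinarith [mul_nonneg hμ.le (sq_nonneg ‖u‖)]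
  have h2 := rpow_le_sq_mul hr (norm_nonneg (fracLap (s / 2) u)) h1
  have h3 := h u hu
  have h4 : μ / 2 * ‖u‖ ^ 2 ≤ q / 2 := by
    rw [hqdef, quad]; nlinarith [sq_nonneg ‖fracLap (s / 2) u‖]
  have h5 : q / 2 ≤ C * (q ^ (r / 2 - 1) * q) := by
    have h6 : q ^ (r / 2 - 1) * ‖fracLap (s / 2) u‖ ^ 2 ≤ q ^ (r / 2 - 1) * q := by gcongr
    have h7 : C * ‖fracLap (s / 2) u‖ ^ r ≤ C * (q ^ (r / 2 - 1) * q) := by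
      gcongr; exact h2.trans h6
    linarith
  have h8 : 1 / (2 * C) ≤ q ^ (r / 2 - 1) := by
    rw [div_le_iff₀ (by positivity)]
    have : q * 1 ≤ q * (q ^ (r / 2 - 1) * (2 * C)) := by nlinarith
    exact le_of_mul_le_mul_left this hq
  calc _ ≤ (q ^ (r / 2 - 1)) ^ (1 / (r / 2 - 1)) := by gcongr
    _ = q := by rw [← Real.rpow_mul hq.le, mul_one_div_cancel hr1.ne', Real.rpow_one]

/-- On bounded parts of the Nehari manifold the `L²` norm is bounded away from zero. -/
lemma Setting.exists_norm_lower (S : Setting N s α p f) {μ : ℝ} (hμ : 0 < μ) {M : ℝ}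
    (hM : 0 < M) :
    ∃ c : ℝ, 0 < c ∧ ∀ u : L2 N, MemHs s u → u ≠ 0 → quad s μ u ≤ ∫ x, f (u x) * u x →
      quad s μ u ≤ M → c ≤ ‖u‖ ^ 2 := by
  obtain ⟨ρ, hρ, hlow⟩ := S.exists_quad_lower hμ
  set r : ℝ := 2 * N / (N - 2 * s)
  have hr : 4 < r := S.two_lt
  have hMr : 0 < M ^ (r / 2 - 1) := by positivity
  -- With this `δ` the critical term is at most a quarter of `quad`, and the `μ/2` term at most
  -- half, so the remaining quarter is bounded by `C‖u‖²`.
  obtain ⟨C, hC, h⟩ := S.exists_mul_le_high (half_pos hμ) (δ := 1 / 4 / M ^ (r / 2 - 1))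
    (by positivity)
  refine ⟨ρ / (4 * C), by positivity, fun u hu hu0 hle hqM => ?_⟩
  have h0 := hlow u hu hu0 hle
  have h1 : ‖fracLap (s / 2) u‖ ^ 2 ≤ quad s μ u := by
    rw [quad]; nlinarith [mul_nonneg hμ.le (sq_nonneg ‖u‖)]
  have h2 := rpow_le_sq_mul hr (norm_nonneg (fracLap (s / 2) u)) (h1.trans hqM)
  have h3 := h u hu
  have h4 : μ / 2 * ‖u‖ ^ 2 ≤ quad s μ u / 2 := by
    rw [quad]; nlinarith [sq_nonneg ‖fracLap (s / 2) u‖]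
  have h5 : 1 / 4 / M ^ (r / 2 - 1) * ‖fracLap (s / 2) u‖ ^ r ≤ quad s μ u / 4 := by
    calc _ ≤ 1 / 4 / M ^ (r / 2 - 1) * (M ^ (r / 2 - 1) * ‖fracLap (s / 2) u‖ ^ 2) := by gcongr
      _ = ‖fracLap (s / 2) u‖ ^ 2 / 4 := by field_simp
      _ ≤ _ := by linarith
  rw [div_le_iff₀ (by positivity)]
  linarith

/-- The energy levels of the problems with constant potential `μ` tend to infinity with `μ`. -/
lemma Setting.exists_level_large (S : Setting N s α p f) {M : ℝ} (hM : 0 < M) :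
    ∃ μ : ℝ, 0 < μ ∧ ∀ u : L2 N, MemHs s u → u ≠ 0 → quad s μ u ≤ ∫ x, f (u x) * u x →
      M ≤ quad s μ u := by
  set r : ℝ := 2 * N / (N - 2 * s)
  have hr : 4 < r := S.two_lt
  have hMr : 0 < M ^ (r / 2 - 1) := by positivity
  obtain ⟨C, hC, h⟩ := S.exists_mul_le_high one_pos (δ := 1 / 2 / M ^ (r / 2 - 1)) (by positivity)
  -- The nonlinear term costs `(1 + C)‖u‖²` and half the gradient as long as `quad < M`; the choice
  -- `μ = 2 + C` leaves a surplus `‖u‖² > 0`, contradicting the Nehari inequality.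
  refine ⟨2 + C, by positivity, fun u hu hu0 hle => ?_⟩
  by_contra hq
  push Not at hq
  have h1 : ‖fracLap (s / 2) u‖ ^ 2 ≤ quad s (2 + C) u := by
    rw [quad]; nlinarith [mul_nonneg (by positivity : 0 ≤ 2 + C) (sq_nonneg ‖u‖)]
  have h2 := rpow_le_sq_mul hr (norm_nonneg (fracLap (s / 2) u)) (h1.trans hq.le)
  have h3 := h u hu
  have h5 : 1 / 2 / M ^ (r / 2 - 1) * ‖fracLap (s / 2) u‖ ^ r ≤ ‖fracLap (s / 2) u‖ ^ 2 / 2 := by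
    calc _ ≤ 1 / 2 / M ^ (r / 2 - 1) * (M ^ (r / 2 - 1) * ‖fracLap (s / 2) u‖ ^ 2) := by gcongr
      _ = _ := by field_simp
  have h6 : 0 < ‖u‖ := norm_pos_iff.2 hu0
  have h7 : 0 < ‖u‖ ^ 2 := by positivity
  rw [quad] at hle
  nlinarith [sq_nonneg ‖fracLap (s / 2) u‖]

end HsSpace

/-! ### The space `W_ε` -/

section WSpace

variable {N : ℕ} {s ε V₀ : ℝ} {V : E N → ℝ}

lemma innerW_eq (u v : L2 N) : innerW s V ε u v =
    inner ℝ (fracLap (s / 2) u) (fracLap (s / 2) v) + ∫ x, V (ε • x) * u x * v x := by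
  rw [innerW, inner_eq_integral]

lemma innerW_comm (u v : L2 N) : innerW s V ε u v = innerW s V ε v u := by
  rw [innerW_eq, innerW_eq, real_inner_comm]
  congr 2; ext x; ring

lemma measurable_potential (hV : Continuous V) : Measurable fun x => V (ε • x) :=
  (hV.comp (continuous_const_smul ε)).measurable

lemma MemW.integrable_mul (hV : Continuous V) (hV₀ : ∀ x, V₀ ≤ V x) (hpos : 0 < V₀) {u v : L2 N}
    (hu : MemW s V ε u) (hv : MemW s V ε v) : Integrable fun x => V (ε • x) * u x * v x := by
  refine Integrable.mono' (hu.2.add hv.2) (((measurable_potential hV).mul (measurable_coe u)).mul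
    (measurable_coe v)).aestronglyMeasurable (ae_of_all _ fun x => ?_)
  have h := hpos.trans_le (hV₀ (ε • x))
  rw [Real.norm_eq_abs, abs_le]
  constructor <;> simp only [Pi.add_apply] <;>
    nlinarith [mul_nonneg h.le (sq_nonneg (u x + v x)), mul_nonneg h.le (sq_nonneg (u x - v x)),
      mul_nonneg h.le (sq_nonneg (u x)), mul_nonneg h.le (sq_nonneg (v x))]

lemma MemW.lin (hV : Continuous V) (hV₀ : ∀ x, V₀ ≤ V x) (hpos : 0 < V₀) {u v : L2 N}
    (hu : MemW s V ε u) (hv : MemW s V ε v) (a b : ℝ) : MemW s V ε (a • u + b • v) := by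
  refine ⟨hu.1.lin hv.1 a b, ?_⟩
  have h1 : Integrable fun x => a ^ 2 * (V (ε • x) * (u x) ^ 2) +
      2 * a * b * (V (ε • x) * u x * v x) + b ^ 2 * (V (ε • x) * (v x) ^ 2) :=
    ((hu.2.const_mul _).add ((hu.integrable_mul hV hV₀ hpos hv).const_mul _)).add
      (hv.2.const_mul _)
  refine h1.congr ?_
  filter_upwards [coeFn_lin u v a b] with x hx
  rw [hx]; ring

lemma MemW.smul {u : L2 N} (hu : MemW s V ε u) (a : ℝ) : MemW s V ε (a • u) := by
  refine ⟨hu.1.smul a, (hu.2.const_mul (a ^ 2)).congr ?_⟩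
  filter_upwards [coeFn_smul' u a] with x hx
  rw [hx]; ring

lemma innerW_lin_left (hV : Continuous V) (hV₀ : ∀ x, V₀ ≤ V x) (hpos : 0 < V₀) {u v w : L2 N}
    (hu : MemW s V ε u) (hv : MemW s V ε v) (hw : MemW s V ε w) (a b : ℝ) :
    innerW s V ε (a • u + b • v) w = a * innerW s V ε u w + b * innerW s V ε v w := by
  have h1 : ∫ x, V (ε • x) * (a • u + b • v : L2 N) x * w x =
      a * (∫ x, V (ε • x) * u x * w x) + b * ∫ x, V (ε • x) * v x * w x := by
    rw [← integral_const_mul, ← integral_const_mul,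
      ← integral_add ((hu.integrable_mul hV hV₀ hpos hw).const_mul _)
        ((hv.integrable_mul hV hV₀ hpos hw).const_mul _)]
    apply integral_congr_ae
    filter_upwards [coeFn_lin u v a b] with x hx
    rw [hx]; ring
  rw [innerW_eq, innerW_eq, innerW_eq, h1, fracLap_lin hu.1 hv.1, inner_add_left,
    real_inner_smul_left, real_inner_smul_left]
  ring

lemma innerW_lin_lin (hV : Continuous V) (hV₀ : ∀ x, V₀ ≤ V x) (hpos : 0 < V₀) {u v : L2 N}
    (hu : MemW s V ε u) (hv : MemW s V ε v) (a b : ℝ) :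
    innerW s V ε (a • u + b • v) (a • u + b • v) =
      a ^ 2 * innerW s V ε u u + 2 * a * b * innerW s V ε u v + b ^ 2 * innerW s V ε v v := by
  have hw := hu.lin hV hV₀ hpos hv a b
  rw [innerW_lin_left hV hV₀ hpos hu hv hw, innerW_comm u, innerW_comm v,
    innerW_lin_left hV hV₀ hpos hu hv hu, innerW_lin_left hV hV₀ hpos hu hv hv, innerW_comm v u]
  ring

lemma innerW_smul_smul {u : L2 N} (hu : MemHs s u) (a : ℝ) :
    innerW s V ε (a • u) (a • u) = a ^ 2 * innerW s V ε u u := by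
  have h1 : ∫ x, V (ε • x) * (a • u : L2 N) x * (a • u : L2 N) x =
      a ^ 2 * ∫ x, V (ε • x) * u x * u x := by
    rw [← integral_const_mul]
    apply integral_congr_ae
    filter_upwards [coeFn_smul' u a] with x hx
    rw [hx]; ring
  rw [innerW_eq, innerW_eq, h1, fracLap_smul hu, real_inner_smul_left, real_inner_smul_right]
  ring

lemma innerW_self (u : L2 N) : innerW s V ε u u =
    ‖fracLap (s / 2) u‖ ^ 2 + ∫ x, V (ε • x) * (u x) ^ 2 := by
  rw [innerW_eq, real_inner_self_eq_norm_sq]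
  congr 2; ext x; ring

lemma quad_le_innerW (hV₀ : ∀ x, V₀ ≤ V x) {u : L2 N} (hu : MemW s V ε u) :
    quad s V₀ u ≤ innerW s V ε u u := by
  rw [innerW_self, quad, norm_sq_eq_integral_real u, ← integral_const_mul]
  have := integral_mono ((integrable_sq u).const_mul V₀) hu.2 fun x =>
    mul_le_mul_of_nonneg_right (hV₀ (ε • x)) (sq_nonneg (u x))
  linarith

/-- Inside the ball `V` may be smaller than `μ`; the deficit is at most `μ` times the local mass,
which disappears along locally vanishing sequences. -/
lemma quad_le_innerW_add {μ R : ℝ} (hV₀ : ∀ x, V₀ ≤ V x) (hpos : 0 < V₀)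
    (hout : ∀ x, R ≤ ‖x‖ → μ ≤ V (ε • x)) {u : L2 N} (hu : MemW s V ε u) :
    quad s μ u ≤ innerW s V ε u u + μ * ∫ x in Metric.ball 0 R, (u x) ^ 2 := by
  rw [innerW_self, quad, norm_sq_eq_integral_real u, ← integral_const_mul,
    ← integral_const_mul, ← integral_indicator measurableSet_ball, add_assoc,
    ← integral_add hu.2 (((integrable_sq u).const_mul μ).indicator measurableSet_ball)]
  gcongr
  · exact (integrable_sq u).const_mul μ
  · exact hu.2.add (((integrable_sq u).const_mul μ).indicator measurableSet_ball)
  intro x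
  simp only
  by_cases hx : x ∈ Metric.ball (0 : E N) R
  · rw [indicator_of_mem hx]
    have := hpos.trans_le (hV₀ (ε • x))
    nlinarith [mul_nonneg this.le (sq_nonneg (u x))]
  · rw [indicator_of_notMem hx, add_zero]
    gcongr
    exact hout x (by simpa using hx)

/-- Separability makes the weak-star compact balls used below sequentially compact. -/
instance : SecondCountableTopology (L2 N) := by
  have : Fact ((2 : ℝ≥0∞) ≠ ⊤) := ⟨by norm_num⟩
  infer_instance

/-- Bounded sequences in a separable Hilbert space have weakly convergent subsequences. -/
lemma exists_weak_subseq {X : Type*} [NormedAddCommGroup X] [InnerProductSpace ℝ X]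
    [CompleteSpace X] [SecondCountableTopology X] {x : ℕ → X} {M : ℝ} (hM : ∀ n, ‖x n‖ ≤ M) :
    ∃ (y : X) (φ : ℕ → ℕ), StrictMono φ ∧
      ∀ z, Tendsto (fun n => inner ℝ (x (φ n)) z) atTop (𝓝 (inner ℝ y z)) := by
  have hsc := WeakDual.isSeqCompact_closedBall ℝ X 0 M
  obtain ⟨ℓ, _, φ, hφ, hlim⟩ := hsc (x := fun n =>
    (InnerProductSpace.toDual ℝ X (x n)).toWeakDual) fun n => by
      simpa using hM n
  rw [tendsto_iff_forall_eval_tendsto_topDualPairing] at hlim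
  refine ⟨(InnerProductSpace.toDual ℝ X).symm (WeakDual.toStrongDual ℓ), φ, hφ, fun z => ?_⟩
  rw [InnerProductSpace.toDual_symm_apply]
  exact hlim z

lemma measurable_sqrt_potential (hV : Continuous V) : Measurable fun x => √(V (ε • x)) :=
  (measurable_potential hV).sqrt

lemma MemW.memLp_sqrt (hV : Continuous V) (hV₀ : ∀ x, V₀ ≤ V x) (hpos : 0 < V₀) {u : L2 N}
    (hu : MemW s V ε u) : MemLp (fun x => √(V (ε • x)) * u x) 2 volume := by
  have hm : AEStronglyMeasurable (fun x => √(V (ε • x)) * u x) volume :=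
    ((measurable_sqrt_potential hV).mul (measurable_coe u)).aestronglyMeasurable
  refine (memLp_two_iff_integrable_sq hm).2 ?_
  refine hu.2.congr (ae_of_all _ fun x => ?_)
  simp only
  rw [mul_pow, Real.sq_sqrt (hpos.trans_le (hV₀ _)).le]

/-- Weak sequential compactness of bounded subsets of `W_ε`. -/
theorem exists_weak_subseq_memW (hV : Continuous V) (hV₀ : ∀ x, V₀ ≤ V x) (hpos : 0 < V₀)
    {u : ℕ → L2 N} (hu : ∀ n, MemW s V ε (u n)) {M : ℝ} (hM : ∀ n, innerW s V ε (u n) (u n) ≤ M) :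
    ∃ (w : L2 N) (φ : ℕ → ℕ), StrictMono φ ∧ MemW s V ε w ∧
      (∀ ψ, Tendsto (fun n => inner ℝ ψ (u (φ n))) atTop (𝓝 (inner ℝ ψ w))) ∧
      ∀ z, MemW s V ε z →
        Tendsto (fun n => innerW s V ε z (u (φ n))) atTop (𝓝 (innerW s V ε z w)) := by
  -- The map `w ↦ (w, (-Δ)^(s/2) w, √V w)` sends `W_ε` into a product of copies of `L²`, with image
  -- the closed subspace `S`; weak compactness is taken from the product.
  let X := WithLp 2 (L2 N × WithLp 2 (L2 N × L2 N))
  let S : Submodule ℝ X :=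
    { carrier := {z | HasFracLap (s / 2) z.fst z.snd.fst ∧
        z.snd.snd =ᵐ[volume] fun x => √(V (ε • x)) * z.fst x}
      add_mem' := by
        rintro a b ⟨h1, h2⟩ ⟨k1, k2⟩
        refine ⟨h1.add k1, ?_⟩
        filter_upwards [h2, k2, Lp.coeFn_add a.fst b.fst, Lp.coeFn_add a.snd.snd b.snd.snd]
          with x q1 q2 q3 q4
        change (a.snd.snd + b.snd.snd : L2 N) x = √(V (ε • x)) * (a.fst + b.fst : L2 N) x
        rw [q3, q4, Pi.add_apply, Pi.add_apply, q1, q2]; ring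
      zero_mem' := by
        refine ⟨HasFracLap.zero, ?_⟩
        filter_upwards [Lp.coeFn_zero ℝ 2 (volume : Measure (E N))] with x hx
        change (0 : L2 N) x = √(V (ε • x)) * (0 : L2 N) x
        rw [hx]; simp
      smul_mem' := by
        rintro c a ⟨h1, h2⟩
        refine ⟨h1.smul c, ?_⟩
        filter_upwards [h2, coeFn_smul' a.fst c, coeFn_smul' a.snd.snd c] with x q1 q2 q3
        change (c • a.snd.snd : L2 N) x = √(V (ε • x)) * (c • a.fst : L2 N) x
        rw [q3, q2, q1]; ring }
  have hcl : IsClosed (S : Set X) := by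
    apply IsSeqClosed.isClosed
    intro z y hz hlim
    have c1 : Continuous fun z : X => z.fst := (WithLp.prod_continuous_ofLp 2 _ _).fst
    have c2 : Continuous fun z : X => z.snd := (WithLp.prod_continuous_ofLp 2 _ _).snd
    have c3 : Continuous fun z : X => z.snd.fst := (WithLp.prod_continuous_ofLp 2 _ _).fst.comp c2
    have c4 : Continuous fun z : X => z.snd.snd := (WithLp.prod_continuous_ofLp 2 _ _).snd.comp c2
    have l1 := (c1.tendsto y).comp hlim
    have l3 := (c3.tendsto y).comp hlim
    have l4 := (c4.tendsto y).comp hlim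
    refine ⟨HasFracLap.of_tendsto (fun n => (hz n).1) l1 l3, ?_⟩
    obtain ⟨φ, hφ, h1⟩ := exists_subseq_ae_tendsto l1
    obtain ⟨ψ, hψ, h2⟩ := exists_subseq_ae_tendsto (l4.comp hφ.tendsto_atTop)
    filter_upwards [h1, h2, ae_all_iff.2 fun n => (hz n).2] with x q1 q2 q3
    simp only [Function.comp] at q1 q2
    refine tendsto_nhds_unique q2 ?_
    simp only [q3]
    exact (q1.comp hψ.tendsto_atTop).const_mul _
  -- the embedding of `W_ε`
  let ι : ∀ w : L2 N, MemW s V ε w → X := fun w hw => WithLp.toLp 2 (w, WithLp.toLp 2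
    (fracLap (s / 2) w, (hw.memLp_sqrt hV hV₀ hpos).toLp _))
  have hιS : ∀ w hw, ι w hw ∈ S := fun w hw =>
    ⟨hw.1.hasFracLap, (hw.memLp_sqrt hV hV₀ hpos).coeFn_toLp⟩
  have hsq : ∀ w z (hw : MemW s V ε w) (hz : MemW s V ε z),
      inner ℝ ((hw.memLp_sqrt hV hV₀ hpos).toLp _) ((hz.memLp_sqrt hV hV₀ hpos).toLp _) =
        ∫ x, V (ε • x) * w x * z x := fun w z hw hz => by
    rw [inner_eq_integral]
    apply integral_congr_ae
    filter_upwards [(hw.memLp_sqrt hV hV₀ hpos).coeFn_toLp,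
      (hz.memLp_sqrt hV hV₀ hpos).coeFn_toLp] with x q1 q2
    rw [q1, q2]
    have := Real.mul_self_sqrt (hpos.trans_le (hV₀ (ε • x))).le
    linear_combination (w x * z x) * this
  have hιn : ∀ n, ‖ι (u n) (hu n)‖ ≤ √(M / V₀ + M) := fun n => by
    apply Real.le_sqrt_of_sq_le
    rw [WithLp.prod_norm_sq_eq_of_L2, WithLp.prod_norm_sq_eq_of_L2]
    have h1 : ‖(hu n).memLp_sqrt hV hV₀ hpos |>.toLp _‖ ^ 2 =
        ∫ x, V (ε • x) * u n x * u n x := by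
      rw [← hsq (u n) (u n) (hu n) (hu n), real_inner_self_eq_norm_sq]
    have h2 := quad_le_innerW hV₀ (hu n)
    have h3 := hM n
    rw [quad] at h2
    have h4 : ‖u n‖ ^ 2 ≤ M / V₀ := by
      rw [le_div_iff₀ hpos]; nlinarith [sq_nonneg ‖fracLap (s / 2) (u n)‖]
    rw [innerW_eq, real_inner_self_eq_norm_sq, ← h1] at h3
    exact add_le_add h4 h3
  obtain ⟨y, φ, hφ, hweak⟩ := exists_weak_subseq hιn
  have hy : y ∈ S := by
    -- A closed subspace equals its double orthogonal complement, hence is weakly closed.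
    have hS : Sᗮᗮ = S := by
      have : CompleteSpace S := hcl.completeSpace_coe
      exact Submodule.orthogonal_orthogonal S
    rw [← hS, Submodule.mem_orthogonal]
    intro z hz
    have h0 : ∀ n, inner ℝ (ι (u (φ n)) (hu (φ n))) z = 0 := fun n =>
      (Submodule.mem_orthogonal _ _).1 hz _ (hιS _ (hu (φ n)))
    have h1 := hweak z
    simp only [h0] at h1
    rw [real_inner_comm]
    exact (tendsto_nhds_unique h1 tendsto_const_nhds)
  have hyW : MemW s V ε y.fst := by
    refine ⟨⟨_, hy.1⟩, (integrable_sq y.snd.snd).congr ?_⟩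
    filter_upwards [hy.2] with x hx
    rw [hx, mul_pow, Real.sq_sqrt (hpos.trans_le (hV₀ _)).le]
  have hyι : y = ι y.fst hyW := by
    apply (WithLp.equiv 2 _).injective
    refine Prod.ext rfl ((WithLp.equiv 2 _).injective (Prod.ext ?_ ?_))
    · exact hy.1.fracLap_eq.symm
    · exact Lp.ext (hy.2.trans (hyW.memLp_sqrt hV hV₀ hpos).coeFn_toLp.symm)
  refine ⟨y.fst, φ, hφ, hyW, fun ψ => ?_, fun z hz => ?_⟩
  · have e : ∀ w (hw : MemW s V ε w), inner ℝ (ι w hw) (WithLp.toLp 2 (ψ, 0)) =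
        inner ℝ ψ w := fun w hw => by
      rw [WithLp.prod_inner_apply]
      simp [ι, real_inner_comm]
    have h2 := hweak (WithLp.toLp 2 (ψ, 0))
    rw [hyι] at h2
    simp only [e] at h2
    exact h2
  · have e : ∀ w (hw : MemW s V ε w), inner ℝ (ι w hw) (WithLp.toLp 2 (0, (ι z hz).snd)) =
        innerW s V ε z w := fun w hw => by
      rw [WithLp.prod_inner_apply, WithLp.prod_inner_apply]
      have h1 := hsq w z hw hz
      rw [innerW_comm, innerW_eq, ← h1]
      simp [ι]
    have h2 := hweak (WithLp.toLp 2 (0, (ι z hz).snd))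
    rw [hyι] at h2
    simp only [e] at h2
    exact h2

end WSpace

/-! ### Splitting along weakly convergent sequences -/

section Split

variable {N : ℕ} {s α p : ℝ} {f : ℝ → ℝ}

lemma tendsto_setIntegral_compl_ball {g : E N → ℝ} (hg : Integrable g) :
    Tendsto (fun n : ℕ => ∫ x in (Metric.ball (0 : E N) n)ᶜ, g x) atTop (𝓝 0) := by
  have h := tendsto_setIntegral_of_antitone (μ := volume) (f := g)
    (s := fun n : ℕ => (Metric.ball (0 : E N) n)ᶜ)
    (fun n => measurableSet_ball.compl)
    (fun m n hmn => compl_subset_compl.2 (Metric.ball_subset_ball (by exact_mod_cast hmn)))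
    ⟨0, hg.integrableOn⟩
  have e : ⋂ n : ℕ, (Metric.ball (0 : E N) n)ᶜ = ∅ := by
    rw [← compl_iUnion, Metric.iUnion_ball_nat, compl_univ]
  rw [e] at h
  simpa using h

/-- Strong local `L²` convergence and `H^s` boundedness. -/
structure LocallyVanishing (s : ℝ) (v : ℕ → L2 N) : Prop where
  mem : ∀ n, MemHs s (v n)
  bound : ∃ M, ∀ n, ‖v n‖ ≤ M ∧ ‖fracLap (s / 2) (v n)‖ ≤ M
  loc : ∀ R, Tendsto (fun n => ∫ x in Metric.ball 0 R, (v n x) ^ 2) atTop (𝓝 0)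

lemma Setting.exists_integral_gauge_le (S : Setting N s α p f) {v : ℕ → L2 N}
    (hv : LocallyVanishing s v) : ∃ M : ℝ, 0 < M ∧ ∀ n, ∫ x, gauge2 p (v n x) ≤ M ∧
      ∫ x, |v n x| ^ (2 * N / (N - 2 * s) : ℝ) ≤ M := by
  obtain ⟨M, hM⟩ := hv.bound
  obtain ⟨C, hC, h⟩ := S.exists_sobolev
  set r : ℝ := 2 * N / (N - 2 * s)
  have hr : 4 < r := S.two_lt
  have hM0 : 0 ≤ M := (norm_nonneg _).trans (hM 0).1
  have hb : ∀ n, ∫ x, |v n x| ^ r ≤ C * M ^ r := fun n =>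
    (h _ (hv.mem n)).2.trans (by gcongr; exact (hM n).2)
  have hMr : 0 ≤ C * M ^ r := by positivity
  refine ⟨2 * M ^ 2 + C * M ^ r + 1, by positivity, fun n => ⟨?_, ?_⟩⟩
  · have h1 : ∫ x, gauge2 p (v n x) ≤ ∫ x, (2 * (v n x) ^ 2 + |v n x| ^ r) := by
      refine integral_mono (S.integrable_gauge (hv.mem n))
        (((integrable_sq _).const_mul 2).add (S.integrable_rpow (hv.mem n))) fun x => ?_
      have := rpow_le_add_rpow (a := 2) (b := p) (c := r) two_pos (by linarith [S.nl.four_lt])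
        S.p_lt.le (abs_nonneg (v n x))
      rw [Real.rpow_two, sq_abs] at this
      simp only [gauge2]
      linarith
    rw [integral_add ((integrable_sq _).const_mul 2) (S.integrable_rpow (hv.mem n)),
      integral_const_mul, ← norm_sq_eq_integral_real] at h1
    have h2 := hb n
    have h3 : ‖v n‖ ^ 2 ≤ M ^ 2 := by gcongr; exact (hM n).1
    linarith
  · have := hb n
    have : 0 ≤ M ^ 2 := by positivity
    linarith

/-- Interpolation: as `2 < p < 2N/(N-2s)`, the `p`-th power is a small multiple of the bounded
critical power plus a multiple of the square, whose integral over the ball tends to `0`. -/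
lemma Setting.tendsto_setIntegral_gauge (S : Setting N s α p f) {v : ℕ → L2 N}
    (hv : LocallyVanishing s v) (R : ℝ) :
    Tendsto (fun n => ∫ x in Metric.ball 0 R, gauge2 p (v n x)) atTop (𝓝 0) := by
  obtain ⟨M, hM0, hM⟩ := S.exists_integral_gauge_le hv
  set r : ℝ := 2 * N / (N - 2 * s)
  rw [Metric.tendsto_atTop]
  intro δ hδ
  obtain ⟨C, hC, hb⟩ := exists_rpow_le_high (a := 2) (b := p) (c := r) two_pos
    (by linarith [S.nl.four_lt]) S.p_lt (δ := δ / (2 * M)) (by positivity)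
  obtain ⟨n0, hn0⟩ := eventually_atTop.1 ((hv.loc R).eventually
    (gt_mem_nhds (by positivity : 0 < δ / (2 * (1 + C)))))
  refine ⟨n0, fun n hn => ?_⟩
  have h0 : 0 ≤ ∫ x in Metric.ball 0 R, gauge2 p (v n x) :=
    integral_nonneg fun x => gauge2_nonneg _ _
  rw [Real.dist_eq, sub_zero, abs_of_nonneg h0]
  have h1 : ∫ x in Metric.ball 0 R, gauge2 p (v n x) ≤
      ∫ x in Metric.ball 0 R, ((1 + C) * (v n x) ^ 2 + δ / (2 * M) * |v n x| ^ r) := by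
    refine integral_mono (S.integrable_gauge (hv.mem n)).integrableOn
      (((integrable_sq _).const_mul _).add
        ((S.integrable_rpow (hv.mem n)).const_mul _)).integrableOn fun x => ?_
    have := hb |v n x| (abs_nonneg _)
    rw [Real.rpow_two, sq_abs] at this
    simp only [gauge2]
    linarith
  rw [integral_add ((integrable_sq _).const_mul _).integrableOn
    ((S.integrable_rpow (hv.mem n)).const_mul _).integrableOn,
    integral_const_mul, integral_const_mul] at h1
  have h2 : ∫ x in Metric.ball 0 R, |v n x| ^ r ≤ M :=
    (setIntegral_le_integral (S.integrable_rpow (hv.mem n))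
      (ae_of_all _ fun x => by positivity)).trans (hM n).2
  have h3 : (1 + C) * ∫ x in Metric.ball 0 R, (v n x) ^ 2 < δ / 2 := by
    calc _ < (1 + C) * (δ / (2 * (1 + C))) := by gcongr; exact hn0 n hn
      _ = _ := by field_simp
  have h4 : δ / (2 * M) * ∫ x in Metric.ball 0 R, |v n x| ^ r ≤ δ / 2 := by
    calc _ ≤ δ / (2 * M) * M := by gcongr
      _ = _ := by field_simp
  linarith

/-- The Brezis-Lieb splitting for `∫ F`, uniformly along bounded parts of rays. -/
theorem Setting.eventually_split (S : Setting N s α p f) {u : L2 N} (hu : MemHs s u)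
    {v : ℕ → L2 N} (hv : LocallyVanishing s v) (T : ℝ) {δ : ℝ} (hδ : 0 < δ) :
    ∀ᶠ n in atTop, ∀ t, 0 ≤ t → t ≤ T →
      |(∫ x, primitive f (t * (u + v n : L2 N) x)) - (∫ x, primitive f (t * u x)) -
        ∫ x, primitive f (t * v n x)| ≤ δ := by
  obtain ⟨M, hM0, hM⟩ := S.exists_integral_gauge_le hv
  have hp := S.nl.four_lt
  set T' := max T 1
  have hT'1 : 1 ≤ T' := le_max_right _ _
  have hT'0 : 0 < T' := by linarith
  have hT'p : 0 < T' ^ p := by positivity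
  set A := ∫ x, gauge2 p (u x)
  have hA : 0 ≤ A := integral_nonneg fun x => gauge2_nonneg _ _
  -- Error budget: the small coefficient meets the total gauges `M + A` and costs `δ/4`; the
  -- constant `C` meets the gauge of `u` outside the ball and that of `v n` inside it, each costing
  -- `δ/4`. The factor `T'^p` makes this uniform in `t ≤ T`.
  obtain ⟨C, hC, hb⟩ := S.nl.exists_split_bound (δ := δ / (4 * T' ^ p * (M + A))) (by positivity)
  set δ' := δ / (4 * T' ^ p * (M + A))
  have hδ' : 0 < δ' := by positivity
  obtain ⟨R, hR⟩ := ((tendsto_setIntegral_compl_ball (S.integrable_gauge hu)).eventually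
    (gt_mem_nhds (by positivity : 0 < δ / (4 * T' ^ p * C)))).exists
  filter_upwards [(S.tendsto_setIntegral_gauge hv R).eventually
    (gt_mem_nhds (by positivity : 0 < δ / (4 * T' ^ p * C)))] with n hn t ht0 htT
  have htT' : t ≤ T' := htT.trans (le_max_left _ _)
  have hgt : ∀ y, gauge2 p (t * y) ≤ T' ^ p * gauge2 p y := fun y => by
    refine le_trans (gauge2_mono hp ?_) (gauge2_mul_le hp hT'1 y)
    rw [abs_mul, abs_mul, abs_of_nonneg ht0, abs_of_pos hT'0]
    gcongr
  set G : E N → ℝ := fun x => primitive f (t * (u x + v n x)) - primitive f (t * u x) -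
    primitive f (t * v n x)
  have e0 : (fun x => primitive f (t * (u + v n : L2 N) x)) =ᵐ[volume]
      fun x => primitive f (t * (u x + v n x)) := by
    filter_upwards [Lp.coeFn_add u (v n)] with x hx
    rw [hx, Pi.add_apply]
  have hsum : MemHs s (u + v n) := by
    have := hu.lin (hv.mem n) 1 1
    simpa using this
  have i0 : Integrable fun x => primitive f (t * (u x + v n x)) :=
    (S.integrable_primitive_smul hsum t).congr e0
  have i1 := S.integrable_primitive_smul hu t
  have i2 := S.integrable_primitive_smul (hv.mem n) t
  have hG : Integrable G := (i0.sub i1).sub i2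
  have e1 : (∫ x, primitive f (t * (u + v n : L2 N) x)) - (∫ x, primitive f (t * u x)) -
      ∫ x, primitive f (t * v n x) = ∫ x, G x := by
    rw [integral_congr_ae e0, ← integral_sub i0 i1]
    exact (integral_sub (i0.sub i1) i2).symm
  rw [e1]
  have gu := S.integrable_gauge hu
  have gv := S.integrable_gauge (hv.mem n)
  -- The splitting error is symmetric in its two arguments, so the large constant can be put on
  -- whichever function is small: on `u` far away, on `v n` inside the ball.
  have bnd1 : ∀ x, |G x| ≤ T' ^ p * (δ' * gauge2 p (v n x) + C * gauge2 p (u x)) := fun x => by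
    have h1 := hb (t * u x) (t * v n x)
    rw [← mul_add] at h1
    calc |G x| ≤ _ := h1
      _ ≤ δ' * (T' ^ p * gauge2 p (v n x)) + C * (T' ^ p * gauge2 p (u x)) := by
        gcongr <;> exact hgt _
      _ = _ := by ring
  have bnd2 : ∀ x, |G x| ≤ T' ^ p * (δ' * gauge2 p (u x) + C * gauge2 p (v n x)) := fun x => by
    have h1 := hb (t * v n x) (t * u x)
    rw [← mul_add, add_comm (v n x), sub_right_comm] at h1
    calc |G x| ≤ _ := h1
      _ ≤ δ' * (T' ^ p * gauge2 p (u x)) + C * (T' ^ p * gauge2 p (v n x)) := by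
        gcongr <;> exact hgt _
      _ = _ := by ring
  set B := Metric.ball (0 : E N) R
  have hB : MeasurableSet B := measurableSet_ball
  have hin : ∫ x in B, |G x| ≤ T' ^ p * (δ' * A + C * (δ / (4 * T' ^ p * C))) := by
    calc ∫ x in B, |G x| ≤ ∫ x in B, T' ^ p * (δ' * gauge2 p (u x) + C * gauge2 p (v n x)) :=
          integral_mono hG.abs.integrableOn
            (((gu.const_mul _).add (gv.const_mul _)).const_mul _).integrableOn bnd2
      _ = T' ^ p * (δ' * (∫ x in B, gauge2 p (u x)) + C * ∫ x in B, gauge2 p (v n x)) := by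
          rw [integral_const_mul, integral_add (gu.const_mul _).integrableOn
            (gv.const_mul _).integrableOn, integral_const_mul, integral_const_mul]
      _ ≤ _ := by
          gcongr
          exact setIntegral_le_integral gu (ae_of_all _ fun x => gauge2_nonneg _ _)
  have hcomp : ∫ x in Bᶜ, |G x| ≤ T' ^ p * (δ' * M + C * (δ / (4 * T' ^ p * C))) := by
    calc ∫ x in Bᶜ, |G x| ≤ ∫ x in Bᶜ, T' ^ p * (δ' * gauge2 p (v n x) + C * gauge2 p (u x)) :=
          integral_mono hG.abs.integrableOn
            (((gv.const_mul _).add (gu.const_mul _)).const_mul _).integrableOn bnd1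
      _ = T' ^ p * (δ' * (∫ x in Bᶜ, gauge2 p (v n x)) + C * ∫ x in Bᶜ, gauge2 p (u x)) := by
          rw [integral_const_mul, integral_add (gv.const_mul _).integrableOn
            (gu.const_mul _).integrableOn, integral_const_mul, integral_const_mul]
      _ ≤ _ := by
          gcongr
          exact (setIntegral_le_integral gv (ae_of_all _ fun x => gauge2_nonneg _ _)).trans
            (hM n).1
  calc |∫ x, G x| ≤ ∫ x, |G x| := abs_integral_le_integral_abs
    _ = (∫ x in B, |G x|) + ∫ x in Bᶜ, |G x| := (integral_add_compl hB hG.abs).symm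
    _ ≤ T' ^ p * (δ' * A + C * (δ / (4 * T' ^ p * C))) +
        T' ^ p * (δ' * M + C * (δ / (4 * T' ^ p * C))) := add_le_add hin hcomp
    _ = T' ^ p * (δ' * (M + A)) + δ / 2 := by field_simp; ring
    _ = δ / 4 + δ / 2 := by
        congr 1
        simp only [δ']
        field_simp
    _ ≤ δ := by linarith

end Split

/-! ### The Poisson term -/

section PoissonTerm

variable {N : ℕ} {s α p θ ε : ℝ} {f : ℝ → ℝ}

/-- The exponent `2N/(N+α)` lies in `[1,2]`, so the power of `|uv|` is dominated by squares and
fourth powers; fourth powers are integrable because `4` lies below the critical exponent. -/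
lemma Setting.memLp_mul (S : Setting N s α p f) {u v : L2 N} (hu : MemHs s u) (hv : MemHs s v) :
    MemLp (fun x => u x * v x) (cStar N α) volume := by
  have hN : (0 : ℝ) < N := S.alpha_pos.trans S.alpha_lt
  set q : ℝ := 2 * N / (N + α)
  have hq1 : 1 ≤ q := by
    rw [le_div_iff₀ (by linarith [S.alpha_pos])]; linarith [S.alpha_lt]
  have hq2 : q ≤ 2 := by
    rw [div_le_iff₀ (by linarith [S.alpha_pos])]; linarith [S.alpha_pos]
  have hm : Measurable fun x => u x * v x := (measurable_coe u).mul (measurable_coe v)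
  have h4 : ∀ {w : L2 N}, MemHs s w → Integrable fun x => (w x) ^ 4 := fun {w} hw => by
    refine Integrable.mono' ((integrable_sq w).add (S.integrable_rpow hw))
      ((measurable_coe w).pow_const 4).aestronglyMeasurable (ae_of_all _ fun x => ?_)
    have := rpow_le_add_rpow (a := 2) (b := 4) (c := 2 * N / (N - 2 * s)) two_pos (by norm_num)
      S.two_lt.le (abs_nonneg (w x))
    rw [Real.rpow_two, sq_abs] at this
    rw [norm_pow, Real.norm_eq_abs]
    convert! this using 1
    norm_cast
  have hi : Integrable fun x => |u x * v x| ^ q := by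
    refine Integrable.mono' (((integrable_sq u).add (integrable_sq v)).add ((h4 hu).add (h4 hv)))
      (hm.abs.pow_const q).aestronglyMeasurable (ae_of_all _ fun x => ?_)
    rw [Real.norm_of_nonneg (by positivity)]
    have h1 := rpow_le_add_rpow (a := 1) (b := q) (c := 2) one_pos hq1 hq2
      (abs_nonneg (u x * v x))
    rw [Real.rpow_two, sq_abs, Real.rpow_one] at h1
    refine h1.trans ?_
    simp only [Pi.add_apply]
    have h2 : |u x * v x| ≤ u x ^ 2 + v x ^ 2 := by
      rw [abs_le]; constructor <;> nlinarith [sq_nonneg (u x + v x), sq_nonneg (u x - v x)]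
    nlinarith [sq_nonneg (u x ^ 2 - v x ^ 2), sq_nonneg (u x ^ 2), sq_nonneg (v x ^ 2)]
  have hq0 : 0 < q := by linarith
  have := integrable_norm_rpow_iff (p := cStar N α) (μ := volume) hm.aestronglyMeasurable
    (by simpa [cStar] using hq0) ENNReal.ofReal_ne_top
  rw [← this]
  rw [cStar, ENNReal.toReal_ofReal hq0.le]
  exact hi

lemma Setting.memLp_sq (S : Setting N s α p f) {u : L2 N} (hu : MemHs s u) :
    MemLp (fun x => (u x) ^ 2) (cStar N α) volume := by
  simpa [sq] using S.memLp_mul hu hu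

/-- The Poisson energy `∫ φ_u u²`. -/
def poissonE (α θ ε : ℝ) (u : L2 N) : ℝ := ∫ x, phi α θ ε u x * (u x) ^ 2

lemma Setting.isPoissonSol (S : Setting N s α p f) {u : L2 N} (hu : MemHs s u) :
    IsPoissonSol α θ ε u (phi α θ ε u) := by
  have : Fact (1 ≤ pStar N α) := ⟨one_le_pStar S.alpha_pos S.alpha_lt⟩
  obtain ⟨φ, g, h⟩ := exists_isRiesz S.alpha_pos S.alpha_lt (S.memLp_sq hu)
  exact (phi_eq S.alpha_pos S.alpha_lt (S.memLp_sq hu) h).2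

/-- The Poisson energy along the plane spanned by `u` and `v`. -/
lemma Setting.exists_poissonE_lin (S : Setting N s α p f) (θ ε : ℝ) {u v : L2 N}
    (hu : MemHs s u) (hv : MemHs s v) : ∃ g₁ g₂ g₃ : L2 N, ∀ a b : ℝ,
      poissonE α θ ε (a • u + b • v) =
        coef N α θ ε * ‖a ^ 2 • g₁ + (2 * a * b) • g₂ + b ^ 2 • g₃‖ ^ 2 ∧
      ∫ x, phi α θ ε (a • u + b • v) x * (a • u + b • v : L2 N) x * v x =
        coef N α θ ε * inner ℝ (a ^ 2 • g₁ + (2 * a * b) • g₂ + b ^ 2 • g₃)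
          (a • g₂ + b • g₃) := by
  have : Fact (1 ≤ pStar N α) := ⟨one_le_pStar S.alpha_pos S.alpha_lt⟩
  have m1 := S.memLp_mul hu hu
  have m2 := S.memLp_mul hu hv
  have m3 := S.memLp_mul hv hv
  obtain ⟨φ₁, g₁, h₁⟩ := exists_isRiesz S.alpha_pos S.alpha_lt m1
  obtain ⟨φ₂, g₂, h₂⟩ := exists_isRiesz S.alpha_pos S.alpha_lt m2
  obtain ⟨φ₃, g₃, h₃⟩ := exists_isRiesz S.alpha_pos S.alpha_lt m3
  refine ⟨g₁, g₂, g₃, fun a b => ?_⟩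
  set w := a • u + b • v
  have hw : MemHs s w := hu.lin hv a b
  -- Linearity in the density, applied to `(au + bv)² = a²u² + 2ab·uv + b²v²`.
  have k1 := (h₁.add_smul S.alpha_pos S.alpha_lt m1 m2 h₂ (a ^ 2) (2 * a * b)).add_smul
    S.alpha_pos S.alpha_lt ((m1.const_mul _).add (m2.const_mul _)) m3 h₃ 1 (b ^ 2)
  rw [one_smul, one_smul] at k1
  have k2 := h₂.add_smul S.alpha_pos S.alpha_lt m2 m3 h₃ a b
  have congr_riesz : ∀ {ρ ρ' : E N → ℝ} {φ : LStar N α} {g : L2 N}, ρ =ᵐ[volume] ρ' →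
      IsRiesz α ρ φ g → IsRiesz α ρ' φ g := fun {ρ ρ' φ g} e h =>
    ⟨h.1, fun z k hz => (h.2 z k hz).trans (integral_congr_ae (by
      filter_upwards [e] with x hx; rw [hx]))⟩
  have k1' := congr_riesz (ρ' := fun x => (w x) ^ 2) (by
    filter_upwards [coeFn_lin u v a b] with x hx
    rw [hx]; simp only [Pi.add_apply]; ring) k1
  have k2' := congr_riesz (ρ' := fun x => w x * v x) (by
    filter_upwards [coeFn_lin u v a b] with x hx
    rw [hx]; ring) k2
  constructor
  · rw [poissonE, integral_phi_mul S.alpha_pos S.alpha_lt (S.memLp_sq hw) k1' k1',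
      real_inner_self_eq_norm_sq]
  · rw [← integral_phi_mul S.alpha_pos S.alpha_lt (S.memLp_sq hw) k1' k2']
    congr 1; ext x; ring

lemma Setting.exists_poissonE_eq (S : Setting N s α p f) {u : L2 N} (hu : MemHs s u) :
    ∃ φ g, IsRiesz α (fun x => (u x) ^ 2) φ g ∧
      ∀ θ ε, poissonE α θ ε u = coef N α θ ε * ‖g‖ ^ 2 := by
  have : Fact (1 ≤ pStar N α) := ⟨one_le_pStar S.alpha_pos S.alpha_lt⟩
  obtain ⟨φ, g, h⟩ := exists_isRiesz S.alpha_pos S.alpha_lt (S.memLp_sq hu)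
  refine ⟨φ, g, h, fun θ ε => ?_⟩
  rw [poissonE, integral_phi_mul S.alpha_pos S.alpha_lt (S.memLp_sq hu) h h,
    real_inner_self_eq_norm_sq]

lemma Setting.coef_pos (S : Setting N s α p f) (hε : 0 < ε) : 0 < coef N α θ ε :=
  FracSP.coef_pos S.alpha_pos S.alpha_lt hε

lemma Setting.poissonE_nonneg (S : Setting N s α p f) (hε : 0 < ε) {u : L2 N} (hu : MemHs s u) :
    0 ≤ poissonE α θ ε u := by
  obtain ⟨φ, g, _, h⟩ := S.exists_poissonE_eq hu
  rw [h]
  have := S.coef_pos (θ := θ) hε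
  positivity

lemma Setting.poissonE_smul (S : Setting N s α p f) {u : L2 N} (hu : MemHs s u) (a : ℝ) :
    poissonE α θ ε (a • u) = a ^ 4 * poissonE α θ ε u := by
  obtain ⟨g₁, g₂, g₃, h⟩ := S.exists_poissonE_lin θ ε hu hu
  have h1 := (h a 0).1
  have h2 := (h 1 0).1
  simp only [zero_smul, add_zero, mul_zero, one_smul, ne_eq, OfNat.ofNat_ne_zero,
    not_false_eq_true, zero_pow, one_pow] at h1 h2
  rw [h1, h2, norm_smul, mul_pow, Real.norm_eq_abs, sq_abs]
  ring

/-- Lower semicontinuity of the Poisson energy. -/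
lemma Setting.eventually_poissonE_le (S : Setting N s α p f) (hε : 0 < ε) {u : L2 N}
    (hu : MemHs s u) {v : ℕ → L2 N} (hv : LocallyVanishing s v) {δ : ℝ} (hδ : 0 < δ) :
    ∀ᶠ n in atTop, poissonE α θ ε u ≤ poissonE α θ ε (u + v n) + δ := by
  have : Fact (1 ≤ pStar N α) := ⟨one_le_pStar S.alpha_pos S.alpha_lt⟩
  have hc := S.coef_pos (θ := θ) hε
  have hsum : ∀ n, MemHs s (u + v n) := fun n => by
    simpa using hu.lin (hv.mem n) 1 1
  obtain ⟨φ₀, g₀, h₀, e₀⟩ := S.exists_poissonE_eq hu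
  choose φ g h e using fun n => S.exists_poissonE_eq (hsum n)
  have hlim : ∀ w : L2 N, IsTest w → Tendsto (fun n => ∫ x, ((u + v n : L2 N) x) ^ 2 * w x) atTop
      (𝓝 (∫ x, (u x) ^ 2 * w x)) := by
    -- The test function has compact support, so only `2u v_n + v_n²` on a ball matters, and local
    -- `L²` convergence suffices.
    rintro w ⟨η, hη1, hη2, hη3⟩
    obtain ⟨C, hC⟩ := hη1.continuous.bounded_above_of_compact_support hη2
    have hC0 : 0 ≤ C := (norm_nonneg _).trans (hC 0)
    obtain ⟨R, hR⟩ := hη2.isBounded.subset_ball 0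
    set B := Metric.ball (0 : E N) R
    obtain ⟨M, hM⟩ := hv.bound
    set a : ℕ → ℝ := fun n => ∫ x in B, (v n x) ^ 2
    have ha : Tendsto a atTop (𝓝 0) := hv.loc R
    have hbound : ∀ n, |(∫ x, ((u + v n : L2 N) x) ^ 2 * w x) - ∫ x, (u x) ^ 2 * w x| ≤
        C * (2 * (‖u‖ * √(a n)) + a n) := fun n => by
      have i1 : Integrable fun x => (u x) ^ 2 * w x := by
        refine ((integrable_sq u).mul_bdd (c := C) (g := fun x => η x)
          hη1.continuous.aestronglyMeasurable (ae_of_all _ hC)).congr ?_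
        filter_upwards [hη3] with x hx
        rw [hx]
      have i2 : Integrable fun x => ((u + v n : L2 N) x) ^ 2 * w x := by
        refine ((integrable_sq (u + v n)).mul_bdd (c := C) (g := fun x => η x)
          hη1.continuous.aestronglyMeasurable (ae_of_all _ hC)).congr ?_
        filter_upwards [hη3] with x hx
        rw [hx]
      rw [← integral_sub i2 i1]
      have i3 : Integrable fun x => |u x| * |v n x| :=
        (Lp.memLp u).abs.integrable_mul (Lp.memLp (v n)).abs
      calc _ ≤ ∫ x, |((u + v n : L2 N) x) ^ 2 * w x - (u x) ^ 2 * w x| :=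
            abs_integral_le_integral_abs
        _ ≤ ∫ x, B.indicator (fun x => C * (2 * (|u x| * |v n x|) + (v n x) ^ 2)) x := by
            apply integral_mono_ae (i2.sub i1).abs
              ((((i3.const_mul 2).add (integrable_sq _)).const_mul C).indicator measurableSet_ball)
            filter_upwards [hη3, Lp.coeFn_add u (v n)] with x hx1 hx2
            simp only [hx1, hx2, Pi.add_apply, Pi.sub_apply]
            by_cases hxB : x ∈ B
            · rw [indicator_of_mem hxB]
              have e1 : (u x + v n x) ^ 2 * η x - u x ^ 2 * η x =
                  η x * (2 * (u x * v n x) + v n x ^ 2) := by ring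
              rw [e1, abs_mul]
              gcongr
              · exact hC x
              · refine (abs_add_le _ _).trans ?_
                rw [abs_mul, abs_mul, abs_of_pos (two_pos : (0 : ℝ) < 2), abs_sq]
            · have : η x = 0 := by
                by_contra hne
                exact hxB (hR (subset_tsupport _ hne))
              rw [this, indicator_of_notMem hxB]; simp
        _ = C * (2 * (∫ x in B, |u x| * |v n x|) + a n) := by
            rw [integral_indicator measurableSet_ball, integral_const_mul,
              integral_add (i3.const_mul 2).integrableOn (integrable_sq _).integrableOn,
              integral_const_mul]
        _ ≤ _ := by
            gcongr
            have h1 := integral_mul_le_sqrt (μ := volume.restrict B)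
              (f := fun x => |u x|) (g := fun x => |v n x|)
              (ae_of_all _ fun _ => abs_nonneg _) (ae_of_all _ fun _ => abs_nonneg _)
              ((Lp.memLp u).abs.restrict B) ((Lp.memLp (v n)).abs.restrict B)
            simp only [sq_abs] at h1
            refine h1.trans ?_
            gcongr
            rw [← Real.sqrt_sq (norm_nonneg u), norm_sq_eq_integral_real]
            exact Real.sqrt_le_sqrt (setIntegral_le_integral (integrable_sq u)
              (ae_of_all _ fun _ => by positivity))
    rw [tendsto_iff_dist_tendsto_zero]
    refine squeeze_zero (fun _ => dist_nonneg) (fun n => hbound n) ?_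
    have h1 : Tendsto (fun n => √(a n)) atTop (𝓝 0) := by
      simpa [Function.comp_def] using (Real.continuous_sqrt.tendsto 0).comp ha
    simpa using (((h1.const_mul ‖u‖).const_mul 2).add ha).const_mul C
  have h1 := eventually_norm_sq_le h h₀ hlim (δ := δ / coef N α θ ε) (by positivity)
  filter_upwards [h1] with n hn
  rw [e₀, e]
  calc _ ≤ coef N α θ ε * (‖g n‖ ^ 2 + δ / coef N α θ ε) := by gcongr
    _ = _ := by field_simp

end PoissonTerm

/-! ### The Nehari manifold -/

section NehariManifold

variable {N : ℕ} {s α p θ ε V₀ : ℝ} {f : ℝ → ℝ} {V : E N → ℝ}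

lemma fiber_smul (Q D : ℝ) (u : L2 N) (t : ℝ) :
    fiber f (t ^ 2 * Q) (t ^ 4 * D) (t • u) 1 = fiber f Q D u t := by
  have := integral_comp_smul_congr (primitive f) u t
  simp [fiber, this]

lemma energy_eq (u : L2 N) :
    energy s α θ V f ε u = fiber f (innerW s V ε u u) (poissonE α θ ε u) u 1 := by
  simp [energy, fiber, poissonE]

lemma Setting.energy_smul (S : Setting N s α p f) {u : L2 N} (hu : MemHs s u) (t : ℝ) :
    energy s α θ V f ε (t • u) = fiber f (innerW s V ε u u) (poissonE α θ ε u) u t := by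
  rw [energy_eq, innerW_smul_smul hu, S.poissonE_smul hu, fiber_smul]

lemma mem_nehari_iff {u : L2 N} : u ∈ nehari s α θ V f ε ↔ MemW s V ε u ∧ u ≠ 0 ∧
    innerW s V ε u u + poissonE α θ ε u = ∫ x, f (u x) * u x := by
  rw [nehari, mem_ofPred_eq, poissonE, sub_eq_zero]

lemma Setting.smul_mem_nehari (S : Setting N s α p f) {u : L2 N} (hu : MemW s V ε u)
    (hu0 : u ≠ 0) {t : ℝ} (ht : 0 < t)
    (h : t ^ 2 * innerW s V ε u u + t ^ 4 * poissonE α θ ε u = ∫ x, f (t * u x) * (t * u x)) :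
    t • u ∈ nehari s α θ V f ε := by
  refine mem_nehari_iff.2 ⟨hu.smul t, smul_ne_zero ht.ne' hu0, ?_⟩
  rw [innerW_smul_smul hu.1, S.poissonE_smul hu.1, h]
  exact (integral_comp_smul_congr (fun y => f y * y) u t).symm

lemma innerW_nonneg (hV₀ : ∀ x, V₀ ≤ V x) (hpos : 0 < V₀) {u : L2 N} (hu : MemW s V ε u) :
    0 ≤ innerW s V ε u u := (quad_nonneg hpos.le u).trans (quad_le_innerW hV₀ hu)

lemma innerW_pos (hV₀ : ∀ x, V₀ ≤ V x) (hpos : 0 < V₀) {u : L2 N} (hu : MemW s V ε u)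
    (hu0 : u ≠ 0) : 0 < innerW s V ε u u := (quad_pos hpos hu0).trans_le (quad_le_innerW hV₀ hu)

lemma Setting.energy_smul_le (S : Setting N s α p f) (hV₀ : ∀ x, V₀ ≤ V x) (hpos : 0 < V₀)
    {u : L2 N} (hu : u ∈ nehari s α θ V f ε) {t : ℝ} (ht : 0 ≤ t) :
    energy s α θ V f ε (t • u) ≤ energy s α θ V f ε u := by
  obtain ⟨h1, h2, h3⟩ := mem_nehari_iff.1 hu
  rw [S.energy_smul h1.1, energy_eq]
  exact S.fiber_le h1.1 (innerW_nonneg hV₀ hpos h1) h3 ht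

lemma Setting.quarter_innerW_le_energy (S : Setting N s α p f) {u : L2 N}
    (hu : u ∈ nehari s α θ V f ε) : 1 / 4 * innerW s V ε u u ≤ energy s α θ V f ε u := by
  obtain ⟨h1, h2, h3⟩ := mem_nehari_iff.1 hu
  have := S.quarter_le_fiber h1.1 (innerW s V ε u u) (poissonE α θ ε u) 1
  simp only [one_pow, one_mul, h3, sub_self, mul_zero, zero_add] at this
  rwa [energy_eq]

/-- Negative energy at `T` forces a negative radial derivative there, so the Nehari point comes
before `T`. This locates it where energy estimates on `[0,T]` apply. -/
lemma Setting.exists_smul_mem_nehari (S : Setting N s α p f) (hV₀ : ∀ x, V₀ ≤ V x)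
    (hpos : 0 < V₀) (hε : 0 < ε) {u : L2 N} (hu : MemW s V ε u) {T : ℝ} (hT : 0 < T)
    (h : energy s α θ V f ε (T • u) < 0) :
    ∃ t, 0 < t ∧ t < T ∧ t • u ∈ nehari s α θ V f ε := by
  have hu0 : u ≠ 0 := by
    rintro rfl
    rw [smul_zero, energy_eq] at h
    have h1 : fiber f (innerW s V ε 0 0) (poissonE α θ ε (0 : L2 N)) (0 : L2 N) 1 ≥ 0 := by
      have h2 := S.poissonE_nonneg (θ := θ) hε hu.1
      have h3 := innerW_nonneg hV₀ hpos hu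
      have h4 : ∫ x, primitive f (1 * (0 : L2 N) x) = 0 := by
        apply integral_eq_zero_of_ae
        refine ae_of_all _ fun x => ?_
        simp [S.nl.primitive_eq_zero le_rfl]
      rw [fiber, h4]; linarith
    linarith
  rw [S.energy_smul hu.1] at h
  have hQ := innerW_pos hV₀ hpos hu hu0
  have h1 := S.quarter_le_fiber hu.1 (innerW s V ε u u) (poissonE α θ ε u) T
  have h2 : 0 ≤ T ^ 2 * innerW s V ε u u := by positivity
  obtain ⟨t, ht0, htT, ht⟩ := S.exists_nehari_point hu.1 hQ (S.poissonE_nonneg hε hu.1) hT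
    (by linarith)
  exact ⟨t, ht0, htT, S.smul_mem_nehari hu hu0 ht0 ht⟩

end NehariManifold

/-! ### Existence of a minimiser -/

section Minimiser

variable {N : ℕ} {s α p θ ε V₀ μ R : ℝ} {f : ℝ → ℝ} {V : E N → ℝ}

/-- Splitting of the energy along a weakly convergent sequence. -/
lemma Setting.eventually_fiber_split (S : Setting N s α p f) (hV : Continuous V)
    (hV₀ : ∀ x, V₀ ≤ V x) (hpos : 0 < V₀) (hε : 0 < ε)
    (hout : ∀ x, R ≤ ‖x‖ → μ ≤ V (ε • x)) {u : L2 N} (hu : MemW s V ε u) {v : ℕ → L2 N}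
    (hvW : ∀ n, MemW s V ε (v n)) (hv : LocallyVanishing s v)
    (hweak : Tendsto (fun n => innerW s V ε u (v n)) atTop (𝓝 0)) (T : ℝ) {δ : ℝ} (hδ : 0 < δ) :
    ∀ᶠ n in atTop, (innerW s V ε u u + quad s μ (v n) - δ ≤ innerW s V ε (u + v n) (u + v n)) ∧
      ∀ t, 0 ≤ t → t ≤ T →
        fiber f (innerW s V ε u u) (poissonE α θ ε u) u t + fiber f (quad s μ (v n)) 0 (v n) t - δ ≤
          energy s α θ V f ε (t • (u + v n)) := by
  -- The quadratic and Poisson errors are multiplied by at most `T²` and `T⁴` along the ray; the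
  -- Poisson energy of `v n` is not kept at all.
  set δ' := δ / (2 + T ^ 2 + T ^ 4) with hδ'
  have hden : 0 < 2 + T ^ 2 + T ^ 4 := by positivity
  have hδ'0 : 0 < δ' := by positivity
  have hδe : δ' * (2 + T ^ 2 + T ^ 4) = δ := by rw [hδ']; field_simp
  have l1 : Tendsto (fun n => 2 * innerW s V ε u (v n) -
      μ * ∫ x in Metric.ball 0 R, (v n x) ^ 2) atTop (𝓝 0) := by
    simpa using (hweak.const_mul 2).sub ((hv.loc R).const_mul μ)
  filter_upwards [l1.eventually (lt_mem_nhds (neg_lt_zero.2 hδ'0)),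
    S.eventually_poissonE_le (θ := θ) hε hu.1 hv hδ'0, S.eventually_split hu.1 hv T hδ'0]
    with n h1 h2 h3
  have hsum : MemW s V ε (u + v n) := by
    simpa using hu.lin hV hV₀ hpos (hvW n) 1 1
  have h4 := quad_le_innerW_add hV₀ hpos hout (hvW n)
  have h5 := innerW_lin_lin hV hV₀ hpos hu (hvW n) 1 1
  simp only [one_smul, one_pow, mul_one, one_mul] at h5
  have h6 : innerW s V ε u u + quad s μ (v n) - δ' ≤ innerW s V ε (u + v n) (u + v n) := by
    linarith
  refine ⟨by nlinarith [sq_nonneg T, sq_nonneg (T ^ 2)], fun t ht0 htT => ?_⟩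
  have h7 := (abs_le.1 (h3 t ht0 htT)).2
  rw [S.energy_smul hsum.1]
  have t2 : t ^ 2 ≤ T ^ 2 := by gcongr
  have t4 : t ^ 4 ≤ T ^ 4 := by gcongr
  have t2' : 0 ≤ t ^ 2 := by positivity
  have t4' : 0 ≤ t ^ 4 := by positivity
  unfold fiber
  have a1 := mul_le_mul_of_nonneg_left h6 t2'
  have a2 := mul_le_mul_of_nonneg_left h2 t4'
  have a3 := mul_le_mul_of_nonneg_right t2 hδ'0.le
  have a4 := mul_le_mul_of_nonneg_right t4 hδ'0.le
  have a5 : 0 ≤ T ^ 2 * δ' := by positivity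
  have a6 : 0 ≤ T ^ 4 * δ' := by positivity
  rw [← hδe]
  linarith

/-- Bounded sequences in `W_ε` split into their weak limit and a locally vanishing part. -/
lemma exists_weak_decomposition (hs : 0 < s) (hV : Continuous V) (hV₀ : ∀ x, V₀ ≤ V x)
    (hpos : 0 < V₀) {U : ℕ → L2 N} (hUW : ∀ n, MemW s V ε (U n)) {B : ℝ}
    (hUQ : ∀ n, innerW s V ε (U n) (U n) ≤ B) :
    ∃ (u : L2 N) (v : ℕ → L2 N) (φ : ℕ → ℕ), StrictMono φ ∧ MemW s V ε u ∧
      (∀ n, u + v n = U (φ n)) ∧ (∀ n, MemW s V ε (v n)) ∧ LocallyVanishing s v ∧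
      Tendsto (fun n => innerW s V ε u (v n)) atTop (𝓝 0) := by
  obtain ⟨u, φ, hφ, huW, hw1, hw2⟩ := exists_weak_subseq_memW hV hV₀ hpos hUW hUQ
  set v : ℕ → L2 N := fun n => U (φ n) - u with hvdef
  have huv : ∀ n, u + v n = U (φ n) := fun n => by simp [hvdef]
  have hvW : ∀ n, MemW s V ε (v n) := fun n => by
    have := (hUW (φ n)).lin hV hV₀ hpos huW 1 (-1)
    simpa [hvdef, sub_eq_add_neg] using this
  have hbound : ∀ n, ‖v n‖ ≤ √(B / V₀) + ‖u‖ ∧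
      ‖fracLap (s / 2) (v n)‖ ≤ √B + ‖fracLap (s / 2) u‖ := fun n => by
    have h1 := (quad_le_innerW hV₀ (hUW (φ n))).trans (hUQ (φ n))
    rw [quad] at h1
    constructor
    · refine (norm_sub_le _ _).trans (add_le_add_left (Real.le_sqrt_of_sq_le ?_) _)
      rw [le_div_iff₀ hpos]
      nlinarith [sq_nonneg ‖fracLap (s / 2) (U (φ n))‖]
    · have h2 := fracLap_lin (hUW (φ n)).1 huW.1 1 (-1)
      have h3 : v n = (1 : ℝ) • U (φ n) + (-1 : ℝ) • u := by
        simp [hvdef, sub_eq_add_neg]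
      rw [h3, h2, one_smul, neg_one_smul, ← sub_eq_add_neg]
      refine (norm_sub_le _ _).trans (add_le_add_left (Real.le_sqrt_of_sq_le ?_) _)
      nlinarith [sq_nonneg ‖U (φ n)‖]
  set M := max (√(B / V₀) + ‖u‖) (√B + ‖fracLap (s / 2) u‖)
  have hv : LocallyVanishing s v := by
    refine ⟨fun n => (hvW n).1, ⟨M, fun n => ⟨(hbound n).1.trans (le_max_left _ _),
      (hbound n).2.trans (le_max_right _ _)⟩⟩, fun r => ?_⟩
    refine tendsto_setIntegral_sq_of_weak hs (fun n => (hvW n).1.hasFracLap) (fun ψ => ?_)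
      (fun n => (hbound n).1.trans (le_max_left _ _))
      (fun n => (hbound n).2.trans (le_max_right _ _)) r
    have := (hw1 ψ).sub_const (inner ℝ ψ u)
    simpa [hvdef, inner_sub_right] using this
  have hweak : Tendsto (fun n => innerW s V ε u (v n)) atTop (𝓝 0) := by
    have h1 := (hw2 u huW).sub_const (innerW s V ε u u)
    rw [sub_self] at h1
    refine h1.congr fun n => ?_
    have h2 := innerW_lin_left hV hV₀ hpos (hUW (φ n)) huW huW 1 (-1)
    have h3 : v n = (1 : ℝ) • U (φ n) + (-1 : ℝ) • u := by
      simp [hvdef, sub_eq_add_neg]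
    rw [h3, innerW_comm u (U (φ n)), innerW_comm u ((1 : ℝ) • _ + (-1 : ℝ) • _), h2]; ring
  exact ⟨u, v, φ, hφ, huW, huv, hvW, hv, hweak⟩

/-- The infimum over the Nehari manifold is attained if it lies below the level `m` of the
problem at infinity. -/
theorem Setting.exists_minimiser (S : Setting N s α p f) (hV : Continuous V)
    (hV₀ : ∀ x, V₀ ≤ V x) (hpos : 0 < V₀) (hε : 0 < ε) (hμ : 0 < μ)
    (hout : ∀ x, R ≤ ‖x‖ → μ ≤ V (ε • x)) {m c : ℝ}
    (hm : ∀ w : L2 N, MemHs s w → w ≠ 0 → quad s μ w = ∫ x, f (w x) * w x →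
      m ≤ fiber f (quad s μ w) 0 w 1)
    (hc : IsGLB (energy s α θ V f ε '' nehari s α θ V f ε) c) (hcm : c < m) :
    ∃ u ∈ nehari s α θ V f ε, energy s α θ V f ε u = c := by
  have hm' : ∀ (w : L2 N) (t : ℝ), MemHs s w → w ≠ 0 → 0 < t →
      t ^ 2 * quad s μ w + t ^ 4 * 0 = ∫ x, f (t * w x) * (t * w x) →
      m ≤ fiber f (quad s μ w) 0 w t := fun w t hw hw0 ht h => by
    have h1 := hm (t • w) (hw.smul t) (smul_ne_zero ht.ne' hw0) (by
      rw [quad_smul hw, integral_comp_smul_congr (fun y => f y * y) w t, ← h]; ring)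
    rwa [quad_smul hw, ← mul_zero (t ^ 4), fiber_smul] at h1
  have hlow : ∀ u ∈ nehari s α θ V f ε, c ≤ energy s α θ V f ε u := fun u hu =>
    hc.1 (mem_image_of_mem _ hu)
  -- a minimising sequence
  have hseq : ∀ n : ℕ, ∃ u ∈ nehari s α θ V f ε, energy s α θ V f ε u < c + 1 / ((n : ℝ) + 1) :=
    fun n => by
      obtain ⟨_, ⟨u, hu, rfl⟩, h⟩ := (isGLB_lt_iff hc).1
        (show c < c + 1 / ((n : ℝ) + 1) by linarith [Nat.one_div_pos_of_nat (α := ℝ) (n := n)])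
      exact ⟨u, hu, h⟩
  choose U hU hUe using hseq
  have hUW : ∀ n, MemW s V ε (U n) := fun n => (mem_nehari_iff.1 (hU n)).1
  have hUQ : ∀ n, innerW s V ε (U n) (U n) ≤ 4 * (c + 1) := fun n => by
    have h1 := S.quarter_innerW_le_energy (hU n)
    have h2 := hUe n
    have h3 : 1 / ((n : ℝ) + 1) ≤ 1 := by
      rw [div_le_one (by positivity)]; linarith [n.cast_nonneg (α := ℝ)]
    linarith
  obtain ⟨u, v, φ, hφ, huW, huv, hvW, hv, hweak⟩ :=
    exists_weak_decomposition S.s_pos hV hV₀ hpos hUW hUQ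
  have hsmall : Tendsto (fun n => c + 1 / ((φ n : ℝ) + 1)) atTop (𝓝 c) := by
    have h1 : Tendsto (fun n : ℕ => 1 / ((n : ℝ) + 1)) atTop (𝓝 0) :=
      tendsto_one_div_add_atTop_nhds_zero_nat
    have h2 := (h1.comp hφ.tendsto_atTop).const_add c
    rw [add_zero] at h2
    exact h2
  have hUt : ∀ (n : ℕ) (t : ℝ), 0 ≤ t → energy s α θ V f ε (t • (u + v n)) < c + 1 / ((φ n : ℝ) + 1) :=
    fun n t ht => by
      have h1 := S.energy_smul_le (u := U (φ n)) (t := t) hV₀ hpos (hU (φ n)) ht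
      rw [huv]
      exact lt_of_le_of_lt h1 (hUe (φ n))
  -- no mass is lost at infinity
  have hcontra : ∀ T : ℝ, 0 < T →
      (∀ t, 0 ≤ t → t ≤ T → 0 ≤ fiber f (innerW s V ε u u) (poissonE α θ ε u) u t) →
      (∀ᶠ n in atTop, v n ≠ 0 ∧
        T ^ 2 * quad s μ (v n) + T ^ 4 * 0 - ∫ x, f (T * v n x) * (T * v n x) < 0) → False := by
    intro T hT hfib hneg
    have hδ : 0 < (m - c) / 2 := by linarith
    obtain ⟨n, ⟨h1, h2⟩, ⟨-, h3⟩, h4⟩ := (hneg.and ((S.eventually_fiber_split (θ := θ) hV hV₀ hpos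
      hε hout huW hvW hv hweak T hδ).and
      (hsmall.eventually (gt_mem_nhds (show c < (m + c) / 2 by linarith))))).exists
    -- At this `t` the autonomous energy of `t v_n` is at least `m` and the energy of `t u` is
    -- nonnegative, so the splitting gives energy at least `(m + c)/2` on the ray of `U (φ n)`,
    -- where it is smaller than that.
    obtain ⟨t, ht0, htT, ht⟩ := S.exists_nehari_point (hvW n).1 (quad_pos hμ h1) le_rfl hT h2
    have h5 := hm' _ t (hvW n).1 h1 ht0 ht
    have h6 := h3 t ht0.le htT.le
    have h7 := hUt n t ht0.le
    have h8 := hfib t ht0.le htT.le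
    linarith
  have hu0Q := innerW_nonneg hV₀ hpos huW
  have hD := S.poissonE_nonneg (θ := θ) hε huW.1
  -- A nonpositive weak limit contributes nothing to `∫ F`, so its ray has nonnegative energy and
  -- the nonlinear mass is carried by `v n`.
  by_cases hneg : ∀ᵐ x, u x ≤ 0
  · exfalso
    have hP : ∀ t, 0 ≤ t → ∫ x, primitive f (t * u x) = 0 := fun t ht => by
      apply integral_eq_zero_of_ae
      filter_upwards [hneg] with x hx
      exact S.nl.primitive_eq_zero (mul_nonpos_of_nonneg_of_nonpos ht hx)
    -- Here `quad s μ (v n) ≤ ∫ f(v n) v n + ρ ≤ 2 ∫ f(v n) v n`, as the Nehari bound `ρ` is itself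
    -- below that integral. Doubling multiplies the nonlinear term by at least `16` and the
    -- quadratic one by `4`, which gives the negative sign.
    refine hcontra 2 two_pos (fun t ht _ => by
      rw [fiber, hP t ht, sub_zero]
      exact add_nonneg (mul_nonneg (by norm_num) (mul_nonneg (sq_nonneg t) hu0Q))
        (mul_nonneg (by norm_num) (mul_nonneg (by positivity) hD))) ?_
    obtain ⟨ρ, hρ, hρl⟩ := S.exists_quad_lower hpos
    filter_upwards [S.eventually_fiber_split (θ := θ) hV hV₀ hpos hε hout huW hvW hv hweak 2 hρ]
      with n ⟨h1, _⟩
    rw [huv] at h1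
    obtain ⟨k1, k2, k3⟩ := mem_nehari_iff.1 (hU (φ n))
    have hDn := S.poissonE_nonneg (θ := θ) hε k1.1
    have h2 : ∫ x, f (U (φ n) x) * U (φ n) x ≤ ∫ x, f (v n x) * v n x := by
      refine integral_mono_ae (S.integrable_mul_self k1.1) (S.integrable_mul_self (hvW n).1) ?_
      rw [← huv]
      filter_upwards [hneg, Lp.coeFn_add u (v n)] with x hx1 hx2
      apply S.nl.mul_self_mono
      rw [hx2, Pi.add_apply]; linarith
    have h3 := quad_le_innerW hV₀ k1
    have h4 := hρl _ k1.1 k2 (by linarith)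
    have h5 := S.scale_integral_ge (hvW n).1 one_le_two
    refine ⟨fun h0 => ?_, by linarith⟩
    have : ∫ x, f (v n x) * v n x = 0 := by
      apply integral_eq_zero_of_ae
      rw [h0]
      refine ae_of_all _ fun x => ?_
      simp
    linarith
  · have hu0 : u ≠ 0 := by
      rintro rfl
      refine hneg ?_
      refine ae_of_all _ fun x => ?_
      simp
    obtain ⟨T, hT, hTneg⟩ := S.exists_fiber_neg huW.1 (innerW s V ε u u) (poissonE α θ ε u)
      (S.integral_primitive_pos huW.1 hneg)
    have h1 := S.quarter_le_fiber huW.1 (innerW s V ε u u) (poissonE α θ ε u) T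
    have h2 : 0 ≤ T ^ 2 * innerW s V ε u u := by positivity
    obtain ⟨t₀, ht₀, -, ht⟩ := S.exists_nehari_point huW.1 (innerW_pos hV₀ hpos huW hu0) hD hT
      (by linarith)
    have hmem := S.smul_mem_nehari huW hu0 ht₀ ht
    refine ⟨t₀ • u, hmem, le_antisymm ?_ (hlow _ hmem)⟩
    rw [S.energy_smul huW.1]
    -- If the Nehari point of `u` had energy above `c`, the splitting at `t₀` would leave negative
    -- autonomous energy for `t₀ v_n`. Then `v n` has an autonomous Nehari point before `t₀`, where
    -- the energy of `t u` is nonnegative.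
    by_contra hlt
    push Not at hlt
    set e := fiber f (innerW s V ε u u) (poissonE α θ ε u) u t₀
    have hδ : 0 < (e - c) / 2 := by linarith
    refine hcontra t₀ ht₀ (fun t ht1 ht2 => S.fiber_nonneg huW.1 hu0Q ht₀ ht ht1 ht2) ?_
    filter_upwards [S.eventually_fiber_split (θ := θ) hV hV₀ hpos hε hout huW hvW hv hweak t₀ hδ,
      hsmall.eventually (gt_mem_nhds (show c < (e + c) / 2 by linarith))] with n ⟨_, h3⟩ h4
    have h5 := h3 t₀ ht₀.le le_rfl
    have h6 := hUt n t₀ ht₀.le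
    have h7 : fiber f (quad s μ (v n)) 0 (v n) t₀ < 0 := by linarith
    have h8 := S.quarter_le_fiber (hvW n).1 (quad s μ (v n)) 0 t₀
    have h9 : 0 ≤ t₀ ^ 2 * quad s μ (v n) := mul_nonneg (sq_nonneg _) (quad_nonneg hμ.le _)
    refine ⟨fun h0 => ?_, by linarith⟩
    have : ∫ x, primitive f (t₀ * v n x) = 0 := by
      apply integral_eq_zero_of_ae
      rw [h0]
      refine ae_of_all _ fun x => ?_
      simp [S.nl.primitive_eq_zero le_rfl]
    rw [fiber, this] at h7
    linarith

end Minimiser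

/-! ### Minimisers on the Nehari manifold are weak solutions -/

section WeakSolution

variable {N : ℕ} {s α p θ ε V₀ : ℝ} {f : ℝ → ℝ} {V : E N → ℝ}

namespace Nonlinearity

/-- On the positive axis `f` is the product of the increasing functions `f(t)/t³` and `t³`.
Monotonicity makes `F` convex. -/
lemma monotone (hf : Nonlinearity f p) : Monotone f := fun x y hxy => by
  rcases le_or_gt x 0 with hx | hx
  · rw [hf.eq_zero x hx]; exact hf.nonneg y
  · have hy := hx.trans_le hxy
    have h1 := hf.mono.monotoneOn (mem_Ioi.2 hx) (mem_Ioi.2 hy) hxy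
    have hx3 : 0 < x ^ 3 := by positivity
    have hy3 : 0 < y ^ 3 := by positivity
    calc f x = f x / x ^ 3 * x ^ 3 := (div_mul_cancel₀ _ hx3.ne').symm
      _ ≤ f y / y ^ 3 * y ^ 3 := by
        have := div_nonneg (hf.nonneg x) hx3.le
        gcongr
        exact this.trans h1
      _ = f y := div_mul_cancel₀ _ hy3.ne'

/-- Convexity of the primitive. -/
lemma primitive_tangent_le (hf : Nonlinearity f p) (x y : ℝ) :
    primitive f x + f x * (y - x) ≤ primitive f y := by
  rcases lt_trichotomy x y with h | rfl | h
  · obtain ⟨c, hc, e⟩ := exists_hasDerivAt_eq_slope (primitive f) f h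
      hf.continuous_primitive.continuousOn fun t _ => hf.hasDerivAt t
    rw [eq_div_iff (by linarith)] at e
    have := mul_le_mul_of_nonneg_right (hf.monotone hc.1.le) (sub_nonneg.2 h.le)
    linarith
  · simp
  · obtain ⟨c, hc, e⟩ := exists_hasDerivAt_eq_slope (primitive f) f h
      hf.continuous_primitive.continuousOn fun t _ => hf.hasDerivAt t
    rw [eq_div_iff (by linarith)] at e
    have := mul_le_mul_of_nonneg_right (hf.monotone hc.2.le) (sub_nonneg.2 h.le)
    linarith

end Nonlinearity

/-- Continuity of `(a, b) ↦ ∫ f(au + bv) z`. -/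
lemma Setting.continuous_integral_lin (S : Setting N s α p f) {u v z : L2 N} (hu : MemHs s u)
    (hv : MemHs s v) (hz : MemHs s z) :
    Continuous fun q : ℝ × ℝ => ∫ x, f (q.1 * u x + q.2 * v x) * z x := by
  obtain ⟨C, hC, hb⟩ := S.nl.exists_gauge_bound
  have hp := S.nl.four_lt
  refine continuous_iff_continuousAt.2 fun q₀ => ?_
  set T : ℝ := 2 * (|q₀.1| + |q₀.2| + 1)
  have hT1 : 1 ≤ T := by
    have := abs_nonneg q₀.1
    have := abs_nonneg q₀.2
    linarith
  refine continuousAt_of_dominated (bound := fun x =>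
    C * (T ^ p * (gauge2 p (u x) + gauge2 p (v x)) + gauge2 p (z x))) ?_ ?_ ?_ ?_
  · exact Eventually.of_forall fun q => ((S.nl.cont.measurable.comp
      (((measurable_coe u).const_mul _).add ((measurable_coe v).const_mul _))).mul
      (measurable_coe z)).aestronglyMeasurable
  · have h1 : ∀ᶠ q : ℝ × ℝ in 𝓝 q₀, |q.1| < |q₀.1| + 1 :=
      (continuous_fst.abs.tendsto q₀).eventually (gt_mem_nhds (by linarith))
    have h2 : ∀ᶠ q : ℝ × ℝ in 𝓝 q₀, |q.2| < |q₀.2| + 1 :=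
      (continuous_snd.abs.tendsto q₀).eventually (gt_mem_nhds (by linarith))
    filter_upwards [h1, h2] with q k1 k2
    refine ae_of_all _ fun x => ?_
    rw [norm_mul, Real.norm_of_nonneg (S.nl.nonneg _), Real.norm_eq_abs]
    refine (hb _ _).trans ?_
    gcongr
    have e1 : |q.1 * u x + q.2 * v x| ≤ T * max |u x| |v x| := by
      calc |q.1 * u x + q.2 * v x| ≤ |q.1| * |u x| + |q.2| * |v x| := by
            rw [← abs_mul, ← abs_mul]; exact abs_add_le _ _
        _ ≤ (|q₀.1| + 1) * max |u x| |v x| + (|q₀.2| + 1) * max |u x| |v x| := by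
            gcongr
            · exact le_max_left _ _
            · exact le_max_right _ _
        _ ≤ _ := by
            have : 0 ≤ max |u x| |v x| := (abs_nonneg _).trans (le_max_left _ _)
            have := abs_nonneg q₀.1
            have := abs_nonneg q₀.2
            nlinarith
    have e2 : gauge2 p (q.1 * u x + q.2 * v x) ≤ gauge2 p (T * max |u x| |v x|) := by
      refine gauge2_mono hp (e1.trans (le_abs_self _))
    refine e2.trans ((gauge2_mul_le hp hT1 _).trans ?_)
    gcongr
    have ha := gauge2_nonneg p (u x)
    have hb := gauge2_nonneg p (v x)
    rcases max_choice |u x| |v x| with e | e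
    · have := gauge2_mono (s := |u x|) (t := u x) hp (by simp)
      rw [e]; linarith
    · have := gauge2_mono (s := |v x|) (t := v x) hp (by simp)
      rw [e]; linarith
  · exact ((((S.integrable_gauge hu).add (S.integrable_gauge hv)).const_mul _).add
      (S.integrable_gauge hz)).const_mul _
  · refine ae_of_all _ fun x => Continuous.continuousAt ?_
    have := S.nl.cont
    fun_prop

set_option maxHeartbeats 800000 in
/-- A minimiser on the Nehari manifold has no descent direction. -/
lemma Setting.nonneg_of_isLeast (S : Setting N s α p f) (hV : Continuous V)
    (hV₀ : ∀ x, V₀ ≤ V x) (hpos : 0 < V₀) {u : L2 N} (hu : u ∈ nehari s α θ V f ε)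
    (hmin : ∀ w ∈ nehari s α θ V f ε, energy s α θ V f ε u ≤ energy s α θ V f ε w)
    {v : L2 N} (hv : MemW s V ε v) :
    0 ≤ innerW s V ε u v + (∫ x, phi α θ ε u x * u x * v x) - ∫ x, f (u x) * v x := by
  obtain ⟨huW, hu0, huN⟩ := mem_nehari_iff.1 hu
  obtain ⟨g₁, g₂, g₃, hP⟩ := S.exists_poissonE_lin θ ε huW.1 hv.1
  set κ := coef N α θ ε
  have hPE : ∀ a b : ℝ, poissonE α θ ε (a • u + b • v) =
      κ * (a ^ 4 * inner ℝ g₁ g₁ + 4 * a ^ 3 * b * inner ℝ g₁ g₂ +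
        b ^ 2 * (2 * a ^ 2 * inner ℝ g₁ g₃ + 4 * a ^ 2 * inner ℝ g₂ g₂ +
          4 * a * b * inner ℝ g₂ g₃ + b ^ 2 * inner ℝ g₃ g₃)) := fun a b => by
    rw [(hP a b).1, ← real_inner_self_eq_norm_sq]
    simp only [inner_add_left, inner_add_right, real_inner_smul_left, real_inner_smul_right,
      real_inner_comm g₁ g₂, real_inner_comm g₁ g₃, real_inner_comm g₂ g₃]
    ring
  have hphi : ∫ x, phi α θ ε u x * u x * v x = κ * inner ℝ g₁ g₂ := by
    have h := (hP 1 0).2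
    simpa using h
  by_contra hneg
  push Not at hneg
  rw [hphi] at hneg
  set H : L2 N → ℝ × ℝ → ℝ := fun z q => ∫ x, f (q.1 * u x + q.2 * v x) * z x with hH
  have hHu : Continuous (H u) := S.continuous_integral_lin huW.1 hv.1 huW.1
  have hHv : Continuous (H v) := S.continuous_integral_lin huW.1 hv.1 hv.1
  have hlinW : ∀ a b : ℝ, MemW s V ε (a • u + b • v) := fun a b => huW.lin hV hV₀ hpos hv a b
  -- `J (a, b)` is the Nehari constraint at `w = au + bv`, that is `I_ε'(w)[w]`, written so that
  -- continuity in `(a, b)` is evident.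
  set J : ℝ × ℝ → ℝ := fun q => q.1 ^ 2 * innerW s V ε u u + 2 * q.1 * q.2 * innerW s V ε u v +
    q.2 ^ 2 * innerW s V ε v v +
    κ * (q.1 ^ 4 * inner ℝ g₁ g₁ + 4 * q.1 ^ 3 * q.2 * inner ℝ g₁ g₂ +
        q.2 ^ 2 * (2 * q.1 ^ 2 * inner ℝ g₁ g₃ + 4 * q.1 ^ 2 * inner ℝ g₂ g₂ +
          4 * q.1 * q.2 * inner ℝ g₂ g₃ + q.2 ^ 2 * inner ℝ g₃ g₃)) -
    (q.1 * H u q + q.2 * H v q) with hJ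
  have hJc : Continuous J := by fun_prop
  have hJe : ∀ a b : ℝ, J (a, b) = innerW s V ε (a • u + b • v) (a • u + b • v) +
      poissonE α θ ε (a • u + b • v) -
      ∫ x, f ((a • u + b • v : L2 N) x) * (a • u + b • v : L2 N) x := fun a b => by
    have h1 : ∫ x, f ((a • u + b • v : L2 N) x) * (a • u + b • v : L2 N) x =
        a * H u (a, b) + b * H v (a, b) := by
      have e1 : Integrable fun x => f (a * u x + b * v x) * u x := by
        refine (S.integrable_mul (hlinW a b).1 huW.1).congr ?_
        filter_upwards [coeFn_lin u v a b] with x hx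
        rw [hx]
      have e2 : Integrable fun x => f (a * u x + b * v x) * v x := by
        refine (S.integrable_mul (hlinW a b).1 hv.1).congr ?_
        filter_upwards [coeFn_lin u v a b] with x hx
        rw [hx]
      simp only [hH]
      rw [← integral_const_mul, ← integral_const_mul,
        ← integral_add (e1.const_mul a) (e2.const_mul b)]
      apply integral_congr_ae
      filter_upwards [coeFn_lin u v a b] with x hx
      rw [hx]; ring
    rw [h1, innerW_lin_lin hV hV₀ hpos huW hv, hPE]
  -- `b * B (a, b)` bounds the increment of the energy from `au` to `au + bv`: the polynomial parts
  -- are exact, and `F` is replaced by its tangent using convexity. At `(1, 0)` it equals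
  -- `I_ε'(u)[v]`, assumed negative.
  set B : ℝ × ℝ → ℝ := fun q => q.1 * innerW s V ε u v + 1 / 2 * q.2 * innerW s V ε v v +
    κ * (q.1 ^ 3 * inner ℝ g₁ g₂ + 1 / 4 * q.2 * (2 * q.1 ^ 2 * inner ℝ g₁ g₃ +
      4 * q.1 ^ 2 * inner ℝ g₂ g₂ + 4 * q.1 * q.2 * inner ℝ g₂ g₃ + q.2 ^ 2 * inner ℝ g₃ g₃)) -
    H v (q.1, 0) with hB
  have hBc : Continuous B := by fun_prop
  have hBe : ∀ a b : ℝ, energy s α θ V f ε (a • u + b • v) ≤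
      energy s α θ V f ε (a • u) + b * B (a, b) := fun a b => by
    have h0 := hPE a b
    have h1 := hPE a 0
    have h2 := innerW_lin_lin (ε := ε) hV hV₀ hpos huW hv a b
    have h3 := innerW_smul_smul (V := V) (ε := ε) huW.1 a
    simp only [zero_smul, add_zero] at h1
    have i0 : Integrable fun x => f (a * u x) * v x := by
      refine (S.integrable_mul (huW.1.smul a) hv.1).congr ?_
      filter_upwards [coeFn_smul' u a] with x hx
      rw [hx]
    have h4 : (∫ x, primitive f ((a • u : L2 N) x)) + b * H v (a, 0) ≤
        ∫ x, primitive f ((a • u + b • v : L2 N) x) := by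
      simp only [hH, zero_mul, add_zero]
      rw [← integral_const_mul, ← integral_add (S.integrable_primitive (huW.1.smul a))
        (i0.const_mul b)]
      refine integral_mono_ae ((S.integrable_primitive (huW.1.smul a)).add (i0.const_mul b))
        (S.integrable_primitive (hlinW a b).1) ?_
      filter_upwards [coeFn_lin u v a b, coeFn_smul' u a] with x hx1 hx2
      rw [hx1, hx2]
      have := S.nl.primitive_tangent_le (a * u x) (a * u x + b * v x)
      linarith
    simp only [energy]
    change 1 / 2 * _ + 1 / 4 * poissonE α θ ε (a • u + b • v) - _ ≤
      1 / 2 * _ + 1 / 4 * poissonE α θ ε (a • u) - _ + _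
    rw [h0, h1, h2, h3]
    simp only [hB]
    linarith
  -- sign conditions near `(1, 0)`
  have hB0 : B (1, 0) < 0 := by
    simp only [hB, hH]
    simpa using hneg
  obtain ⟨δ, hδ, hδB⟩ := Metric.eventually_nhds_iff.1
    (hBc.continuousAt.eventually (gt_mem_nhds hB0))
  -- `η < δ` keeps `a` where `B < 0`, and `η ≤ 1/2` keeps `a` away from `0`, so that `au + rv`
  -- cannot vanish for small `r`.
  set η := min (δ / 2) (1 / 2) with hη
  have hη0 : 0 < η := by positivity
  have hη1 : η ≤ 1 / 2 := min_le_right _ _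
  have hηδ : η < δ := (min_le_left _ _).trans_lt (by linarith)
  have hQ := innerW_pos hV₀ hpos huW hu0
  have hJray : ∀ t : ℝ, J (t, 0) = t ^ 2 * innerW s V ε u u + t ^ 4 * poissonE α θ ε u -
      ∫ x, f (t * u x) * (t * u x) := fun t => by
    rw [hJe t 0, zero_smul, add_zero, innerW_smul_smul huW.1, S.poissonE_smul huW.1]
    congr 1
    exact integral_comp_smul_congr (fun y => f y * y) u t
  have hJ1 : 0 < J (1 - η, 0) := by
    rw [hJray]
    have h1 := S.scale_integral_le huW.1 (t := 1 - η) (by linarith) (by linarith)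
    rw [← huN] at h1
    have h2 : (1 - η) ^ 2 < 1 := pow_lt_one₀ (by linarith) (by linarith) two_ne_zero
    have h3 : 0 < (1 - η) ^ 2 := pow_pos (by linarith) 2
    have h4 : 0 < (1 - (1 - η) ^ 2) * ((1 - η) ^ 2 * innerW s V ε u u) :=
      mul_pos (by linarith) (by positivity)
    nlinarith
  have hJ2 : J (1 + η, 0) < 0 := by
    rw [hJray]
    have h1 := S.scale_integral_ge huW.1 (t := 1 + η) (by linarith)
    rw [← huN] at h1
    have h2 : 1 < (1 + η) ^ 2 := one_lt_pow₀ (by linarith) two_ne_zero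
    have h4 : 0 < ((1 + η) ^ 2 - 1) * ((1 + η) ^ 2 * innerW s V ε u u) :=
      mul_pos (by linarith) (by positivity)
    nlinarith
  have hr : ∀ᶠ r : ℝ in 𝓝[>] 0, 0 < J (1 - η, r) ∧ J (1 + η, r) < 0 ∧ r * ‖v‖ < 1 / 2 * ‖u‖ ∧
      r < η := by
    have c1 : Continuous fun r : ℝ => J (1 - η, r) := by fun_prop
    have c2 : Continuous fun r : ℝ => J (1 + η, r) := by fun_prop
    have c3 : Continuous fun r : ℝ => r * ‖v‖ := by fun_prop
    have hun : 0 < ‖u‖ := norm_pos_iff.2 hu0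
    refine nhdsWithin_le_nhds ?_
    filter_upwards [(c1.tendsto 0).eventually (lt_mem_nhds hJ1),
      (c2.tendsto 0).eventually (gt_mem_nhds hJ2),
      (c3.tendsto 0).eventually (gt_mem_nhds (show 0 * ‖v‖ < 1 / 2 * ‖u‖ by rw [zero_mul]; positivity)),
      gt_mem_nhds hη0] with r k1 k2 k3 k4
    exact ⟨k1, k2, k3, k4⟩
  obtain ⟨r, ⟨k1, k2, k3, k4⟩, hr0⟩ := (hr.and self_mem_nhdsWithin).exists
  have hr0 : 0 < r := hr0
  have c1 : ContinuousOn (fun a : ℝ => J (a, r)) (Icc (1 - η) (1 + η)) := by fun_prop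
  -- The sign change of `J` across `a = 1` persists for small `r`, so `rv` can be corrected by a
  -- multiple of `u` to return to the Nehari manifold. The energy there is below that of `au`, hence
  -- below that of `u`.
  obtain ⟨a, ha, hJa⟩ := intermediate_value_Ioo' (by linarith) c1 ⟨k2, k1⟩
  simp only at hJa
  have hw0 : a • u + r • v ≠ 0 := fun h0 => by
    have h1 : a • u = -(r • v) := eq_neg_of_add_eq_zero_left h0
    have h2 : |a| * ‖u‖ = r * ‖v‖ := by
      have := congrArg norm h1
      rwa [norm_neg, norm_smul, norm_smul, Real.norm_eq_abs, Real.norm_eq_abs,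
        abs_of_pos hr0] at this
    have h3 : 1 / 2 ≤ |a| := le_trans (by linarith [ha.1]) (le_abs_self a)
    have := mul_le_mul_of_nonneg_right h3 (norm_nonneg u)
    linarith
  have hw : a • u + r • v ∈ nehari s α θ V f ε :=
    mem_nehari_iff.2 ⟨hlinW a r, hw0, by rw [hJe] at hJa; linarith⟩
  have h1 := hmin _ hw
  have h2 := hBe a r
  have h3 := S.energy_smul_le hV₀ hpos hu (t := a) (by linarith [ha.1])
  have h4 : B (a, r) < 0 := by
    apply hδB
    rw [Prod.dist_eq, max_lt_iff, Real.dist_eq, Real.dist_eq]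
    constructor
    · change |a - 1| < δ
      rw [abs_lt]
      exact ⟨by linarith [ha.1], by linarith [ha.2]⟩
    · change |r - 0| < δ
      rw [abs_lt]
      exact ⟨by linarith, by linarith⟩
  have h5 : r * B (a, r) < 0 := mul_neg_of_pos_of_neg hr0 h4
  linarith

lemma MemW.neg {v : L2 N} (hv : MemW s V ε v) : MemW s V ε (-v) := by
  simpa using hv.smul (-1)

/-- Minimisers of the energy on the Nehari manifold are ground states. -/
theorem Setting.isGroundState (S : Setting N s α p f) (hV : Continuous V)
    (hV₀ : ∀ x, V₀ ≤ V x) (hpos : 0 < V₀) {u : L2 N} (hu : u ∈ nehari s α θ V f ε)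
    (hmin : ∀ w ∈ nehari s α θ V f ε, energy s α θ V f ε u ≤ energy s α θ V f ε w) :
    IsGroundState s α θ V f ε u := by
  obtain ⟨huW, hu0, huN⟩ := mem_nehari_iff.1 hu
  refine ⟨hu0, ⟨huW, fun v hv => ?_, S.isPoissonSol huW.1⟩, mem_image_of_mem _ hu, ?_⟩
  · have h1 := S.nonneg_of_isLeast hV hV₀ hpos hu hmin hv
    have h2 := S.nonneg_of_isLeast hV hV₀ hpos hu hmin hv.neg
    have e0 := innerW_lin_left hV hV₀ hpos hv hv huW (-1) 0
    have e1 : innerW s V ε u (-v) = -innerW s V ε u v := by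
      rw [innerW_comm, innerW_comm u]; simpa using e0
    have e2 : ∫ x, phi α θ ε u x * u x * (-v : L2 N) x = -∫ x, phi α θ ε u x * u x * v x := by
      rw [← integral_neg]
      apply integral_congr_ae
      filter_upwards [Lp.coeFn_neg v] with x hx
      rw [hx, Pi.neg_apply]; ring
    have e3 : ∫ x, f (u x) * (-v : L2 N) x = -∫ x, f (u x) * v x := by
      rw [← integral_neg]
      apply integral_congr_ae
      filter_upwards [Lp.coeFn_neg v] with x hx
      rw [hx, Pi.neg_apply]; ring
    rw [e1, e2, e3] at h2
    linarith
  · rintro _ ⟨w, hw, rfl⟩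
    exact hmin w hw

end WeakSolution

/-! ### Comparison of energy levels -/

section Levels

variable {N : ℕ} {s α p θ ε V₀ : ℝ} {f : ℝ → ℝ} {V : E N → ℝ}

lemma Setting.quarter_quad_le_fiber (S : Setting N s α p f) {μ : ℝ} {w : L2 N} (hw : MemHs s w)
    (h : quad s μ w = ∫ x, f (w x) * w x) :
    1 / 4 * quad s μ w ≤ fiber f (quad s μ w) 0 w 1 := by
  have := S.quarter_le_fiber hw (quad s μ w) 0 1
  simp only [one_pow, one_mul, mul_zero, add_zero, ← h, sub_self, zero_add] at this
  exact this

/-- The levels of the autonomous problems tend to infinity with the potential. -/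
lemma Setting.exists_level_ge (S : Setting N s α p f) (M : ℝ) : ∃ μ : ℝ, 0 < μ ∧
    ∀ w : L2 N, MemHs s w → w ≠ 0 → quad s μ w = ∫ x, f (w x) * w x →
      M ≤ fiber f (quad s μ w) 0 w 1 := by
  obtain ⟨μ, hμ, h⟩ := S.exists_level_large (M := 4 * (|M| + 1)) (by positivity)
  refine ⟨μ, hμ, fun w hw hw0 hN => ?_⟩
  have h1 := h w hw hw0 hN.le
  have h2 := S.quarter_quad_le_fiber hw hN
  linarith [le_abs_self M]

/-- The levels of the autonomous problems are strictly increasing in the potential. -/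
lemma Setting.exists_level_gap (S : Setting N s α p f) (hpos : 0 < V₀) {μ : ℝ} (hμ : V₀ < μ)
    {m : ℝ} (hm : ∀ w : L2 N, MemHs s w → w ≠ 0 → quad s V₀ w = ∫ x, f (w x) * w x →
      m ≤ fiber f (quad s V₀ w) 0 w 1) :
    ∃ d : ℝ, 0 < d ∧ ∀ w : L2 N, MemHs s w → w ≠ 0 → quad s μ w = ∫ x, f (w x) * w x →
      m + d ≤ fiber f (quad s μ w) 0 w 1 := by
  obtain ⟨c, hc, hlow⟩ := S.exists_norm_lower hpos (M := 4 * (|m| + 1)) (by positivity)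
  have hμ' : 0 < μ - V₀ := by linarith
  -- `c` bounds the squared `L²` norm from below on the bounded part of the Nehari set for `V₀`, so
  -- raising the potential adds at least `(μ - V₀)c/2`. The bound `1` on the gap keeps competitors
  -- in that bounded part.
  refine ⟨min 1 (1 / 2 * ((μ - V₀) * c)), by positivity, fun w hw hw0 hN => ?_⟩
  by_contra hlt
  push Not at hlt
  have h1 : fiber f (quad s μ w) 0 w 1 < m + 1 := hlt.trans_le (by gcongr; exact min_le_left _ _)
  have h2 := S.quarter_quad_le_fiber hw hN
  have hn : 0 < ‖w‖ := norm_pos_iff.2 hw0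
  have hq : quad s μ w = quad s V₀ w + (μ - V₀) * ‖w‖ ^ 2 := by unfold quad; ring
  have hn2 : 0 < (μ - V₀) * ‖w‖ ^ 2 := by positivity
  have hQ := quad_pos (s := s) hpos hw0
  -- Lowering the potential moves the Nehari point to some `t < 1`. The energy for `μ` at `w`
  -- dominates that at `tw`, which is the energy for `V₀` plus the gain from the `L²` norm.
  obtain ⟨t, ht0, ht1, ht⟩ := S.exists_nehari_point (D := 0) (T := 1) hw hQ le_rfl one_pos (by
    simp only [one_pow, one_mul, mul_zero, add_zero, ← hN]; linarith)
  have ht' : quad s V₀ (t • w) = ∫ x, f ((t • w : L2 N) x) * (t • w : L2 N) x := by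
    rw [quad_smul hw, integral_comp_smul_congr (fun y => f y * y) w t, ← ht]; ring
  have hne : t • w ≠ 0 := smul_ne_zero ht0.ne' hw0
  have ht2 : t ^ 2 ≤ 1 := pow_le_one₀ ht0.le ht1.le
  have h3 := hm _ (hw.smul t) hne ht'
  have h4 := hlow _ (hw.smul t) hne ht'.le (by
    rw [quad_smul hw]
    have : t ^ 2 * quad s V₀ w ≤ 1 * quad s V₀ w := by gcongr
    linarith [le_abs_self m])
  rw [quad_smul hw, ← mul_zero (t ^ 4), fiber_smul] at h3
  rw [norm_smul, Real.norm_eq_abs, mul_pow, sq_abs] at h4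
  have h5 := S.fiber_le (D := 0) hw (quad_nonneg (hpos.trans hμ).le w) (by rw [hN, add_zero]) ht0.le
  have h6 : fiber f (quad s μ w) 0 w t = fiber f (quad s V₀ w) 0 w t +
      1 / 2 * ((μ - V₀) * (t ^ 2 * ‖w‖ ^ 2)) := by
    rw [hq]; unfold fiber; ring
  have h7 : (μ - V₀) * c ≤ (μ - V₀) * (t ^ 2 * ‖w‖ ^ 2) := by gcongr
  have h8 := min_le_right 1 (1 / 2 * ((μ - V₀) * c))
  linarith

lemma IsTest.memW (hs : 0 < s) (hV : Continuous V) {w : L2 N} (hw : IsTest w) : MemW s V ε w := by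
  refine ⟨hw.exists_hasFracLap (by positivity), ?_⟩
  obtain ⟨η, h1, h2, h3⟩ := hw
  have h4 : Integrable fun x => V (ε • x) * (η x) ^ 2 := by
    apply Continuous.integrable_of_hasCompactSupport
    · have := h1.continuous
      fun_prop
    · exact HasCompactSupport.mul_left (h2.comp_left (g := fun y => y ^ 2) (by simp))
  refine h4.congr ?_
  filter_upwards [h3] with x hx
  rw [hx]

/-- There is a test function that is positive somewhere. -/
lemma Setting.exists_test_primitive_pos (S : Setting N s α p f) :
    ∃ w : L2 N, IsTest w ∧ 0 < ∫ x, primitive f (w x) := by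
  let b : ContDiffBump (0 : E N) := ⟨1, 2, one_pos, one_lt_two⟩
  have h1 : ContDiff ℝ ∞ b := b.contDiff
  have h2 : HasCompactSupport b := b.hasCompactSupport
  have ht := isTest_testLp h1 h2
  refine ⟨testLp h1 h2, ht, S.integral_primitive_pos
    (ht.exists_hasFracLap (by linarith [S.s_pos])) fun hn => ?_⟩
  have h3 : ∀ᵐ x : E N, b x ≤ 0 := by
    filter_upwards [hn, coeFn_testLp h1 h2] with x k1 k2
    rwa [← k2]
  have hopen : IsOpen {x : E N | 0 < b x} := isOpen_lt continuous_const h1.continuous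
  have hpos : 0 < volume {x : E N | 0 < b x} :=
    hopen.measure_pos _ ⟨0, by
      change 0 < b 0
      rw [b.one_of_mem_closedBall (by simp [b])]; exact one_pos⟩
  rw [ae_iff] at h3
  simp only [not_le] at h3
  exact hpos.ne' h3

lemma Setting.nehari_nonempty (S : Setting N s α p f) (hV : Continuous V) (hV₀ : ∀ x, V₀ ≤ V x)
    (hpos : 0 < V₀) (hε : 0 < ε) : (nehari s α θ V f ε).Nonempty := by
  obtain ⟨w, hw, hwp⟩ := S.exists_test_primitive_pos
  have hW : MemW s V ε w := hw.memW S.s_pos hV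
  obtain ⟨T, hT, hTn⟩ := S.exists_fiber_neg hW.1 (innerW s V ε w w) (poissonE α θ ε w) hwp
  rw [← S.energy_smul hW.1] at hTn
  obtain ⟨t, -, -, ht⟩ := S.exists_smul_mem_nehari hV₀ hpos hε hW hT hTn
  exact ⟨_, ht⟩

lemma Setting.exists_quad_eq (S : Setting N s α p f) (hpos : 0 < V₀) :
    ∃ w : L2 N, MemHs s w ∧ w ≠ 0 ∧ quad s V₀ w = ∫ x, f (w x) * w x := by
  obtain ⟨w, hw, hwp⟩ := S.exists_test_primitive_pos
  have hH : MemHs s w := hw.exists_hasFracLap (by linarith [S.s_pos])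
  have hw0 : w ≠ 0 := by
    rintro rfl
    have : ∫ x, primitive f ((0 : L2 N) x) = 0 := by
      apply integral_eq_zero_of_ae
      refine ae_of_all _ fun x => ?_
      simp [S.nl.primitive_eq_zero le_rfl]
    linarith
  have hQ := quad_pos (s := s) hpos hw0
  obtain ⟨T, hT, hTn⟩ := S.exists_fiber_neg hH (quad s V₀ w) 0 hwp
  have h1 := S.quarter_le_fiber hH (quad s V₀ w) 0 T
  have h2 : 0 ≤ T ^ 2 * quad s V₀ w := by positivity
  obtain ⟨t, ht0, -, ht⟩ := S.exists_nehari_point hH hQ le_rfl hT (by linarith)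
  refine ⟨t • w, hH.smul t, smul_ne_zero ht0.ne' hw0, ?_⟩
  rw [quad_smul hH, integral_comp_smul_congr (fun y => f y * y) w t, ← ht]; ring

/-- Approximation by test functions, with control of the energy along rays. -/
lemma Setting.exists_test_fiber_near (S : Setting N s α p f) {w : L2 N} (hw : MemHs s w) (T : ℝ)
    {δ : ℝ} (hδ : 0 < δ) : ∃ η : L2 N, IsTest η ∧ quad s V₀ η ≤ quad s V₀ w + δ ∧
      ∀ t, 0 ≤ t → t ≤ T →
        (∫ x, primitive f (t * w x)) - δ ≤ ∫ x, primitive f (t * η x) := by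
  have hseq : ∀ n : ℕ, ∃ z k : L2 N, IsTest z ∧ HasFracLap (s / 2) z k ∧
      ‖z - w‖ < 1 / ((n : ℝ) + 1) ∧ ‖k - fracLap (s / 2) w‖ < 1 / ((n : ℝ) + 1) := fun n =>
    exists_test_near (by linarith [S.s_pos]) hw.hasFracLap Nat.one_div_pos_of_nat
  choose z k hz hk hzw hkw using hseq
  have h0 : Tendsto (fun n : ℕ => 1 / ((n : ℝ) + 1)) atTop (𝓝 0) :=
    tendsto_one_div_add_atTop_nhds_zero_nat
  have hle : ∀ n : ℕ, 1 / ((n : ℝ) + 1) ≤ 1 := fun n => by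
    rw [div_le_one (by positivity)]; linarith [n.cast_nonneg (α := ℝ)]
  have lz0 : Tendsto (fun n => ‖z n - w‖) atTop (𝓝 0) :=
    squeeze_zero (fun _ => norm_nonneg _) (fun n => (hzw n).le) h0
  have lz : Tendsto z atTop (𝓝 w) := tendsto_iff_norm_sub_tendsto_zero.2 lz0
  have lk : Tendsto k atTop (𝓝 (fracLap (s / 2) w)) := tendsto_iff_norm_sub_tendsto_zero.2
    (squeeze_zero (fun _ => norm_nonneg _) (fun n => (hkw n).le) h0)
  have hvf : ∀ n, HasFracLap (s / 2) (z n - w) (k n - fracLap (s / 2) w) := fun n =>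
    (hk n).sub hw.hasFracLap
  -- Strong convergence is a special case of local vanishing, so the splitting estimate applies to
  -- `z n = w + (z n - w)`; the term of the remainder is nonnegative.
  have hv : LocallyVanishing s fun n => z n - w := by
    refine ⟨fun n => ⟨_, hvf n⟩, ⟨1, fun n => ⟨(hzw n).le.trans (hle n), ?_⟩⟩, fun R => ?_⟩
    · rw [(hvf n).fracLap_eq]; exact (hkw n).le.trans (hle n)
    · refine squeeze_zero (fun n => integral_nonneg fun x => sq_nonneg _) (fun n => ?_)
        (g := fun n => ‖z n - w‖ ^ 2) (by simpa using lz0.pow 2)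
      rw [norm_sq_eq_integral_real]
      exact setIntegral_le_integral (integrable_sq _) (ae_of_all _ fun _ => sq_nonneg _)
  have lq : Tendsto (fun n => quad s V₀ (z n)) atTop (𝓝 (quad s V₀ w)) := by
    have e : (fun n => quad s V₀ (z n)) = fun n => ‖k n‖ ^ 2 + V₀ * ‖z n‖ ^ 2 := by
      ext n; rw [quad, (hk n).fracLap_eq]
    rw [e]
    exact (lk.norm.pow 2).add ((lz.norm.pow 2).const_mul V₀)
  obtain ⟨n, h1, h2⟩ := ((lq.eventually (gt_mem_nhds (show quad s V₀ w < quad s V₀ w + δ by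
    linarith))).and (S.eventually_split hw hv T hδ)).exists
  refine ⟨z n, hz n, h1.le, fun t ht0 htT => ?_⟩
  have h3 := (abs_le.1 (h2 t ht0 htT)).1
  rw [add_sub_cancel] at h3
  have h4 : 0 ≤ ∫ x, primitive f (t * (z n - w : L2 N) x) :=
    integral_nonneg fun x => S.nl.primitive_nonneg _
  linarith

/-- The condition `θ < α` makes the Poisson coupling vanish as `ε → 0`. -/
lemma tendsto_coef (hθ : θ < α) : Tendsto (fun ε => coef N α θ ε) (𝓝[>] 0) (𝓝 0) := by
  have h1 : ContinuousAt (fun ε : ℝ => ε ^ (α - θ)) 0 :=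
    Real.continuousAt_rpow_const _ _ (Or.inr (by linarith))
  have h2 := (h1.tendsto.mul_const (gammaConst N α)).mono_left
    (nhdsWithin_le_nhds (s := Ioi (0 : ℝ)))
  rw [Real.zero_rpow (by linarith), zero_mul] at h2
  exact h2

/-- Translating a test function to a minimum point of the potential. -/
lemma Setting.exists_translate (S : Setting N s α p f) (hV : Continuous V) {x₀ : E N}
    (hx₀ : V x₀ = V₀) (hθ : θ < α) {η : L2 N} (hη : IsTest η) {δ : ℝ} (hδ : 0 < δ) :
    ∃ ε' > 0, ∀ ε, 0 < ε → ε ≤ ε' → ∃ z : L2 N, MemW s V ε z ∧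
      innerW s V ε z z ≤ quad s V₀ η + δ ∧ poissonE α θ ε z ≤ δ ∧
      ∀ t, ∫ x, primitive f (t * z x) = ∫ x, primitive f (t * η x) := by
  have : Fact (1 ≤ pStar N α) := ⟨one_le_pStar S.alpha_pos S.alpha_lt⟩
  obtain ⟨h, h1, h2, h3⟩ := hη
  have hη' : η = testLp h1 h2 := Lp.ext (h3.trans (coeFn_testLp h1 h2).symm)
  subst hη'
  have hs2 : 0 ≤ s / 2 := by linarith [S.s_pos]
  have hHη : MemHs s (testLp h1 h2) := (isTest_testLp h1 h2).exists_hasFracLap hs2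
  obtain ⟨C, hC, hnorm⟩ := IsRiesz.norm_le (N := N) S.alpha_pos S.alpha_lt
  set A := (C * (eLpNorm (fun x => (h x) ^ 2) (cStar N α) volume).toReal) ^ 2
  -- The potential energy of the translate as a function of `ε`. Restriction to the compact support
  -- makes it continuous up to `ε = 0`, where the potential is frozen at its minimum.
  set Φ : ℝ → ℝ := fun ε => ∫ y in tsupport h, V (ε • y + x₀) * (h y) ^ 2 with hΦ
  have hΦc : Continuous Φ := by
    apply continuous_parametric_integral_of_continuous _ h2
    have := h1.continuous
    simp only [Function.uncurry_def]
    fun_prop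
  have hΦe : ∀ ε, Φ ε = ∫ y, V (ε • y + x₀) * (h y) ^ 2 := fun ε => by
    apply setIntegral_eq_integral_of_forall_compl_eq_zero
    intro x hx
    rw [image_eq_zero_of_notMem_tsupport hx]; simp
  have hΦ0 : Φ 0 = V₀ * ‖testLp h1 h2‖ ^ 2 := by
    rw [hΦe, norm_sq_eq_integral_real, ← integral_const_mul]
    apply integral_congr_ae
    filter_upwards [coeFn_testLp h1 h2] with x hx
    rw [hx, zero_smul, zero_add, hx₀]
  have l1 : ∀ᶠ ε in 𝓝[>] (0 : ℝ), Φ ε < Φ 0 + δ :=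
    ((hΦc.tendsto 0).mono_left nhdsWithin_le_nhds).eventually (gt_mem_nhds (by linarith))
  have l2 : ∀ᶠ ε in 𝓝[>] (0 : ℝ), coef N α θ ε * A < δ := by
    have := (tendsto_coef (N := N) hθ).mul_const A
    rw [zero_mul] at this
    exact this.eventually (gt_mem_nhds hδ)
  obtain ⟨ε', hε', hsub⟩ := mem_nhdsGT_iff_exists_Ioc_subset.1 (l1.and l2)
  refine ⟨ε', hε', fun ε hε hεε => ?_⟩
  obtain ⟨k1, k2⟩ := hsub ⟨hε, hεε⟩
  -- Centre of the minimum of `V(εx)`; around it the rescaled potential reads `V(εy + x₀)`.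
  set y₀ : E N := ε⁻¹ • x₀
  set z := testLp (contDiff_translate h1 y₀) (hasCompactSupport_translate h2 y₀) with hz
  have hzc := coeFn_testLp (contDiff_translate h1 y₀) (hasCompactSupport_translate h2 y₀)
  rw [← hz] at hzc
  have hzW : MemW s V ε z := (isTest_testLp _ _).memW S.s_pos hV
  refine ⟨z, hzW, ?_, ?_, fun t => ?_⟩
  · have e1 := norm_fracLap_translate h1 h2 y₀ hHη.hasFracLap hzW.1.hasFracLap
    have e2 : ∫ x, V (ε • x) * (z x) ^ 2 = Φ ε := by
      rw [hΦe, ← integral_sub_right_eq_self (fun y => V (ε • y + x₀) * (h y) ^ 2) y₀]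
      apply integral_congr_ae
      filter_upwards [hzc] with x hx
      rw [hx, smul_sub, smul_inv_smul₀ hε.ne', sub_add_cancel]
    rw [innerW_self, e1, e2, quad]
    linarith
  · obtain ⟨φ, g, hg, e⟩ := S.exists_poissonE_eq hzW.1
    have e1 : eLpNorm (fun x => (z x) ^ 2) (cStar N α) volume =
        eLpNorm (fun x => (h x) ^ 2) (cStar N α) volume := by
      have e2 : (fun x => (z x) ^ 2) =ᵐ[volume] (fun x => (h x) ^ 2) ∘ fun x => x - y₀ := by
        filter_upwards [hzc] with x hx
        rw [hx]; rfl
      rw [eLpNorm_congr_ae e2]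
      exact eLpNorm_comp_measurePreserving
        (h1.continuous.pow 2).aestronglyMeasurable (measurePreserving_sub_right volume y₀)
    have e3 := hnorm (S.memLp_sq hzW.1) hg
    rw [e1] at e3
    rw [e]
    have := S.coef_pos (θ := θ) hε
    calc coef N α θ ε * ‖g‖ ^ 2 ≤ coef N α θ ε * A := by
          gcongr
          exact pow_le_pow_left₀ (norm_nonneg _) e3 2
      _ ≤ δ := k2.le
  · rw [← integral_sub_right_eq_self (fun y => primitive f (t * testLp h1 h2 y)) y₀]
    have hq := (measurePreserving_sub_right volume y₀).quasiMeasurePreserving.ae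
      (coeFn_testLp h1 h2)
    apply integral_congr_ae
    filter_upwards [hzc, hq] with x hx1 hx2
    rw [hx1, hx2]

/-- For small `ε` the level of the Nehari manifold is almost below that of the autonomous problem
with potential `V₀`. -/
lemma Setting.exists_nehari_energy_le (S : Setting N s α p f) (hV : Continuous V)
    (hV₀ : ∀ x, V₀ ≤ V x) (hpos : 0 < V₀) {x₀ : E N} (hx₀ : V x₀ = V₀) (hθ : θ < α) {w : L2 N}
    (hw : MemHs s w) (hw0 : w ≠ 0) (hN : quad s V₀ w = ∫ x, f (w x) * w x) {δ : ℝ} (hδ : 0 < δ) :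
    ∃ ε' > 0, ∀ ε, 0 < ε → ε ≤ ε' → ∃ z ∈ nehari s α θ V f ε,
      energy s α θ V f ε z ≤ fiber f (quad s V₀ w) 0 w 1 + δ := by
  have hQ := quad_pos (s := s) hpos hw0
  obtain ⟨T, hT, hTn⟩ := S.exists_fiber_neg hw (quad s V₀ w) 0
    (S.integral_primitive_pos hw (S.not_nonpos_of_integral_pos (hN ▸ hQ)))
  set F₀ := fiber f (quad s V₀ w) 0 w
  set κ := 1 + T ^ 2 + T ^ 4
  have hκ : 0 < κ := by positivity
  -- The bound by `δ` is the final accuracy; the bound by `-F₀ T / 2` keeps the energy at `T z`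
  -- negative, which guarantees a Nehari point before `T`.
  set δ' := min δ (-F₀ T / 2) / κ with hδ'
  have hmin : 0 < min δ (-F₀ T / 2) := lt_min hδ (by linarith)
  have hδ'0 : 0 < δ' := by positivity
  have hδ'e : δ' * κ = min δ (-F₀ T / 2) := div_mul_cancel₀ _ hκ.ne'
  obtain ⟨η, hη, hη1, hη2⟩ := S.exists_test_fiber_near (V₀ := V₀) hw T hδ'0
  obtain ⟨ε', hε', H⟩ := S.exists_translate hV hx₀ hθ hη hδ'0
  refine ⟨ε', hε', fun ε hε hεε => ?_⟩
  obtain ⟨z, hzW, hz1, hz2, hz3⟩ := H ε hε hεε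
  have hkey : ∀ t, 0 ≤ t → t ≤ T → energy s α θ V f ε (t • z) ≤ F₀ t + δ' * κ := fun t ht0 htT => by
    rw [S.energy_smul hzW.1]
    have t2 : t ^ 2 ≤ T ^ 2 := by gcongr
    have t4 : t ^ 4 ≤ T ^ 4 := by gcongr
    have a1 : t ^ 2 * innerW s V ε z z ≤ t ^ 2 * (quad s V₀ w + δ' + δ') := by
      gcongr; linarith
    have a2 : t ^ 4 * poissonE α θ ε z ≤ t ^ 4 * δ' := by gcongr
    have a3 := mul_le_mul_of_nonneg_right t2 hδ'0.le
    have a4 := mul_le_mul_of_nonneg_right t4 hδ'0.le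
    have a5 := hη2 t ht0 htT
    have a6 : 0 ≤ T ^ 4 * δ' := by positivity
    have a7 : 0 ≤ t ^ 4 * δ' := by positivity
    simp only [F₀, κ, fiber]
    rw [hz3]
    linarith
  obtain ⟨t, ht0, htT, ht⟩ := S.exists_smul_mem_nehari (θ := θ) hV₀ hpos hε hzW hT (by
    have := hkey T hT.le le_rfl
    rw [hδ'e] at this
    have := min_le_right δ (-F₀ T / 2)
    linarith)
  refine ⟨_, ht, ?_⟩
  have h1 := hkey t ht0.le htT.le
  rw [hδ'e] at h1
  have h2 := min_le_left δ (-F₀ T / 2)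
  have h3 := S.fiber_le (D := 0) hw hQ.le (by rw [hN, add_zero]) ht0.le
  linarith

/-! ### Existence of ground states -/

/-- A ground state exists if the level lies below that of the problem at infinity. -/
theorem Setting.exists_isGroundState (S : Setting N s α p f) (hV : Continuous V)
    (hV₀ : ∀ x, V₀ ≤ V x) (hpos : 0 < V₀) (hε : 0 < ε) {μ R : ℝ} (hμ : 0 < μ)
    (hout : ∀ x, R ≤ ‖x‖ → μ ≤ V x) {m : ℝ}
    (hm : ∀ w : L2 N, MemHs s w → w ≠ 0 → quad s μ w = ∫ x, f (w x) * w x →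
      m ≤ fiber f (quad s μ w) 0 w 1)
    (hlt : ∃ z ∈ nehari s α θ V f ε, energy s α θ V f ε z < m) :
    ∃ u : L2 N, IsGroundState s α θ V f ε u := by
  obtain ⟨z, hz, hzm⟩ := hlt
  have hbdd : BddBelow (energy s α θ V f ε '' nehari s α θ V f ε) := by
    refine ⟨0, ?_⟩
    rintro _ ⟨u, hu, rfl⟩
    have h1 := S.quarter_innerW_le_energy hu
    have h2 := innerW_nonneg hV₀ hpos (mem_nehari_iff.1 hu).1
    linarith
  have hglb := isGLB_csInf ⟨_, mem_image_of_mem _ hz⟩ hbdd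
  have hout' : ∀ x : E N, R / ε ≤ ‖x‖ → μ ≤ V (ε • x) := fun x hx => by
    apply hout
    rw [norm_smul, Real.norm_of_nonneg hε.le]
    rwa [div_le_iff₀' hε] at hx
  obtain ⟨u, hu, hue⟩ := S.exists_minimiser hV hV₀ hpos hε hμ hout' hm hglb
    ((hglb.1 (mem_image_of_mem _ hz)).trans_lt hzm)
  exact ⟨u, S.isGroundState hV hV₀ hpos hu fun w hw => hue ▸ hglb.1 (mem_image_of_mem _ hw)⟩

lemma exists_le_of_lt_Vinf {μ : ℝ} (h : (μ : EReal) < Vinf V) :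
    ∃ R : ℝ, ∀ x, R ≤ ‖x‖ → μ ≤ V x := by
  have h1 := eventually_lt_of_lt_liminf h
  rw [← comap_norm_atTop, eventually_comap, eventually_atTop] at h1
  obtain ⟨R, hR⟩ := h1
  exact ⟨R, fun x hx => by exact_mod_cast (hR _ hx x rfl).le⟩

end Levels

end

end FracSP

/-! ### The two cases of the potential at infinity -/

theorem theorem3p6 (N : ℕ) (s α θ : ℝ)
    (hs : s ∈ Set.Ioo (0 : ℝ) 1) (hα : α ∈ Set.Ioo (0 : ℝ) N) (hθ : θ ∈ Set.Ioo (0 : ℝ) α)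
    (hN : (N : ℝ) ∈ Set.Ioo (2 * s) (2 * s + α))
    (V : FracSP.E N → ℝ) (hVcont : Continuous V)
    (V₀ : ℝ) (hVmin : IsLeast (Set.range V) V₀) (hVpos : 0 < V₀)
    (hVinf : (V₀ : EReal) < FracSP.Vinf V)
    (f : ℝ → ℝ) (hf₁ : ContDiff ℝ 1 f) (hf₁' : ∀ t ≤ 0, f t = 0)
    (hf₂ : Filter.Tendsto (fun t => f t / t) (nhdsWithin 0 {0}ᶜ) (nhds 0))
    (hf₃ : ∃ q₀ ∈ Set.Ioo (2 : ℝ) (2 * N / (N - 2 * s) - 1),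
      Filter.Tendsto (fun t => f t / t ^ q₀) Filter.atTop (nhds 0))
    (hf₄ : ∃ K : ℝ, 4 < K ∧ ∀ t > 0,
      0 < K * FracSP.primitive f t ∧ K * FracSP.primitive f t ≤ t * f t)
    (hf₅ : StrictMonoOn (fun t => f t / t ^ 3) (Set.Ioi 0)) :
    (FracSP.Vinf V < ⊤ → ∃ ε' > 0, ∀ ε : ℝ, 0 < ε → ε ≤ ε' →
      ∃ u : FracSP.L2 N, FracSP.IsGroundState s α θ V f ε u) ∧
    (FracSP.Vinf V = ⊤ → ∀ ε : ℝ, 0 < ε →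
      ∃ u : FracSP.L2 N, FracSP.IsGroundState s α θ V f ε u) := by
  obtain ⟨q₀, hq, hgrowth⟩ := hf₃
  -- With `p = q₀ + 1` the growth condition is of order `p - 1`, and `q₀ < 2*_s - 1` becomes
  -- subcriticality `p < 2*_s`.
  have S : FracSP.Setting N s α (q₀ + 1) f :=
    { s_pos := hs.1
      alpha_pos := hα.1
      alpha_lt := hα.2
      two_s_lt := hN.1
      p_lt := by linarith [hq.2]
      nl :=
        { cont := hf₁.continuous
          eq_zero := hf₁'
          small := hf₂
          growth := by simpa using hgrowth
          ambrosetti := hf₄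
          mono := hf₅ } }
  obtain ⟨⟨x₀, hx₀⟩, hlow⟩ := hVmin
  have hV₀ : ∀ x, V₀ ≤ V x := fun x => hlow (Set.mem_range_self x)
  refine ⟨fun _ => ?_, fun htop ε hε => ?_⟩
  · obtain ⟨μ, hμ, hμV⟩ := EReal.lt_iff_exists_real_btwn.1 hVinf
    have hμ' : V₀ < μ := by exact_mod_cast hμ
    obtain ⟨R, hR⟩ := FracSP.exists_le_of_lt_Vinf hμV
    -- The infimum of `A` is the level of the autonomous problem with potential `V₀`;
    -- near-minimisers suffice, its attainment is not needed.
    set A : Set ℝ := {e | ∃ w : FracSP.L2 N, FracSP.MemHs s w ∧ w ≠ 0 ∧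
      FracSP.quad s V₀ w = ∫ x, f (w x) * w x ∧ e = FracSP.fiber f (FracSP.quad s V₀ w) 0 w 1}
    have hbdd : BddBelow A := by
      refine ⟨0, ?_⟩
      rintro _ ⟨w, h1, _, h3, rfl⟩
      have h4 := S.quarter_quad_le_fiber h1 h3
      have h5 := FracSP.quad_nonneg (s := s) hVpos.le w
      linarith
    have hne : A.Nonempty := by
      obtain ⟨w, h1, h2, h3⟩ := S.exists_quad_eq hVpos
      exact ⟨_, w, h1, h2, h3, rfl⟩
    obtain ⟨d, hd, hgap⟩ := S.exists_level_gap hVpos hμ' (m := sInf A) fun w h1 h2 h3 =>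
      csInf_le hbdd ⟨w, h1, h2, h3, rfl⟩
    -- Choosing `w` costs `d/2` and transplanting it to the minimum of `V` another `d/4`, which
    -- stays below the gap `d`.
    obtain ⟨_, ⟨w, h1, h2, h3, rfl⟩, hlt⟩ := exists_lt_of_csInf_lt hne
      (show sInf A < sInf A + d / 2 by linarith)
    obtain ⟨ε', hε', H⟩ := S.exists_nehari_energy_le hVcont hV₀ hVpos hx₀ hθ.2 h1 h2 h3
      (show 0 < d / 4 by linarith)
    refine ⟨ε', hε', fun ε hε hεε => ?_⟩
    obtain ⟨z, hz, hze⟩ := H ε hε hεε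
    exact S.exists_isGroundState hVcont hV₀ hVpos hε (hVpos.trans hμ') hR hgap
      ⟨z, hz, by linarith⟩
  -- With `V` unbounded at infinity `μ` is free, so the level at infinity can be raised above the
  -- energy of any one Nehari point, for each `ε`.
  · obtain ⟨z, hz⟩ := S.nehari_nonempty (θ := θ) hVcont hV₀ hVpos hε
    obtain ⟨μ, hμ, hlev⟩ := S.exists_level_ge (FracSP.energy s α θ V f ε z + 1)
    obtain ⟨R, hR⟩ := FracSP.exists_le_of_lt_Vinf (V := V) (μ := μ)
      (by rw [htop]; exact EReal.coe_lt_top μ)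
    exact S.exists_isGroundState hVcont hV₀ hVpos hε hμ hR hlev ⟨z, hz, by linarith⟩
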